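/- Let $\kappa(x,y)=c_0/(|x-y|^{\Delta}+c_1)$ be a small-world kernel on $[0,1]$, where $\Delta>1$ and $0<c_0\le c_1$ (so $\kappa$ takes values in $(0,1]$), and let $\mathcal D$ be a probability distribution on $[0,1]$. Let $\mathcal K f(x)=\int\kappa(x,y)f(y)\,d\mathcal D(y)$ on $L^2(\mathcal D)$, assume that $\mathcal K$ has no negative eigenvalue, let $\lambda_1\ge\lambda_2\ge\cdots\ge 0$ be its eigenvalues with multiplicity (continued by zeros), and put $\delta_d=\lambda_d-\lambda_{d+1}$. Let $C(n)$ satisfy $C(n)\ge 1$ for all large $n$ and put $\rho(n)=n/C(n)$. In the simplified model on $n$ nodes, $x_1,\dots,x_n$ are i.i.d. from $\mathcal D$ and, given these, the entries $A_{ij}=A_{ji}\in\{0,1\}$, $i\le j$, of the adjacency matrix $A$ are independent with $\Pr[A_{ij}=1]=\kappa(x_i,x_j)/C(n)$. Let $K=(\kappa(x_i,x_j))_{i,j\le n}$ be the Gram matrix. For $M\in\{A,K\}$ let $\tilde U_M\tilde S_M\tilde V_M^{\mathsf T}$ be any singular value decomposition of $M$ with singular values in decreasing order; for $d\le n$ let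 $U_M$ consist of the first $d$ columns of $\tilde U_M$, and let $S_M$ be the $d\times d$ diagonal matrix of the $d$ largest singular values. Let $t=t(n)>0$ satisfy $t=o(\rho(n))$ and $t^2/\rho(n)=\omega(\log n)$, and suppose $\rho(n)=\omega(\log n)$. Let $d$ be the largest $d\in\{1,\dots,n\}$ with $\sigma_d(A/\rho(n))-\sigma_{d+1}(A/\rho(n))\ge 10\,(t/\rho(n))^{2/29}$, where $\sigma_i$ denotes the $i$-th largest singular value and $\sigma_{n+1}=0$. Then there is a constant $M_0>0$, depending only on $\kappa$ and $\mathcal D$, such that for every $c$ and all sufficiently large $n$, with probability larger than $1-n^{-c}$ the following holds: $d$ is well defined, $\delta_d>0$, and for every choice of the singular value decompositions there is an orthogonal $d\times d$ matrix $W$ with $$\left\|\sqrt{C(n)}\,U_AS_A^{1/2}W-U_KS_K^{1/2}\right\|_F\le M_0\,\frac{t\sqrt{dn}}{\delta_d^2\,\rho(n)} .$$ -/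

import Mathlib

open MeasureTheory ProbabilityTheory Filter Asymptotics
open scoped unitInterval Matrix

namespace LatentGraph

noncomputable section

/-- Parameters of a small-world kernel `κ(x, y) = c₀ / (|x - y| ^ Δ + c₁)` on `[0, 1]` with
`Δ > 1`; the condition `c₀ ≤ c₁` says that `κ` takes its values in `(0, 1]`. -/
structure SmallWorldKernel where
  c₀ : ℝ
  c₁ : ℝ
  Δ : ℝ
  c₀_pos : 0 < c₀
  c₀_le_c₁ : c₀ ≤ c₁
  one_lt_Δ : 1 < Δ

namespace SmallWorldKernel

/-- The kernel function `κ : [0, 1] × [0, 1] → (0, 1]`. -/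
def val (κ : SmallWorldKernel) (x y : I) : ℝ :=
  κ.c₀ / (|(x : ℝ) - (y : ℝ)| ^ κ.Δ + κ.c₁)

theorem denom_pos (κ : SmallWorldKernel) (x y : I) :
    0 < |(x : ℝ) - (y : ℝ)| ^ κ.Δ + κ.c₁ :=
  add_pos_of_nonneg_of_pos (Real.rpow_nonneg (abs_nonneg _) _) (κ.c₀_pos.trans_le κ.c₀_le_c₁)

theorem val_pos (κ : SmallWorldKernel) (x y : I) : 0 < κ.val x y :=
  div_pos κ.c₀_pos (κ.denom_pos x y)

theorem val_le_one (κ : SmallWorldKernel) (x y : I) : κ.val x y ≤ 1 := by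
  refine (div_le_one (κ.denom_pos x y)).2 (κ.c₀_le_c₁.trans ?_)
  exact le_add_of_nonneg_left (Real.rpow_nonneg (abs_nonneg _) _)

theorem val_comm (κ : SmallWorldKernel) (x y : I) : κ.val x y = κ.val y x := by
  unfold val
  rw [abs_sub_comm]

theorem continuous_val (κ : SmallWorldKernel) :
    Continuous (fun q : I × I => κ.val q.1 q.2) := by
  unfold val
  refine Continuous.div continuous_const ?_ (fun q => (κ.denom_pos q.1 q.2).ne')
  refine Continuous.add (Continuous.rpow_const (by fun_prop) ?_) continuous_const
  exact fun _ => Or.inr (zero_le_one.trans κ.one_lt_Δ.le)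

theorem integrable_val_mul (κ : SmallWorldKernel) (D : Measure I) [IsProbabilityMeasure D]
    (f : Lp ℝ 2 D) (x : I) : Integrable (fun y => κ.val x y * f y) D := by
  refine Integrable.bdd_mul (c := 1) ((Lp.memLp f).integrable one_le_two) ?_ ?_
  · exact (κ.continuous_val.comp (by fun_prop : Continuous fun y : I => (x, y))).aestronglyMeasurable
  · refine Eventually.of_forall fun y => ?_
    rw [Real.norm_of_nonneg (κ.val_pos x y).le]
    exact κ.val_le_one x y

theorem memLp_integral (κ : SmallWorldKernel) (D : Measure I) [IsProbabilityMeasure D]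
    (f : Lp ℝ 2 D) : MemLp (fun x => ∫ y, κ.val x y * f y ∂D) 2 D := by
  refine MemLp.of_bound (C := ∫ y, ‖f y‖ ∂D) ?_ (Eventually.of_forall fun x => ?_)
  · refine StronglyMeasurable.aestronglyMeasurable ?_
    refine StronglyMeasurable.integral_prod_right (f := fun x y => κ.val x y * f y) ?_
    exact κ.continuous_val.stronglyMeasurable.mul
      ((Lp.stronglyMeasurable f).comp_measurable measurable_snd)
  · refine norm_integral_le_of_norm_le ((Lp.memLp f).integrable one_le_two).norm
      (Eventually.of_forall fun y => ?_)
    rw [norm_mul, Real.norm_of_nonneg (κ.val_pos x y).le]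
    exact mul_le_of_le_one_left (norm_nonneg _) (κ.val_le_one x y)

/-- The integral operator `𝒦 f(x) = ∫ κ(x, y) f(y) dD(y)` on `L²(D)`. -/
def integralOperator (κ : SmallWorldKernel) (D : Measure I) [IsProbabilityMeasure D] :
    Module.End ℝ (Lp ℝ 2 D) where
  toFun f := (κ.memLp_integral D f).toLp
  map_add' f g := by
    rw [← MemLp.toLp_add]
    refine MemLp.toLp_congr _ _ (Eventually.of_forall fun x => ?_)
    simp only [Pi.add_apply]
    rw [← integral_add (κ.integrable_val_mul D f x) (κ.integrable_val_mul D g x)]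
    refine integral_congr_ae ?_
    filter_upwards [Lp.coeFn_add f g] with y hy
    rw [hy, Pi.add_apply, mul_add]
  map_smul' a f := by
    rw [RingHom.id_apply, ← MemLp.toLp_const_smul]
    refine MemLp.toLp_congr _ _ (Eventually.of_forall fun x => ?_)
    simp only [Pi.smul_apply, smul_eq_mul]
    rw [← integral_const_mul]
    refine integral_congr_ae ?_
    filter_upwards [Lp.coeFn_smul a f] with y hy
    rw [hy, Pi.smul_apply, smul_eq_mul]
    ring

end SmallWorldKernel

/-- `lam 0 ≥ lam 1 ≥ ⋯ ≥ 0` is the list of the eigenvalues of `T`, repeated according to their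
multiplicity and continued by zeros if there are only finitely many nonzero ones. (In particular
`T` has no negative eigenvalue.) -/
structure IsEigenvalueSequence {E : Type} [AddCommGroup E] [Module ℝ E] (T : Module.End ℝ E)
    (lam : ℕ → ℝ) : Prop where
  antitone : Antitone lam
  nonneg : ∀ i, 0 ≤ lam i
  multiplicity : ∀ μ : ℝ, μ ≠ 0 → Cardinal.mk {i // lam i = μ} = Module.rank ℝ (T.eigenspace μ)

/-- The eigengap `δ_d = λ_d - λ_{d+1}` for `d ≥ 1`, where `λ_i` is `lam (i - 1)`. -/
def eigengap (lam : ℕ → ℝ) (d : ℕ) : ℝ := lam (d - 1) - lam d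

/-- The Gram matrix `K` with entries `κ(x_i, x_j)`. -/
def gramMatrix (κ : SmallWorldKernel) {n : ℕ} (x : Fin n → I) : Matrix (Fin n) (Fin n) ℝ :=
  Matrix.of fun i j => κ.val (x i) (x j)

/-- The probability `κ(x_i, x_j) / C` of the edge `{i, j}`. The projection to `[0, 1]` does nothing
when `C ≥ 1`. -/
def edgeProb (κ : SmallWorldKernel) (C : ℝ) {n : ℕ} (x : Fin n → I) (e : Sym2 (Fin n)) : I :=
  Set.projIcc 0 1 zero_le_one
    (Sym2.lift ⟨fun i j => κ.val (x i) (x j) / C, fun i j => by simp only [κ.val_comm]⟩ e)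

theorem continuous_edgeProb (κ : SmallWorldKernel) (C : ℝ) {n : ℕ} (e : Sym2 (Fin n)) :
    Continuous (fun x : Fin n → I => edgeProb κ C x e) := by
  induction e using Sym2.ind with
  | _ i j =>
    refine continuous_projIcc.comp ?_
    exact (κ.continuous_val.comp
      (by fun_prop : Continuous fun x : Fin n → I => (x i, x j))).div_const C

/-- Given the latent positions `x`, the edges are independent and `e` is present with probability
`edgeProb κ C x e`. -/
def edgeKernel (κ : SmallWorldKernel) (C : ℝ) (n : ℕ) :
    Kernel (Fin n → I) (Sym2 (Fin n) → Bool) where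
  toFun x := Measure.pi fun e => bernoulliMeasure true false (edgeProb κ C x e)
  measurable' := by
    refine Measurable.measure_of_isPiSystem_of_isProbabilityMeasure
      (S := Set.univ.pi '' Set.univ.pi fun _ : Sym2 (Fin n) => {s : Set Bool | MeasurableSet s})
      generateFrom_pi.symm isPiSystem_pi ?_
    rintro _ ⟨s, hs, rfl⟩
    simp only [Measure.pi_pi]
    refine Finset.measurable_prod _ fun e _ => ?_
    have hm : Measurable fun x : Fin n → I => edgeProb κ C x e :=
      (continuous_edgeProb κ C e).measurable
    have h1 : Measurable fun x : Fin n → I => unitInterval.toNNReal (edgeProb κ C x e) :=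
      unitInterval.toNNReal_continuous.measurable.comp hm
    have h2 : Measurable fun x : Fin n → I =>
        unitInterval.toNNReal (unitInterval.symm (edgeProb κ C x e)) :=
      (unitInterval.toNNReal_continuous.comp unitInterval.continuous_symm).measurable.comp hm
    simp only [bernoulliMeasure_def, Measure.add_apply, Measure.smul_apply, ENNReal.smul_def,
      smul_eq_mul]
    exact (h1.coe_nnreal_ennreal.mul_const _).add (h2.coe_nnreal_ennreal.mul_const _)

instance (κ : SmallWorldKernel) (C : ℝ) (n : ℕ) : IsMarkovKernel (edgeKernel κ C n) :=
  ⟨fun x => (inferInstance : IsProbabilityMeasure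
    (Measure.pi fun e => bernoulliMeasure true false (edgeProb κ C x e)))⟩

/-- The law of `(x, e)` in the simplified model on `n` nodes: the latent positions `x_1, …, x_n` are
i.i.d. from `D` and, given `x`, the edges are independent and `{i, j}` (`i ≤ j`) is present with
probability `κ(x_i, x_j) / C`. -/
def modelLaw (κ : SmallWorldKernel) (D : Measure I) [IsProbabilityMeasure D] (C : ℝ) (n : ℕ) :
    Measure ((Fin n → I) × (Sym2 (Fin n) → Bool)) :=
  (Measure.pi fun _ => D) ⊗ₘ edgeKernel κ C n

/-- The symmetric `0/1` adjacency matrix. -/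
def adjacency {n : ℕ} (e : Sym2 (Fin n) → Bool) : Matrix (Fin n) (Fin n) ℝ :=
  Matrix.of fun i j => if e s(i, j) then 1 else 0

/-- The `i`-th largest singular value of a square matrix, `i = 1, 2, …`; it is `0` for `i > n`. -/
def singularValue {n : ℕ} (M : Matrix (Fin n) (Fin n) ℝ) (i : ℕ) : ℝ :=
  (Matrix.toEuclideanLin M).singularValues (i - 1)

/-- `M = U S Vᵀ` is a singular value decomposition, where `S` is the diagonal matrix of the singular
values of `M` in decreasing order. -/
def IsSVD {n : ℕ} (M U V : Matrix (Fin n) (Fin n) ℝ) : Prop :=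
  U ∈ Matrix.orthogonalGroup (Fin n) ℝ ∧ V ∈ Matrix.orthogonalGroup (Fin n) ℝ ∧
    M = U * Matrix.diagonal (fun i : Fin n => singularValue M (i + 1)) * Vᵀ

/-- The output `d` of the rule `DecideThreshold(t, ρ)`: the largest `d` for which
`λ_d(A/ρ) - λ_{d+1}(A/ρ) ≥ 10 (t/ρ)^(2/29)`, with `λ_i` the `i`-th singular value. -/
def IsThresholdIndex {n : ℕ} (A : Matrix (Fin n) (Fin n) ℝ) (t ρ : ℝ) (d : ℕ) : Prop :=
  IsGreatest {k : ℕ | 1 ≤ k ∧ k ≤ n ∧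
    10 * (t / ρ) ^ (2 / 29 : ℝ) ≤
      singularValue (ρ⁻¹ • A) k - singularValue (ρ⁻¹ • A) (k + 1)} d

/-- `U_M S_M^{1/2}`: the first `d` columns of the matrix `U` of left singular vectors of `M`, the
`j`-th one multiplied by the square root of the `j`-th singular value. -/
def topEmbedding {n d : ℕ} (h : d ≤ n) (M U : Matrix (Fin n) (Fin n) ℝ) :
    Matrix (Fin n) (Fin d) ℝ :=
  U.submatrix id (Fin.castLE h) *
    Matrix.diagonal (fun j : Fin d => √(singularValue M (j + 1)))

open scoped Matrix.Norms.Frobenius in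
/-- The Frobenius norm. -/
def frobeniusNorm {m n : ℕ} (M : Matrix (Fin m) (Fin n) ℝ) : ℝ := ‖M‖

end

end LatentGraph

/-!
Write `h = (t / ρ) ^ (2 / 29)`. Two facts about typical samples drive the theorem.

* The noise satisfies `‖A - K / C‖ ≤ t`. Exchanging one entry of the noise with an independent copy
  bounds its trace moment of order `2 * s` by `s ^ s` times the `s`-th moment of the variance proxy,
  which is diagonal with entries of the size of a degree. Taking `s` of order `log n` and applying
  Markov's inequality gives tails below any power of `n`.
* Cut `[0, 1]` into cells. Up to the unitary change from counting to empirical measure, `K / n` is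
  the integral operator of the empirical measure. It and `𝒦` are both close to the same finite
  matrix once the cell masses agree, which Hoeffding's inequality provides. Hence the quadratic
  forms and singular values of `K / n` and the eigenvalues of `𝒦` agree up to `h`.

By Weyl's inequality the singular values of `A / ρ` agree with the eigenvalues of `𝒦` up to `2 * h`.
Hence a gap `10 * h` of `A / ρ` exists once `𝒦` has a gap `14 * h`, which happens because `h → 0`,
and it forces `δ_d ≥ 6 * h`. Behind such a gap the noise moves each of the top singular vectors by a
multiple of `(t / ρ) / δ_d`, and `W` is the orthogonal polar factor of the cross Gram matrix of the
two bases. This matrix is invertible if the squared displacements of the `d` vectors sum to less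
than one; they do, as `𝒦` has Hilbert–Schmidt norm at most one and so `d * δ_d ^ 2 ≤ 1`.
-/

namespace LatentGraph

noncomputable section

section TraceInequality

theorem pow_mul_pow_add_pow_mul_pow_le {a b : ℝ} (ha : 0 ≤ a) (hb : 0 ≤ b) (r s : ℕ) :
    a ^ r * b ^ s + b ^ r * a ^ s ≤ a ^ (r + s) + b ^ (r + s) := by
  rw [pow_add, pow_add]
  rcases le_total a b with h | h
  · exact mul_add_mul_le_mul_add_mul (pow_le_pow_left₀ ha h r) (pow_le_pow_left₀ ha h s)
  · linarith [mul_add_mul_le_mul_add_mul (pow_le_pow_left₀ hb h r) (pow_le_pow_left₀ hb h s)]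

theorem sum_range_pow_mul_pow_le (y z : ℝ) (n : ℕ) :
    ∑ r ∈ Finset.range (n + 1), y ^ r * z ^ (n - r) ≤ (n + 1) / 2 * (|y| ^ n + |z| ^ n) := by
  set f : ℕ → ℝ := fun r => |y| ^ r * |z| ^ (n - r)
  have hreflect : ∑ r ∈ Finset.range (n + 1), f (n - r) = ∑ r ∈ Finset.range (n + 1), f r :=
    Finset.sum_range_reflect f (n + 1)
  have hpair : ∑ r ∈ Finset.range (n + 1), (f r + f (n - r)) ≤
      ∑ _r ∈ Finset.range (n + 1), (|y| ^ n + |z| ^ n) := by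
    refine Finset.sum_le_sum fun r hr => ?_
    have hrn : r ≤ n := Nat.lt_succ_iff.1 (Finset.mem_range.1 hr)
    have h := pow_mul_pow_add_pow_mul_pow_le (abs_nonneg y) (abs_nonneg z) r (n - r)
    rw [Nat.add_sub_cancel' hrn] at h
    simpa only [f, Nat.sub_sub_self hrn, mul_comm (|z| ^ r)] using h
  have habs : ∑ r ∈ Finset.range (n + 1), y ^ r * z ^ (n - r) ≤ ∑ r ∈ Finset.range (n + 1), f r :=
    Finset.sum_le_sum fun r _ => (le_abs_self _).trans_eq (by rw [abs_mul, abs_pow, abs_pow])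
  rw [Finset.sum_add_distrib, hreflect, Finset.sum_const, Finset.card_range, nsmul_eq_mul] at hpair
  push_cast at hpair
  linarith

theorem sub_mul_pow_sub_pow_le (y z : ℝ) (q : ℕ) :
    (y - z) * (y ^ (2 * q + 1) - z ^ (2 * q + 1)) ≤
      (2 * q + 1) / 2 * ((y - z) ^ 2 * (y ^ (2 * q) + z ^ (2 * q))) := by
  have hsum := sum_range_pow_mul_pow_le y z (2 * q)
  rw [(even_two_mul q).pow_abs, (even_two_mul q).pow_abs] at hsum
  have hgeom := (Commute.all y z).geom_sum₂_mul (2 * q + 1)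
  rw [Nat.add_sub_cancel] at hgeom
  rw [← hgeom]
  push_cast at hsum
  linarith [mul_le_mul_of_nonneg_left hsum (sq_nonneg (y - z))]

theorem succ_mul_mul_pow_le {a y : ℝ} (ha : 0 ≤ a) (hy : 0 ≤ y) (q : ℕ) :
    (q + 1) * (a * y ^ q) ≤ a ^ (q + 1) + q * y ^ (q + 1) := by
  induction q with
  | zero => simp
  | succ q ih =>
    have hmixed := pow_mul_pow_add_pow_mul_pow_le ha hy (q + 1) 1
    have hstep := mul_le_mul_of_nonneg_right ih hy
    push_cast
    ring_nf at hmixed hstep ⊢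
    linarith

variable {N : Type*} [Fintype N] [DecidableEq N]

theorem isHermitian_pow_eq {Y : Matrix N N ℝ} (hY : Y.IsHermitian) (r : ℕ) :
    Y ^ r = (hY.eigenvectorUnitary : Matrix N N ℝ) *
      Matrix.diagonal (fun i => hY.eigenvalues i ^ r) *
        star (hY.eigenvectorUnitary : Matrix N N ℝ) := by
  conv_lhs => rw [hY.spectral_theorem, ← map_pow, Matrix.diagonal_pow,
    Unitary.conjStarAlgAut_apply]
  rfl

/-- The squared inner product of the `i`-th eigenvector of `Y` and the `j`-th eigenvector of `Z`.
All mixed trace moments of `Y` and `Z` are combinations of the eigenvalues with these weights, which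
reduces trace inequalities to inequalities between real numbers. -/
def eigenOverlap {Y Z : Matrix N N ℝ} (hY : Y.IsHermitian) (hZ : Z.IsHermitian) (i j : N) : ℝ :=
  (star (hY.eigenvectorUnitary : Matrix N N ℝ) * (hZ.eigenvectorUnitary : Matrix N N ℝ)) i j ^ 2

theorem trace_diagonal_mul_mul_diagonal_mul_transpose (G : Matrix N N ℝ) (y z : N → ℝ) :
    (Matrix.diagonal y * G * Matrix.diagonal z * Gᵀ).trace =
      ∑ i, ∑ j, G i j ^ 2 * (y i * z j) := by
  simp only [Matrix.trace, Matrix.diag, Matrix.mul_apply (N := Gᵀ), Matrix.mul_diagonal,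
    Matrix.diagonal_mul, Matrix.transpose_apply]
  exact Finset.sum_congr rfl fun i _ => Finset.sum_congr rfl fun j _ => by ring

theorem trace_pow_mul_pow {Y Z : Matrix N N ℝ} (hY : Y.IsHermitian) (hZ : Z.IsHermitian)
    (r s : ℕ) : (Y ^ r * Z ^ s).trace =
      ∑ i, ∑ j, eigenOverlap hY hZ i j * (hY.eigenvalues i ^ r * hZ.eigenvalues j ^ s) := by
  rw [isHermitian_pow_eq hY, isHermitian_pow_eq hZ]
  set U := (hY.eigenvectorUnitary : Matrix N N ℝ)
  set V := (hZ.eigenvectorUnitary : Matrix N N ℝ)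
  have hGt : (star U * V)ᵀ = star V * U := by
    simp [Matrix.star_eq_conjTranspose, Matrix.transpose_mul]
  have htrace := trace_diagonal_mul_mul_diagonal_mul_transpose (star U * V)
    (fun i => hY.eigenvalues i ^ r) (fun j => hZ.eigenvalues j ^ s)
  rw [hGt] at htrace
  refine Eq.trans ?_ htrace
  rw [mul_assoc, mul_assoc, Matrix.trace_mul_comm]
  simp only [mul_assoc]

theorem eigenOverlap_nonneg {Y Z : Matrix N N ℝ} (hY : Y.IsHermitian) (hZ : Z.IsHermitian)
    (i j : N) : 0 ≤ eigenOverlap hY hZ i j :=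
  sq_nonneg _

theorem trace_mul_pow_nonneg {Y Z : Matrix N N ℝ} (hY : Y.IsHermitian) (hZ : Z.PosSemidef)
    (q : ℕ) : 0 ≤ (Z * Y ^ (2 * q)).trace := by
  rw [← pow_one Z, trace_pow_mul_pow hZ.isHermitian hY]
  refine Finset.sum_nonneg fun i _ => Finset.sum_nonneg fun j _ => ?_
  exact mul_nonneg (eigenOverlap_nonneg _ _ i j)
    (mul_nonneg (pow_nonneg (hZ.eigenvalues_nonneg i) 1) ((even_two_mul q).pow_nonneg _))

theorem trace_sub_sq_mul_pow (Y Z : Matrix N N ℝ) (m : ℕ) :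
    ((Y - Z) ^ 2 * Y ^ m).trace =
      (Y ^ (m + 2)).trace - 2 * (Y ^ (m + 1) * Z).trace + (Y ^ m * Z ^ 2).trace := by
  have hexpand : (Y - Z) ^ 2 * Y ^ m =
      Y ^ (m + 2) - Z * Y ^ (m + 1) - Y * (Z * Y ^ m) + Z ^ 2 * Y ^ m := by
    rw [pow_succ' Y (m + 1), pow_succ' Y m]
    noncomm_ring
  rw [hexpand, Matrix.trace_add, Matrix.trace_sub, Matrix.trace_sub, Matrix.trace_mul_comm Z,
    Matrix.trace_mul_comm Y, Matrix.trace_mul_comm (Z ^ 2), mul_assoc, ← pow_succ,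
    Matrix.trace_mul_comm Z]
  ring

theorem trace_sub_mul_pow_sub_pow_le {Y Z : Matrix N N ℝ} (hY : Y.IsHermitian)
    (hZ : Z.IsHermitian) (q : ℕ) :
    ((Y - Z) * (Y ^ (2 * q + 1) - Z ^ (2 * q + 1))).trace ≤
      (2 * q + 1) / 2 * ((Y - Z) ^ 2 * (Y ^ (2 * q) + Z ^ (2 * q))).trace := by
  have hleft : ((Y - Z) * (Y ^ (2 * q + 1) - Z ^ (2 * q + 1))).trace =
      (Y ^ (2 * q + 2) * Z ^ 0).trace - (Y ^ 1 * Z ^ (2 * q + 1)).trace -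
        (Y ^ (2 * q + 1) * Z ^ 1).trace + (Y ^ 0 * Z ^ (2 * q + 2)).trace := by
    simp only [sub_mul, mul_sub, Matrix.trace_sub, ← pow_succ', pow_zero, mul_one, one_mul, pow_one,
      Matrix.trace_mul_comm Z]
    ring
  have hright : ((Y - Z) ^ 2 * (Y ^ (2 * q) + Z ^ (2 * q))).trace =
      (Y ^ (2 * q + 2) * Z ^ 0).trace - 2 * (Y ^ (2 * q + 1) * Z ^ 1).trace +
        (Y ^ (2 * q) * Z ^ 2).trace + (Y ^ 2 * Z ^ (2 * q)).trace -
          2 * (Y ^ 1 * Z ^ (2 * q + 1)).trace + (Y ^ 0 * Z ^ (2 * q + 2)).trace := by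
    have hswap : (Y - Z) ^ 2 = (Z - Y) ^ 2 := by rw [← neg_sub, neg_sq]
    rw [mul_add, Matrix.trace_add, trace_sub_sq_mul_pow Y Z, hswap, trace_sub_sq_mul_pow Z Y]
    simp only [Matrix.trace_mul_comm (Z ^ _), pow_zero, pow_one, mul_one, one_mul]
    ring
  rw [hleft, hright]
  simp only [trace_pow_mul_pow hY hZ, Finset.mul_sum, ← Finset.sum_add_distrib,
    ← Finset.sum_sub_distrib]
  refine Finset.sum_le_sum fun i _ => Finset.sum_le_sum fun j _ => ?_
  have h := mul_le_mul_of_nonneg_left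
    (sub_mul_pow_sub_pow_le (hY.eigenvalues i) (hZ.eigenvalues j) q)
    (eigenOverlap_nonneg hY hZ i j)
  ring_nf at h ⊢
  linarith

theorem succ_mul_trace_mul_pow_le {Y V : Matrix N N ℝ} (hY : Y.IsHermitian) (hV : V.PosSemidef)
    (q : ℕ) :
    (q + 1) * (V * Y ^ (2 * q)).trace ≤ (V ^ (q + 1)).trace + q * (Y ^ (2 * (q + 1))).trace := by
  have hleft := trace_pow_mul_pow hV.isHermitian hY 1 (2 * q)
  have hpowV := trace_pow_mul_pow hV.isHermitian hY (q + 1) 0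
  have hpowY := trace_pow_mul_pow hV.isHermitian hY 0 (2 * (q + 1))
  simp only [pow_zero, pow_one, mul_one, one_mul] at hleft hpowV hpowY
  rw [hleft, hpowV, hpowY]
  simp only [Finset.mul_sum, ← Finset.sum_add_distrib]
  refine Finset.sum_le_sum fun i _ => Finset.sum_le_sum fun j _ => ?_
  have h := mul_le_mul_of_nonneg_left
    (succ_mul_mul_pow_le (hV.eigenvalues_nonneg i) (sq_nonneg (hY.eigenvalues j)) q)
    (eigenOverlap_nonneg hV.isHermitian hY i j)
  simp only [← pow_mul] at h
  linarith

theorem trace_pow_eq_sum_eigenvalues_pow {Y : Matrix N N ℝ} (hY : Y.IsHermitian) (r : ℕ) :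
    (Y ^ r).trace = ∑ i, hY.eigenvalues i ^ r := by
  rw [isHermitian_pow_eq hY, Matrix.trace_mul_comm, ← mul_assoc, Unitary.coe_star_mul_self, one_mul,
    Matrix.trace_diagonal]

theorem norm_toEuclideanLin_le_of_abs_eigenvalues_le {Y : Matrix N N ℝ} (hY : Y.IsHermitian)
    {t : ℝ} (ht : 0 ≤ t) (h : ∀ i, |hY.eigenvalues i| ≤ t) (v : EuclideanSpace ℝ N) :
    ‖Matrix.toEuclideanLin Y v‖ ≤ t * ‖v‖ := by
  have hcoord (i : N) : hY.eigenvectorBasis.repr (Matrix.toEuclideanLin Y v) i =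
      hY.eigenvalues i * hY.eigenvectorBasis.repr v i := by
    have hsymm := Matrix.isSymmetric_toEuclideanLin_iff.2 hY
    rw [OrthonormalBasis.repr_apply_apply, OrthonormalBasis.repr_apply_apply, ← hsymm,
      Matrix.toLpLin_apply, hY.mulVec_eigenvectorBasis, WithLp.toLp_smul, real_inner_smul_left]
  refine le_of_sq_le_sq ?_ (by positivity)
  rw [mul_pow, ← hY.eigenvectorBasis.repr.norm_map, ← hY.eigenvectorBasis.repr.norm_map v,
    EuclideanSpace.real_norm_sq_eq, EuclideanSpace.real_norm_sq_eq, Finset.mul_sum]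
  refine Finset.sum_le_sum fun i _ => ?_
  rw [hcoord, mul_pow]
  exact mul_le_mul_of_nonneg_right (sq_le_sq.2 ((h i).trans (le_abs_self t))) (sq_nonneg _)

theorem norm_toEuclideanLin_le_of_trace_pow_le {Y : Matrix N N ℝ} (hY : Y.IsHermitian) {t : ℝ}
    (ht : 0 ≤ t) {s : ℕ} (hs : s ≠ 0) (h : (Y ^ (2 * s)).trace ≤ t ^ (2 * s))
    (v : EuclideanSpace ℝ N) : ‖Matrix.toEuclideanLin Y v‖ ≤ t * ‖v‖ := by
  refine norm_toEuclideanLin_le_of_abs_eigenvalues_le hY ht (fun i => ?_) v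
  rw [trace_pow_eq_sum_eigenvalues_pow hY] at h
  refine le_of_pow_le_pow_left₀ (n := 2 * s) (by positivity) ht ?_
  rw [(even_two_mul s).pow_abs]
  exact (Finset.single_le_sum (f := fun i => hY.eigenvalues i ^ (2 * s))
    (fun i _ => (even_two_mul s).pow_nonneg _) (Finset.mem_univ i)).trans h

end TraceInequality

section Resampling

variable {ι α : Type*}

theorem integral_sub_sq_mul [Fintype ι] [Finite α] [MeasurableSpace α] [MeasurableSingletonClass α]
    {μ : ι → Measure α} [∀ i, IsProbabilityMeasure (μ i)] {e : ι} {X : α → ℝ}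
    (hX : ∫ b, X b ∂μ e = 0) (F : (ι → α) → ℝ) :
    ∫ p, (X (p.1 e) - X p.2) ^ 2 * F p.1 ∂(Measure.pi μ).prod (μ e) =
      ∫ ω, (X (ω e) ^ 2 + ∫ b, X b ^ 2 ∂μ e) * F ω ∂Measure.pi μ := by
  rw [integral_prod _ .of_finite]
  refine integral_congr_ae (.of_forall fun ω => ?_)
  have hexpand (b : α) : (X (ω e) - X b) ^ 2 = X (ω e) ^ 2 - 2 * X (ω e) * X b + X b ^ 2 := by ring
  simp only [integral_mul_const, hexpand]
  rw [integral_add .of_finite .of_finite, integral_sub .of_finite .of_finite, integral_const_mul,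
    hX, integral_const, probReal_univ, one_smul, mul_zero, sub_zero]

variable [DecidableEq ι]

/-- Exchange the `e`-th coordinate of a point with an independent copy of it. -/
def resample (e : ι) (p : (ι → α) × α) : (ι → α) × α :=
  (Function.update p.1 e p.2, p.1 e)

theorem resample_preimage_prod (e : ι) (s : ι → Set α) (t : Set α) :
    resample e ⁻¹' (Set.univ.pi s ×ˢ t) = Set.univ.pi (Function.update s e t) ×ˢ s e := by
  ext p
  simp only [resample, Set.mem_preimage, Set.mem_prod, Set.mem_univ_pi]
  rw [Function.forall_update_iff p.1 fun i a => a ∈ s i,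
    Function.forall_update_iff s fun i u => p.1 i ∈ u]
  tauto

variable [MeasurableSpace α]

theorem measurable_resample (e : ι) : Measurable (resample (α := α) e) :=
  measurable_update'.prodMk (by fun_prop)

variable [Fintype ι] (μ : ι → Measure α) [∀ i, IsProbabilityMeasure (μ i)]

theorem measurePreserving_resample (e : ι) :
    MeasurePreserving (resample e) ((Measure.pi μ).prod (μ e)) ((Measure.pi μ).prod (μ e)) := by
  refine ⟨measurable_resample e, (Measure.prod_eq_generateFrom generateFrom_pi
    MeasurableSpace.generateFrom_measurableSet isPiSystem_pi
    MeasurableSpace.isPiSystem_measurableSet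
    (Measure.FiniteSpanningSetsIn.pi fun i => (μ i).toFiniteSpanningSetsIn)
    (μ e).toFiniteSpanningSetsIn ?_).symm⟩
  rintro _ ⟨s, hs, rfl⟩ t ht
  have hbox : MeasurableSet (Set.univ.pi s ×ˢ t) :=
    (MeasurableSet.univ_pi fun i => hs i (Set.mem_univ i)).prod ht
  have hrest : ∏ i ∈ Finset.univ.erase e, μ i (Function.update s e t i) =
      ∏ i ∈ Finset.univ.erase e, μ i (s i) :=
    Finset.prod_congr rfl fun i hi => by rw [Function.update_of_ne (Finset.ne_of_mem_erase hi)]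
  rw [Measure.map_apply (measurable_resample e) hbox, resample_preimage_prod, Measure.prod_prod,
    Measure.pi_pi, Measure.pi_pi, ← Finset.mul_prod_erase Finset.univ _ (Finset.mem_univ e),
    ← Finset.mul_prod_erase Finset.univ (fun i => μ i (s i)) (Finset.mem_univ e), hrest,
    Function.update_self]
  ring

variable [Finite α] [MeasurableSingletonClass α]

theorem integral_comp_resample (e : ι) (f : (ι → α) × α → ℝ) :
    ∫ p, f (resample e p) ∂(Measure.pi μ).prod (μ e) = ∫ p, f p ∂(Measure.pi μ).prod (μ e) := by
  conv_rhs => rw [← (measurePreserving_resample μ e).map_eq]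
  exact (integral_map (measurable_resample e).aemeasurable Integrable.of_finite.1).symm

variable {μ}

theorem integral_mul_eq_integral_resample {e : ι} {X : α → ℝ} (hX : ∫ b, X b ∂μ e = 0)
    (G : (ι → α) → ℝ) :
    ∫ ω, X (ω e) * G ω ∂Measure.pi μ =
      1 / 2 * ∫ p, (X (p.1 e) - X p.2) * (G p.1 - G (resample e p).1)
        ∂(Measure.pi μ).prod (μ e) := by
  have hexpand (p : (ι → α) × α) : (X (p.1 e) - X p.2) * (G p.1 - G (resample e p).1) =
      X (p.1 e) * G p.1 - G p.1 * X p.2 - (G (resample e p).1 * X (resample e p).2 -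
        X ((resample e p).1 e) * G (resample e p).1) := by
    simp only [resample, Function.update_self]
    ring
  have hindep : ∫ p : (ι → α) × α, G p.1 * X p.2 ∂(Measure.pi μ).prod (μ e) = 0 := by
    rw [integral_prod_mul, hX, mul_zero]
  have hfst : ∫ p : (ι → α) × α, X (p.1 e) * G p.1 ∂(Measure.pi μ).prod (μ e) =
      ∫ ω, X (ω e) * G ω ∂Measure.pi μ := by
    simpa using integral_fun_fst (μ := Measure.pi μ) (ν := μ e) fun ω => X (ω e) * G ω
  simp only [hexpand]
  rw [integral_sub .of_finite .of_finite, integral_sub .of_finite .of_finite,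
    integral_comp_resample μ e fun p => G p.1 * X p.2 - X (p.1 e) * G p.1,
    integral_sub .of_finite .of_finite, hindep, hfst]
  ring

end Resampling

section TraceMoments

variable {ι α N : Type*} [Fintype ι]

/-- The random matrix `∑ₑ Xₑ(ωₑ) Hₑ` with independent random coefficients. -/
def coordinateSum (X : ι → α → ℝ) (H : ι → Matrix N N ℝ) (ω : ι → α) : Matrix N N ℝ :=
  ∑ e, X e (ω e) • H e

theorem isHermitian_coordinateSum (X : ι → α → ℝ) {H : ι → Matrix N N ℝ}
    (hH : ∀ e, (H e).IsHermitian) (ω : ι → α) : (coordinateSum X H ω).IsHermitian :=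
  isSelfAdjoint_sum _ fun e _ => (hH e).smul (IsSelfAdjoint.all _)

theorem coordinateSum_sub_update [DecidableEq ι] (X : ι → α → ℝ) (H : ι → Matrix N N ℝ)
    (ω : ι → α) (e : ι) (b : α) :
    coordinateSum X H ω - coordinateSum X H (Function.update ω e b) =
      (X e (ω e) - X e b) • H e := by
  rw [coordinateSum, coordinateSum, ← Finset.sum_sub_distrib, Finset.sum_eq_single e]
  · rw [Function.update_self, sub_smul]
  · intro i _ hi
    rw [Function.update_of_ne hi, sub_self]
  · exact fun h => absurd (Finset.mem_univ e) h

variable [Fintype N] [DecidableEq N] [MeasurableSpace α]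

/-- The variance proxy `∑ₑ (Xₑ(ωₑ)² + 𝔼 Xₑ²) Hₑ²` of the random matrix `∑ₑ Xₑ Hₑ`: up to the
factor `2`, the conditional variance of its increment when one coefficient is resampled. -/
def varianceProxy (μ : ι → Measure α) (X : ι → α → ℝ) (H : ι → Matrix N N ℝ) (ω : ι → α) :
    Matrix N N ℝ :=
  ∑ e, (X e (ω e) ^ 2 + ∫ b, X e b ^ 2 ∂μ e) • H e ^ 2

theorem posSemidef_varianceProxy (μ : ι → Measure α) (X : ι → α → ℝ) {H : ι → Matrix N N ℝ}
    (hH : ∀ e, (H e).IsHermitian) (ω : ι → α) : (varianceProxy μ X H ω).PosSemidef := by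
  refine Matrix.posSemidef_sum _ fun e _ => Matrix.PosSemidef.smul ?_
    (add_nonneg (sq_nonneg _) (integral_nonneg fun b => sq_nonneg _))
  rw [sq]
  simpa only [(hH e).eq] using Matrix.posSemidef_conjTranspose_mul_self (H e)

variable [Finite α] [MeasurableSingletonClass α] {μ : ι → Measure α}
  [∀ e, IsProbabilityMeasure (μ e)] {X : ι → α → ℝ} {H : ι → Matrix N N ℝ}

theorem integral_mul_trace_mul_pow_le (hX : ∀ e, ∫ b, X e b ∂μ e = 0)
    (hH : ∀ e, (H e).IsHermitian) (q : ℕ) (e : ι) :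
    ∫ ω, X e (ω e) * (H e * coordinateSum X H ω ^ (2 * q + 1)).trace ∂Measure.pi μ ≤
      (2 * q + 1) / 2 * ∫ ω, (X e (ω e) ^ 2 + ∫ b, X e b ^ 2 ∂μ e) *
        (H e ^ 2 * coordinateSum X H ω ^ (2 * q)).trace ∂Measure.pi μ := by
  classical
  set F : (ι → α) → ℝ := fun ω => (H e ^ 2 * coordinateSum X H ω ^ (2 * q)).trace
  set P := (Measure.pi μ).prod (μ e)
  have hpointwise (p : (ι → α) × α) :
      (X e (p.1 e) - X e p.2) * ((H e * coordinateSum X H p.1 ^ (2 * q + 1)).trace -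
        (H e * coordinateSum X H (resample e p).1 ^ (2 * q + 1)).trace) ≤
      (2 * q + 1) / 2 * ((X e (p.1 e) - X e p.2) ^ 2 * F p.1 +
        (X e ((resample e p).1 e) - X e (resample e p).2) ^ 2 * F (resample e p).1) := by
    have h := trace_sub_mul_pow_sub_pow_le (isHermitian_coordinateSum X hH p.1)
      (isHermitian_coordinateSum X hH (resample e p).1) q
    simp only [resample] at h ⊢
    rw [coordinateSum_sub_update, smul_pow, smul_mul_assoc, smul_mul_assoc, Matrix.trace_smul,
      Matrix.trace_smul, mul_sub, mul_add, Matrix.trace_sub, Matrix.trace_add, smul_eq_mul,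
      smul_eq_mul] at h
    rw [Function.update_self]
    exact h.trans_eq (by ring)
  have hsymm := integral_comp_resample μ e fun p => (X e (p.1 e) - X e p.2) ^ 2 * F p.1
  rw [integral_mul_eq_integral_resample (hX e), ← integral_sub_sq_mul (hX e) F]
  calc 1 / 2 * ∫ p, (X e (p.1 e) - X e p.2) * ((H e * coordinateSum X H p.1 ^ (2 * q + 1)).trace -
        (H e * coordinateSum X H (resample e p).1 ^ (2 * q + 1)).trace) ∂P
      ≤ 1 / 2 * ∫ p, (2 * q + 1) / 2 * ((X e (p.1 e) - X e p.2) ^ 2 * F p.1 +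
        (X e ((resample e p).1 e) - X e (resample e p).2) ^ 2 * F (resample e p).1) ∂P :=
        mul_le_mul_of_nonneg_left (integral_mono .of_finite .of_finite hpointwise) (by norm_num)
    _ = (2 * q + 1) / 2 * ∫ p, (X e (p.1 e) - X e p.2) ^ 2 * F p.1 ∂P := by
        rw [integral_const_mul, integral_add .of_finite .of_finite, hsymm]
        ring

theorem integral_trace_pow_le_integral_trace_varianceProxy_mul (hX : ∀ e, ∫ b, X e b ∂μ e = 0)
    (hH : ∀ e, (H e).IsHermitian) (q : ℕ) :
    ∫ ω, (coordinateSum X H ω ^ (2 * (q + 1))).trace ∂Measure.pi μ ≤ (2 * q + 1) / 2 *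
      ∫ ω, (varianceProxy μ X H ω * coordinateSum X H ω ^ (2 * q)).trace ∂Measure.pi μ := by
  have hleft (ω : ι → α) : (coordinateSum X H ω ^ (2 * (q + 1))).trace =
      ∑ e, X e (ω e) * (H e * coordinateSum X H ω ^ (2 * q + 1)).trace := by
    rw [mul_add_one, pow_succ' _ (2 * q + 1)]
    conv_lhs => enter [1, 1]; rw [coordinateSum]
    simp only [Finset.sum_mul, Matrix.trace_sum, smul_mul_assoc, Matrix.trace_smul, smul_eq_mul]
  simp only [hleft, varianceProxy, Finset.sum_mul, Matrix.trace_sum, smul_mul_assoc,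
    Matrix.trace_smul, smul_eq_mul]
  rw [integral_finsetSum _ fun _ _ => .of_finite, integral_finsetSum _ fun _ _ => .of_finite,
    Finset.mul_sum]
  exact Finset.sum_le_sum fun e _ => integral_mul_trace_mul_pow_le hX hH q e

theorem integral_trace_pow_le (hX : ∀ e, ∫ b, X e b ∂μ e = 0) (hH : ∀ e, (H e).IsHermitian)
    {s : ℕ} (hs : s ≠ 0) :
    ∫ ω, (coordinateSum X H ω ^ (2 * s)).trace ∂Measure.pi μ ≤
      s ^ s * ∫ ω, (varianceProxy μ X H ω ^ s).trace ∂Measure.pi μ := by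
  obtain ⟨q, rfl⟩ : ∃ q, s = q + 1 := Nat.exists_eq_succ_of_ne_zero hs
  have hyoung (ω : ι → α) :
      (q + 1) * ((q + 1) * (varianceProxy μ X H ω * coordinateSum X H ω ^ (2 * q)).trace) ≤
        (q + 1) ^ (q + 1) * (varianceProxy μ X H ω ^ (q + 1)).trace +
          q * (coordinateSum X H ω ^ (2 * (q + 1))).trace := by
    have h := succ_mul_trace_mul_pow_le (isHermitian_coordinateSum X hH ω)
      ((posSemidef_varianceProxy μ X hH ω).smul (by positivity : (0 : ℝ) ≤ q + 1)) q
    simpa only [smul_pow, smul_mul_assoc, Matrix.trace_smul, smul_eq_mul] using h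
  have hint := integral_mono (μ := Measure.pi μ) .of_finite .of_finite hyoung
  have hnonneg : 0 ≤ ∫ ω, (varianceProxy μ X H ω * coordinateSum X H ω ^ (2 * q)).trace
      ∂Measure.pi μ :=
    integral_nonneg fun ω => trace_mul_pow_nonneg (isHermitian_coordinateSum X hH ω)
      (posSemidef_varianceProxy μ X hH ω) q
  rw [integral_add .of_finite .of_finite] at hint
  simp only [integral_const_mul] at hint
  have hmoment : ∫ ω, (coordinateSum X H ω ^ (2 * (q + 1))).trace ∂Measure.pi μ ≤
      (q + 1) * ∫ ω, (varianceProxy μ X H ω * coordinateSum X H ω ^ (2 * q)).trace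
        ∂Measure.pi μ := by
    refine (integral_trace_pow_le_integral_trace_varianceProxy_mul hX hH q).trans ?_
    exact mul_le_mul_of_nonneg_right (by linarith [(Nat.cast_nonneg q : (0 : ℝ) ≤ q)]) hnonneg
  push_cast
  linarith [mul_le_mul_of_nonneg_left hmoment (by positivity : (0 : ℝ) ≤ q + 1)]

end TraceMoments

section Bernoulli

/-- The value `0` or `1` of a coin. -/
def coinValue (b : Bool) : ℝ := if b then 1 else 0

theorem coinValue_nonneg (b : Bool) : 0 ≤ coinValue b := by
  cases b <;> simp [coinValue]

theorem integral_coinValue_sub (p : I) :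
    ∫ b, (coinValue b - p) ∂bernoulliMeasure true false p = 0 := by
  rw [integral_bernoulliMeasure]
  simp only [coinValue, smul_eq_mul]
  norm_num
  ring

theorem sq_coinValue_sub_add_integral_le (p : I) (b : Bool) :
    (coinValue b - p) ^ 2 + ∫ a, (coinValue a - p) ^ 2 ∂bernoulliMeasure true false p ≤
      coinValue b + p := by
  have hp := p.2.1
  rw [integral_bernoulliMeasure]
  cases b <;> simp only [coinValue, smul_eq_mul] <;> norm_num <;> nlinarith

theorem integral_exp_mul_coinValue_le (p : I) {u : ℝ} (hu₀ : 0 ≤ u) (hu₁ : u ≤ 1) :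
    ∫ b, Real.exp (u * coinValue b) ∂bernoulliMeasure true false p ≤ Real.exp (2 * u * p) := by
  have hexp : Real.exp u ≤ 1 + 2 * u := by
    have h := Real.exp_bound' hu₀ hu₁ (n := 2) (by norm_num)
    norm_num [Finset.sum_range_succ, Nat.factorial] at h
    nlinarith
  calc ∫ b, Real.exp (u * coinValue b) ∂bernoulliMeasure true false p
      = 1 + (Real.exp u - 1) * p := by
        rw [integral_bernoulliMeasure]
        simp [coinValue]
        ring
    _ ≤ 2 * u * p + 1 := by nlinarith [mul_le_mul_of_nonneg_right hexp p.2.1]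
    _ ≤ Real.exp (2 * u * p) := Real.add_one_le_exp _

variable {ι : Type*} [Fintype ι] (p : ι → I)

theorem integral_exp_mul_sum_coinValue_le (S : Finset ι) {u : ℝ} (hu₀ : 0 ≤ u) (hu₁ : u ≤ 1) :
    ∫ ω, Real.exp (u * ∑ e ∈ S, coinValue (ω e))
        ∂Measure.pi (fun e => bernoulliMeasure true false (p e)) ≤
      Real.exp (2 * u * ∑ e ∈ S, (p e : ℝ)) := by
  classical
  have hprod (ω : ι → Bool) : Real.exp (u * ∑ e ∈ S, coinValue (ω e)) =
      ∏ e, if e ∈ S then Real.exp (u * coinValue (ω e)) else 1 := by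
    rw [Finset.prod_ite_mem, Finset.univ_inter, Finset.mul_sum, Real.exp_sum]
  simp only [hprod]
  rw [integral_fintype_prod_eq_prod fun e b => if e ∈ S then Real.exp (u * coinValue b) else 1]
  calc ∏ e, ∫ b, (if e ∈ S then Real.exp (u * coinValue b) else 1)
        ∂bernoulliMeasure true false (p e)
      = ∏ e ∈ S, ∫ b, Real.exp (u * coinValue b) ∂bernoulliMeasure true false (p e) := by
        have hfactor (e : ι) : ∫ b, (if e ∈ S then Real.exp (u * coinValue b) else 1)
            ∂bernoulliMeasure true false (p e) =
              if e ∈ S then ∫ b, Real.exp (u * coinValue b) ∂bernoulliMeasure true false (p e)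
              else 1 := by
          split_ifs <;> simp
        simp only [hfactor]
        rw [Finset.prod_ite_mem, Finset.univ_inter]
    _ ≤ ∏ e ∈ S, Real.exp (2 * u * p e) :=
        Finset.prod_le_prod (fun e _ => integral_nonneg fun b => (Real.exp_pos _).le)
          fun e _ => integral_exp_mul_coinValue_le (p e) hu₀ hu₁
    _ = Real.exp (2 * u * ∑ e ∈ S, (p e : ℝ)) := by rw [← Real.exp_sum, Finset.mul_sum]

theorem add_pow_le_pow_mul_exp {d ρ : ℝ} (hd : 0 ≤ d) (hρ : 0 < ρ) (s : ℕ) :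
    (d + ρ) ^ s ≤ ρ ^ s * Real.exp (s / ρ * d) := by
  calc (d + ρ) ^ s = ρ ^ s * (d / ρ + 1) ^ s := by rw [← mul_pow]; field_simp
    _ ≤ ρ ^ s * Real.exp (d / ρ) ^ s := by gcongr; exact Real.add_one_le_exp _
    _ = ρ ^ s * Real.exp (s / ρ * d) := by rw [← Real.exp_nat_mul]; ring_nf

theorem integral_sum_coinValue_add_pow_le (S : Finset ι) {ρ : ℝ} (hρ : 0 < ρ)
    (hp : ∑ e ∈ S, (p e : ℝ) ≤ ρ) {s : ℕ} (hs : s ≤ ρ) :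
    ∫ ω, (∑ e ∈ S, (coinValue (ω e) + p e)) ^ s
        ∂Measure.pi (fun e => bernoulliMeasure true false (p e)) ≤
      (ρ * Real.exp 2) ^ s := by
  set P := Measure.pi fun e => bernoulliMeasure true false (p e)
  have hpointwise (ω : ι → Bool) : (∑ e ∈ S, (coinValue (ω e) + p e)) ^ s ≤
      ρ ^ s * Real.exp (s / ρ * ∑ e ∈ S, coinValue (ω e)) := by
    refine (pow_le_pow_left₀ ?_ ?_ s).trans (add_pow_le_pow_mul_exp ?_ hρ s)
    · exact Finset.sum_nonneg fun e _ => add_nonneg (coinValue_nonneg _) (p e).2.1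
    · rw [Finset.sum_add_distrib]
      exact add_le_add_right hp _
    · exact Finset.sum_nonneg fun e _ => coinValue_nonneg _
  calc ∫ ω, (∑ e ∈ S, (coinValue (ω e) + p e)) ^ s ∂P
      ≤ ρ ^ s * ∫ ω, Real.exp (s / ρ * ∑ e ∈ S, coinValue (ω e)) ∂P := by
        rw [← integral_const_mul]
        exact integral_mono .of_finite .of_finite hpointwise
    _ ≤ ρ ^ s * Real.exp (2 * (s / ρ) * ∑ e ∈ S, (p e : ℝ)) := by
        gcongr
        exact integral_exp_mul_sum_coinValue_le p S (by positivity) ((div_le_one hρ).2 hs)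
    _ ≤ ρ ^ s * Real.exp (2 * (s / ρ) * ρ) := by gcongr
    _ = (ρ * Real.exp 2) ^ s := by
        rw [mul_pow, ← Real.exp_nat_mul]
        field_simp

end Bernoulli

section AdjacencyConcentration

variable {n : ℕ}

/-- The adjacency matrix of the graph with the single edge `e`. -/
def edgeMatrix (e : Sym2 (Fin n)) : Matrix (Fin n) (Fin n) ℝ :=
  Matrix.of fun k l => if s(k, l) = e then 1 else 0

theorem isHermitian_edgeMatrix (e : Sym2 (Fin n)) : (edgeMatrix e).IsHermitian := by
  ext k l
  simp [edgeMatrix, Sym2.eq_swap]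

theorem edgeMatrix_row_sum (e : Sym2 (Fin n)) (k : Fin n) :
    ∑ l, edgeMatrix e k l = if k ∈ e then 1 else 0 := by
  simp only [edgeMatrix, Matrix.of_apply]
  split_ifs with hk
  · obtain ⟨l, rfl⟩ := hk
    simp only [Sym2.congr_right, Finset.sum_ite_eq', Finset.mem_univ, if_true]
  · refine Finset.sum_eq_zero fun l _ => if_neg ?_
    rintro rfl
    exact hk (Sym2.mem_mk_left k l)

theorem edgeMatrix_sq (e : Sym2 (Fin n)) :
    edgeMatrix e ^ 2 = Matrix.diagonal fun k => if k ∈ e then 1 else 0 := by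
  ext k m
  have hentry (l : Fin n) :
      edgeMatrix e k l * edgeMatrix e l m = if k = m then edgeMatrix e k l else 0 := by
    simp only [edgeMatrix, Matrix.of_apply, ite_zero_mul_ite_zero, mul_one]
    rw [← ite_and]
    refine if_congr ?_ rfl rfl
    rw [Sym2.eq_swap (a := l)]
    constructor
    · rintro ⟨rfl, h⟩
      exact ⟨(Sym2.congr_left.1 h).symm, rfl⟩
    · rintro ⟨rfl, h⟩
      exact ⟨h, h⟩
  rw [sq, Matrix.mul_apply, Matrix.diagonal_apply, Finset.sum_congr rfl fun l _ => hentry l,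
    ← edgeMatrix_row_sum e k]
  split_ifs <;> simp

theorem sum_filter_mem_eq (f : Sym2 (Fin n) → ℝ) (k : Fin n) :
    ∑ e with k ∈ e, f e = ∑ l, f s(k, l) := by
  refine (Finset.sum_nbij (fun l => s(k, l)) (fun l _ => ?_) (fun l _ m _ h => ?_) (fun e he => ?_)
    fun l _ => rfl).symm
  · exact Finset.mem_filter.2 ⟨Finset.mem_univ _, Sym2.mem_mk_left k l⟩
  · exact Sym2.congr_right.1 h
  · obtain ⟨l, rfl⟩ := (Finset.mem_filter.1 he).2
    exact ⟨l, Finset.mem_coe.2 (Finset.mem_univ l), rfl⟩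

theorem edgeProb_mk (κ : SmallWorldKernel) {C : ℝ} (hC : 1 ≤ C) (x : Fin n → I) (i j : Fin n) :
    (edgeProb κ C x s(i, j) : ℝ) = κ.val (x i) (x j) / C := by
  have hC₀ : 0 < C := one_pos.trans_le hC
  rw [edgeProb, Sym2.lift_mk, Set.projIcc_of_mem]
  exact ⟨(div_pos (κ.val_pos _ _) hC₀).le, (div_le_one hC₀).2 ((κ.val_le_one _ _).trans hC)⟩

theorem sum_edgeProb_le (κ : SmallWorldKernel) {C : ℝ} (hC : 1 ≤ C) (x : Fin n → I) (k : Fin n) :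
    ∑ e with k ∈ e, (edgeProb κ C x e : ℝ) ≤ n / C := by
  rw [sum_filter_mem_eq (fun e => (edgeProb κ C x e : ℝ))]
  calc ∑ l, (edgeProb κ C x s(k, l) : ℝ) ≤ ∑ _l : Fin n, 1 / C := by
        refine Finset.sum_le_sum fun l _ => ?_
        rw [edgeProb_mk κ hC]
        exact div_le_div_of_nonneg_right (κ.val_le_one _ _) (zero_le_one.trans hC)
    _ = n / C := by simp [div_eq_mul_inv]

theorem isHermitian_adjacency (ω : Sym2 (Fin n) → Bool) : (adjacency ω).IsHermitian := by
  ext i j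
  simp [adjacency, Sym2.eq_swap]

theorem isHermitian_gramMatrix (κ : SmallWorldKernel) (x : Fin n → I) :
    (gramMatrix κ x).IsHermitian := by
  ext i j
  simp [gramMatrix, κ.val_comm (x i)]

theorem adjacency_sub_gramMatrix_eq_coordinateSum (κ : SmallWorldKernel) {C : ℝ} (hC : 1 ≤ C)
    (x : Fin n → I) (ω : Sym2 (Fin n) → Bool) :
    adjacency ω - C⁻¹ • gramMatrix κ x =
      coordinateSum (fun e b => coinValue b - edgeProb κ C x e) edgeMatrix ω := by
  ext i j
  simp [coordinateSum, edgeMatrix, Matrix.sum_apply, adjacency, coinValue, gramMatrix,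
    edgeProb_mk κ hC, div_eq_inv_mul]

theorem isHermitian_adjacency_sub_gramMatrix (κ : SmallWorldKernel) (C : ℝ) (x : Fin n → I)
    (ω : Sym2 (Fin n) → Bool) : (adjacency ω - C⁻¹ • gramMatrix κ x).IsHermitian :=
  (isHermitian_adjacency ω).sub ((isHermitian_gramMatrix κ x).smul (IsSelfAdjoint.all _))

theorem trace_varianceProxy_edgeMatrix_pow_le (p : Sym2 (Fin n) → I) (ω : Sym2 (Fin n) → Bool)
    (s : ℕ) :
    (varianceProxy (fun e => bernoulliMeasure true false (p e)) (fun e b => coinValue b - p e)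
        edgeMatrix ω ^ s).trace ≤
      ∑ k, (∑ e with k ∈ e, (coinValue (ω e) + p e)) ^ s := by
  set v : Sym2 (Fin n) → ℝ := fun e => (coinValue (ω e) - p e) ^ 2 +
    ∫ b, (coinValue b - p e) ^ 2 ∂bernoulliMeasure true false (p e)
  have hdiag : varianceProxy (fun e => bernoulliMeasure true false (p e))
      (fun e b => coinValue b - p e) edgeMatrix ω =
        Matrix.diagonal fun k => ∑ e with k ∈ e, v e := by
    ext k m
    simp only [varianceProxy, edgeMatrix_sq, Matrix.sum_apply, Matrix.smul_apply,
      Matrix.diagonal_apply, smul_eq_mul, Finset.sum_filter]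
    split_ifs <;> simp [v]
  rw [hdiag, Matrix.diagonal_pow, Matrix.trace_diagonal]
  refine Finset.sum_le_sum fun k _ => pow_le_pow_left₀ ?_ ?_ s
  · exact Finset.sum_nonneg fun e _ =>
      add_nonneg (sq_nonneg _) (integral_nonneg fun b => sq_nonneg _)
  · exact Finset.sum_le_sum fun e _ => sq_coinValue_sub_add_integral_le (p e) (ω e)

theorem integral_trace_adjacency_sub_pow_le (κ : SmallWorldKernel) {C : ℝ} (hC : 1 ≤ C)
    (hn : n ≠ 0) (x : Fin n → I) {s : ℕ} (hs : s ≠ 0) (hsρ : s ≤ n / C) :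
    ∫ ω, ((adjacency ω - C⁻¹ • gramMatrix κ x) ^ (2 * s)).trace ∂edgeKernel κ C n x ≤
      n * (s * (n / C) * Real.exp 2) ^ s := by
  have hρ : 0 < n / C := by positivity
  set p : Sym2 (Fin n) → I := edgeProb κ C x
  set P := Measure.pi fun e => bernoulliMeasure true false (p e)
  simp only [adjacency_sub_gramMatrix_eq_coordinateSum κ hC]
  calc ∫ ω, (coordinateSum (fun e b => coinValue b - p e) edgeMatrix ω ^ (2 * s)).trace ∂P
      ≤ s ^ s * ∫ ω, (varianceProxy (fun e => bernoulliMeasure true false (p e))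
          (fun e b => coinValue b - p e) edgeMatrix ω ^ s).trace ∂P :=
        integral_trace_pow_le (fun e => integral_coinValue_sub (p e)) isHermitian_edgeMatrix hs
    _ ≤ s ^ s * ∫ ω, ∑ k, (∑ e with k ∈ e, (coinValue (ω e) + p e)) ^ s ∂P :=
        mul_le_mul_of_nonneg_left (integral_mono .of_finite .of_finite fun ω =>
          trace_varianceProxy_edgeMatrix_pow_le p ω s) (by positivity)
    _ ≤ s ^ s * ∑ _k : Fin n, (n / C * Real.exp 2) ^ s := by
        rw [integral_finsetSum _ fun _ _ => .of_finite]
        gcongr with k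
        exact integral_sum_coinValue_add_pow_le p _ hρ (sum_edgeProb_le κ hC x k) hsρ
    _ = n * (s * (n / C) * Real.exp 2) ^ s := by
        rw [Finset.sum_const, Finset.card_univ, Fintype.card_fin, nsmul_eq_mul, mul_pow, mul_pow,
          mul_pow]
        ring

theorem edgeKernel_trace_pow_gt_le (κ : SmallWorldKernel) {C t : ℝ} (hC : 1 ≤ C) (hn : n ≠ 0)
    (ht : 0 < t) (x : Fin n → I) {s : ℕ} (hs : s ≠ 0) (hsρ : s ≤ n / C) :
    edgeKernel κ C n x
      {ω | t ^ (2 * s) < ((adjacency ω - C⁻¹ • gramMatrix κ x) ^ (2 * s)).trace} ≤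
      ENNReal.ofReal (n * (s * (n / C) * Real.exp 2 / t ^ 2) ^ s) := by
  have hmarkov := mul_meas_ge_le_integral_of_nonneg (μ := edgeKernel κ C n x)
    (f := fun ω => ((adjacency ω - C⁻¹ • gramMatrix κ x) ^ (2 * s)).trace)
    (.of_forall fun ω => by
      simpa using trace_mul_pow_nonneg (isHermitian_adjacency_sub_gramMatrix κ C x ω)
        Matrix.PosSemidef.one s) .of_finite (t ^ (2 * s))
  rw [← ofReal_measureReal]
  refine ENNReal.ofReal_le_ofReal ?_
  rw [div_pow, ← pow_mul, mul_div_assoc', le_div_iff₀' (by positivity)]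
  refine (mul_le_mul_of_nonneg_left (measureReal_mono fun ω hω => ?_) (by positivity)).trans
    (hmarkov.trans (integral_trace_adjacency_sub_pow_le κ hC hn x hs hsρ))
  exact (Set.mem_ofPred.1 hω).le

theorem measurableSet_trace_pow_gt (κ : SmallWorldKernel) (C t : ℝ) (s : ℕ) :
    MeasurableSet {ω : (Fin n → I) × (Sym2 (Fin n) → Bool) |
      t ^ (2 * s) < ((adjacency ω.2 - C⁻¹ • gramMatrix κ ω.1) ^ (2 * s)).trace} := by
  have hadjacency : Continuous fun ω : (Fin n → I) × (Sym2 (Fin n) → Bool) => adjacency ω.2 :=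
    (continuous_of_discreteTopology (f := adjacency)).comp continuous_snd
  have hgram : Continuous fun ω : (Fin n → I) × (Sym2 (Fin n) → Bool) => gramMatrix κ ω.1 :=
    continuous_matrix fun i j => κ.continuous_val.comp (by fun_prop :
      Continuous fun ω : (Fin n → I) × (Sym2 (Fin n) → Bool) => (ω.1 i, ω.1 j))
  exact measurableSet_lt measurable_const
    ((hadjacency.sub (hgram.const_smul C⁻¹)).pow (2 * s)).matrix_trace.measurable

theorem modelLaw_trace_pow_gt_le (κ : SmallWorldKernel) (D : Measure I) [IsProbabilityMeasure D]
    {C t : ℝ} (hC : 1 ≤ C) (hn : n ≠ 0) (ht : 0 < t) {s : ℕ} (hs : s ≠ 0) (hsρ : s ≤ n / C) :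
    modelLaw κ D C n
      {ω | t ^ (2 * s) < ((adjacency ω.2 - C⁻¹ • gramMatrix κ ω.1) ^ (2 * s)).trace} ≤
      ENNReal.ofReal (n * (s * (n / C) * Real.exp 2 / t ^ 2) ^ s) := by
  rw [modelLaw, Measure.compProd_apply (measurableSet_trace_pow_gt κ C t s)]
  refine (lintegral_mono fun x => edgeKernel_trace_pow_gt_le κ hC hn ht x hs hsρ).trans ?_
  rw [lintegral_const, measure_univ, mul_one]

theorem modelLaw_fst_preimage (κ : SmallWorldKernel) (D : Measure I) [IsProbabilityMeasure D]
    (C : ℝ) {S : Set (Fin n → I)} (hS : MeasurableSet S) :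
    modelLaw κ D C n {ω | ω.1 ∈ S} = Measure.pi (fun _ : Fin n => D) S := by
  rw [← Measure.fst_compProd (Measure.pi fun _ : Fin n => D) (edgeKernel κ C n),
    Measure.fst_apply hS]
  rfl

end AdjacencyConcentration

section FormBound

variable {E : Type*} [NormedAddCommGroup E] [InnerProductSpace ℝ E]

/-- The quadratic form of `T` is at least `θ` times the squared norm on some `k`-dimensional
subspace, which is given as the range of an injective linear map from `ℝ ^ k`. For `θ > 0` this
counts the eigenvalues of a symmetric `T` that are at least `θ`. -/
def HasFormBound (T : E →ₗ[ℝ] E) (θ : ℝ) (k : ℕ) : Prop :=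
  ∃ ι : (Fin k → ℝ) →ₗ[ℝ] E, Function.Injective ι ∧
    ∀ w, θ * ‖ι w‖ ^ 2 ≤ inner ℝ (T (ι w)) (ι w)

theorem hasFormBound_of_orthonormal {T : E →ₗ[ℝ] E} {k : ℕ} {u : Fin k → E}
    (hu : Orthonormal ℝ u) {a : Fin k → ℝ} (hT : ∀ i, T (u i) = a i • u i) {θ : ℝ}
    (hθ : ∀ i, θ ≤ a i) : HasFormBound T θ k := by
  refine ⟨Fintype.linearCombination ℝ u, hu.linearIndependent.fintypeLinearCombination_injective,
    fun w => ?_⟩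
  have hTw : T (Fintype.linearCombination ℝ u w) = ∑ i, (a i * w i) • u i := by
    rw [Fintype.linearCombination_apply, map_sum]
    exact Finset.sum_congr rfl fun i _ => by rw [map_smul, hT, smul_smul, mul_comm]
  have hform := hu.inner_sum (fun i => a i * w i) w Finset.univ
  have hnorm := hu.inner_sum w w Finset.univ
  simp only [conj_trivial] at hform hnorm
  rw [hTw, ← real_inner_self_eq_norm_sq, Fintype.linearCombination_apply, hform, hnorm,
    Finset.mul_sum]
  refine Finset.sum_le_sum fun i _ => ?_
  rw [mul_assoc]
  exact mul_le_mul_of_nonneg_right (hθ i) (mul_self_nonneg _)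

theorem apply_eq_smul_of_apply_apply_eq {T : E →ₗ[ℝ] E} {η s : ℝ}
    (hη : ∀ v, -η * ‖v‖ ^ 2 ≤ inner ℝ (T v) v) (hs : η < s) {v : E}
    (hv : T (T v) = s ^ 2 • v) : T v = s • v := by
  -- `T v - s • v` would be an eigenvector with eigenvalue `-s < -η`.
  have heig : T (T v - s • v) = -s • (T v - s • v) := by
    rw [map_sub, map_smul, hv]
    module
  have hform := hη (T v - s • v)
  rw [heig, inner_smul_left, real_inner_self_eq_norm_sq, conj_trivial] at hform
  by_contra hne
  nlinarith [pow_pos (norm_pos_iff.2 (sub_ne_zero.2 hne)) 2]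

end FormBound

section SingularValues

variable {E F : Type*} [NormedAddCommGroup E] [InnerProductSpace ℝ E]
  [NormedAddCommGroup F] [InnerProductSpace ℝ F]

/-- The linear combinations of the first `k` vectors of an orthonormal basis, parametrized by their
coefficients; it is the extremal subspace in the max-min principle. -/
def initialSpan {m : ℕ} (b : OrthonormalBasis (Fin m) ℝ E) {k : ℕ} (hk : k ≤ m) :
    (Fin k → ℝ) →ₗ[ℝ] E :=
  Fintype.linearCombination ℝ (fun i : Fin k => b (Fin.castLE hk i))

theorem initialSpan_injective {m : ℕ} (b : OrthonormalBasis (Fin m) ℝ E) {k : ℕ} (hk : k ≤ m) :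
    Function.Injective (initialSpan b hk) :=
  (b.orthonormal.comp _
    (Fin.castLE_injective hk)).linearIndependent.fintypeLinearCombination_injective

theorem repr_initialSpan_eq_zero {m : ℕ} (b : OrthonormalBasis (Fin m) ℝ E) {k : ℕ} (hk : k ≤ m)
    (w : Fin k → ℝ) {i : Fin m} (hi : k ≤ i) : b.repr (initialSpan b hk w) i = 0 := by
  rw [b.repr_apply_apply, initialSpan, Fintype.linearCombination_apply, inner_sum]
  refine Finset.sum_eq_zero fun j _ => ?_
  have hij : i ≠ Fin.castLE hk j := fun h => (j.2.trans_le hi).ne' (congrArg Fin.val h)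
  rw [inner_smul_right, b.orthonormal.2 hij, mul_zero]

variable [FiniteDimensional ℝ E] [FiniteDimensional ℝ F]

theorem norm_sq_apply_eq_sum_singularValues (T : E →ₗ[ℝ] F) (v : E) :
    ‖T v‖ ^ 2 = ∑ i : Fin (Module.finrank ℝ E), T.singularValues i ^ 2 *
      (T.isSymmetric_adjoint_comp_self.eigenvectorBasis rfl).repr v i ^ 2 := by
  set b := T.isSymmetric_adjoint_comp_self.eigenvectorBasis rfl with hb
  have hTv : ‖T v‖ ^ 2 = inner ℝ ((LinearMap.adjoint T ∘ₗ T) v) v := by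
    rw [LinearMap.comp_apply, LinearMap.adjoint_inner_left, real_inner_self_eq_norm_sq]
  rw [hTv, ← b.sum_inner_mul_inner]
  refine Finset.sum_congr rfl fun i _ => ?_
  have hi := T.isSymmetric_adjoint_comp_self.eigenvectorBasis_apply_self_apply rfl v i
  rw [← hb] at hi
  rw [real_inner_comm, ← b.repr_apply_apply, ← b.repr_apply_apply, hi, T.sq_singularValues_fin rfl]
  simp only [RCLike.ofReal_real_eq_id, id_eq]
  ring

theorem norm_apply_le_singularValues_mul (T : E →ₗ[ℝ] F) {k : ℕ} {v : E}
    (hv : ∀ i : Fin (Module.finrank ℝ E), (i : ℕ) < k →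
      (T.isSymmetric_adjoint_comp_self.eigenvectorBasis rfl).repr v i = 0) :
    ‖T v‖ ≤ T.singularValues k * ‖v‖ := by
  refine le_of_sq_le_sq ?_ (mul_nonneg (T.singularValues_nonneg _) (norm_nonneg _))
  rw [norm_sq_apply_eq_sum_singularValues, mul_pow,
    ← (T.isSymmetric_adjoint_comp_self.eigenvectorBasis rfl).sum_sq_norm_inner_right,
    Finset.mul_sum]
  refine Finset.sum_le_sum fun i _ => ?_
  rw [← OrthonormalBasis.repr_apply_apply, Real.norm_eq_abs, sq_abs]
  rcases lt_or_ge (i : ℕ) k with hi | hi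
  · rw [hv i hi, zero_pow two_ne_zero, mul_zero, mul_zero]
  · exact mul_le_mul_of_nonneg_right
      (pow_le_pow_left₀ (T.singularValues_nonneg _) (T.singularValues_antitone hi) 2) (sq_nonneg _)

theorem le_singularValues_of_forall_le {T : E →ₗ[ℝ] F} {k : ℕ} {θ : ℝ}
    (ι : (Fin (k + 1) → ℝ) →ₗ[ℝ] E) (hι : Function.Injective ι)
    (h : ∀ w, θ * ‖ι w‖ ≤ ‖T (ι w)‖) : θ ≤ T.singularValues k := by
  have hk : k < Module.finrank ℝ E := by
    simpa using LinearMap.finrank_le_finrank_of_injective hι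
  set b := T.isSymmetric_adjoint_comp_self.eigenvectorBasis rfl
  -- The `k` conditions `⟪b i, ι w⟫ = 0` leave a nonzero solution `w` in dimension `k + 1`.
  let coords : (Fin (k + 1) → ℝ) →ₗ[ℝ] (Fin k → ℝ) :=
    LinearMap.pi fun i => (innerₛₗ ℝ (b ⟨i, i.2.trans hk⟩)) ∘ₗ ι
  have hker : LinearMap.ker coords ≠ ⊥ := LinearMap.ker_ne_bot_of_finrank_lt (by simp)
  obtain ⟨w, hw, hw0⟩ := (Submodule.ne_bot_iff _).1 hker
  have hιw : ι w ≠ 0 := (map_ne_zero_iff ι hι).2 hw0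
  have hrepr : ∀ i : Fin (Module.finrank ℝ E), (i : ℕ) < k → b.repr (ι w) i = 0 := fun i hi => by
    simpa [coords, b.repr_apply_apply] using congrFun (LinearMap.mem_ker.1 hw) ⟨i, hi⟩
  exact le_of_mul_le_mul_right ((h w).trans (norm_apply_le_singularValues_mul T hrepr))
    (norm_pos_iff.2 hιw)

theorem exists_forall_singularValues_mul_norm_le (T : E →ₗ[ℝ] F) {k : ℕ}
    (hk : k < Module.finrank ℝ E) :
    ∃ ι : (Fin (k + 1) → ℝ) →ₗ[ℝ] E, Function.Injective ι ∧
      ∀ w, T.singularValues k * ‖ι w‖ ≤ ‖T (ι w)‖ := by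
  set b := T.isSymmetric_adjoint_comp_self.eigenvectorBasis rfl with hb
  refine ⟨initialSpan b hk, initialSpan_injective b _, fun w => ?_⟩
  refine le_of_sq_le_sq ?_ (norm_nonneg _)
  rw [norm_sq_apply_eq_sum_singularValues, mul_pow, ← b.sum_sq_norm_inner_right, Finset.mul_sum]
  refine Finset.sum_le_sum fun i _ => ?_
  rw [← b.repr_apply_apply, Real.norm_eq_abs, sq_abs, ← hb]
  rcases le_or_gt (k + 1) (i : ℕ) with hi | hi
  · rw [repr_initialSpan_eq_zero b _ w hi, zero_pow two_ne_zero, mul_zero, mul_zero]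
  · exact mul_le_mul_of_nonneg_right (pow_le_pow_left₀ (T.singularValues_nonneg _)
      (T.singularValues_antitone (Nat.lt_succ_iff.1 hi)) 2) (sq_nonneg _)

theorem singularValues_le_add {T S : E →ₗ[ℝ] F} {ε : ℝ} (h : ∀ v, ‖(T - S) v‖ ≤ ε * ‖v‖)
    (hε : 0 ≤ ε) (k : ℕ) : T.singularValues k ≤ S.singularValues k + ε := by
  rcases lt_or_ge k (Module.finrank ℝ E) with hk | hk
  · obtain ⟨ι, hι, hT⟩ := exists_forall_singularValues_mul_norm_le T hk
    refine sub_le_iff_le_add.1 (le_singularValues_of_forall_le ι hι fun w => ?_)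
    have htri := norm_sub_norm_le (T (ι w)) (S (ι w))
    rw [← LinearMap.sub_apply] at htri
    linarith [hT w, h (ι w)]
  · rw [T.singularValues_of_finrank_le hk]
    exact add_nonneg (S.singularValues_nonneg _) hε

theorem abs_singularValues_sub_le {T S : E →ₗ[ℝ] F} {ε : ℝ} (h : ∀ v, ‖(T - S) v‖ ≤ ε * ‖v‖)
    (hε : 0 ≤ ε) (k : ℕ) : |T.singularValues k - S.singularValues k| ≤ ε := by
  have h' : ∀ v, ‖(S - T) v‖ ≤ ε * ‖v‖ := fun v => by
    rw [← neg_sub T S, LinearMap.neg_apply, norm_neg]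
    exact h v
  rw [abs_sub_le_iff]
  exact ⟨by linarith [singularValues_le_add h hε k], by linarith [singularValues_le_add h' hε k]⟩

theorem mul_singularValues_le_smul (T : E →ₗ[ℝ] F) {c : ℝ} (hc : 0 ≤ c) (k : ℕ) :
    c * T.singularValues k ≤ (c • T).singularValues k := by
  rcases lt_or_ge k (Module.finrank ℝ E) with hk | hk
  · obtain ⟨ι, hι, hT⟩ := exists_forall_singularValues_mul_norm_le T hk
    refine le_singularValues_of_forall_le ι hι fun w => ?_
    rw [LinearMap.smul_apply, norm_smul, Real.norm_of_nonneg hc, mul_assoc]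
    exact mul_le_mul_of_nonneg_left (hT w) hc
  · rw [T.singularValues_of_finrank_le hk, mul_zero]
    exact LinearMap.singularValues_nonneg _ _

theorem singularValues_smul (T : E →ₗ[ℝ] F) {c : ℝ} (hc : 0 < c) (k : ℕ) :
    (c • T).singularValues k = c * T.singularValues k := by
  refine le_antisymm ?_ (mul_singularValues_le_smul T hc.le k)
  have := mul_singularValues_le_smul (c • T) (inv_nonneg.2 hc.le) k
  rwa [smul_smul, inv_mul_cancel₀ hc.ne', one_smul, inv_mul_le_iff₀ hc] at this

theorem HasFormBound.le_singularValues {T : E →ₗ[ℝ] E} {k : ℕ} {θ : ℝ}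
    (h : HasFormBound T θ (k + 1)) : θ ≤ T.singularValues k := by
  obtain ⟨ι, hι, hT⟩ := h
  refine le_singularValues_of_forall_le ι hι fun w => ?_
  rcases eq_or_ne (ι w) 0 with hw | hw
  · rw [hw, map_zero, norm_zero, mul_zero]
  · have hcs := (hT w).trans (real_inner_le_norm _ _)
    rw [sq, ← mul_assoc] at hcs
    exact le_of_mul_le_mul_right hcs (norm_pos_iff.2 hw)

theorem hasFormBound_singularValues {T : E →ₗ[ℝ] E} (hT : T.IsSymmetric) {η : ℝ}
    (hη0 : 0 ≤ η) (hη : ∀ v, -η * ‖v‖ ^ 2 ≤ inner ℝ (T v) v) {k : ℕ}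
    (hk : η < T.singularValues k) : HasFormBound T (T.singularValues k) (k + 1) := by
  have hkn : k < Module.finrank ℝ E := by
    by_contra hcon
    exact hk.not_ge ((T.singularValues_of_finrank_le (not_lt.1 hcon)).trans_le hη0)
  set b := T.isSymmetric_adjoint_comp_self.eigenvectorBasis rfl with hb
  have hadj : LinearMap.adjoint T = T := (LinearMap.isSymmetric_iff_isSelfAdjoint T).1 hT
  have hTb : ∀ i : Fin (k + 1), T (b (Fin.castLE hkn i)) =
      T.singularValues i • b (Fin.castLE hkn i) := by
    intro i
    refine apply_eq_smul_of_apply_apply_eq hη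
      (hk.trans_le (T.singularValues_antitone (Nat.lt_succ_iff.1 i.2))) ?_
    have h := T.isSymmetric_adjoint_comp_self.apply_eigenvectorBasis rfl (Fin.castLE hkn i)
    rw [← hb, ← T.sq_singularValues_fin rfl, LinearMap.comp_apply, hadj] at h
    exact h
  exact hasFormBound_of_orthonormal (b.orthonormal.comp _ (Fin.castLE_injective hkn)) hTb
    fun i => T.singularValues_antitone (Nat.lt_succ_iff.1 i.2)

end SingularValues

section FormApprox

variable {E F G : Type*} [NormedAddCommGroup E] [InnerProductSpace ℝ E]
  [NormedAddCommGroup F] [InnerProductSpace ℝ F] [NormedAddCommGroup G] [InnerProductSpace ℝ G]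

/-- The quadratic form of `T` is reproduced by that of `S`, up to `η` times the squared norm, after
a contraction between the underlying spaces. This one-sided comparison of operators on different
spaces is strong enough to transport form bounds. -/
def FormApprox (T : E →ₗ[ℝ] E) (S : F →ₗ[ℝ] F) (η : ℝ) : Prop :=
  ∃ J : E →ₗ[ℝ] F, (∀ f, ‖J f‖ ≤ ‖f‖) ∧
    ∀ f, |inner ℝ (T f) f - inner ℝ (S (J f)) (J f)| ≤ η * ‖f‖ ^ 2

theorem FormApprox.trans {T : E →ₗ[ℝ] E} {S : F →ₗ[ℝ] F} {R : G →ₗ[ℝ] G} {η ε : ℝ}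
    (hTS : FormApprox T S η) (hSR : FormApprox S R ε) (hε : 0 ≤ ε) : FormApprox T R (η + ε) := by
  obtain ⟨J, hJ, hTJ⟩ := hTS
  obtain ⟨L, hL, hSL⟩ := hSR
  refine ⟨L ∘ₗ J, fun f => (hL _).trans (hJ f), fun f => ?_⟩
  rw [add_mul]
  refine (abs_sub_le _ (inner ℝ (S (J f)) (J f)) _).trans (add_le_add (hTJ f) ((hSL _).trans ?_))
  exact mul_le_mul_of_nonneg_left (pow_le_pow_left₀ (norm_nonneg _) (hJ f) 2) hε

theorem FormApprox.hasFormBound {T : E →ₗ[ℝ] E} {S : F →ₗ[ℝ] F} {η θ : ℝ} {k : ℕ}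
    (hTS : FormApprox T S η) (h : HasFormBound T θ k) (hηθ : η < θ) :
    HasFormBound S (θ - η) k := by
  obtain ⟨J, hJ, hTJ⟩ := hTS
  obtain ⟨ι, hι, hT⟩ := h
  have hS : ∀ w, (θ - η) * ‖ι w‖ ^ 2 ≤ inner ℝ (S (J (ι w))) (J (ι w)) := fun w => by
    linarith [hT w, (abs_le.1 (hTJ (ι w))).2]
  refine ⟨J ∘ₗ ι, (injective_iff_map_eq_zero _).2 fun w hw => ?_, fun w => ?_⟩
  · have hle := hS w
    rw [LinearMap.comp_apply] at hw
    rw [hw, inner_zero_right] at hle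
    refine (map_eq_zero_iff ι hι).1 (by_contra fun hne => hle.not_gt ?_)
    exact mul_pos (sub_pos.2 hηθ) (pow_pos (norm_pos_iff.2 hne) 2)
  · refine (mul_le_mul_of_nonneg_left ?_ (sub_nonneg.2 hηθ.le)).trans (hS w)
    exact pow_le_pow_left₀ (norm_nonneg _) (hJ _) 2

theorem FormApprox.neg_mul_norm_sq_le_inner {T : E →ₗ[ℝ] E} {S : F →ₗ[ℝ] F} {η : ℝ}
    (hTS : FormApprox T S η) (hS : ∀ f, 0 ≤ inner ℝ (S f) f) (f : E) :
    -η * ‖f‖ ^ 2 ≤ inner ℝ (T f) f := by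
  obtain ⟨J, -, hTJ⟩ := hTS
  linarith [(abs_le.1 (hTJ f)).1, hS (J f)]

variable [CompleteSpace E] [CompleteSpace F] {T : E →ₗ[ℝ] E} {S : F →ₗ[ℝ] F} {A : E →L[ℝ] F}
  {η : ℝ}

theorem abs_inner_sub_le_of_norm_sub_le (h : ∀ f, ‖T f - A.adjoint (S (A f))‖ ≤ η * ‖f‖) (f : E) :
    |inner ℝ (T f) f - inner ℝ (S (A f)) (A f)| ≤ η * ‖f‖ ^ 2 := by
  rw [← ContinuousLinearMap.adjoint_inner_left, ← inner_sub_left, sq, ← mul_assoc]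
  exact (abs_real_inner_le_norm _ _).trans (mul_le_mul_of_nonneg_right (h f) (norm_nonneg f))

theorem formApprox_of_norm_sub_le (hA : ‖A‖ ≤ 1)
    (h : ∀ f, ‖T f - A.adjoint (S (A f))‖ ≤ η * ‖f‖) : FormApprox T S η :=
  ⟨A, fun _ => (A.le_of_opNorm_le_of_le hA le_rfl).trans_eq (one_mul _),
    abs_inner_sub_le_of_norm_sub_le h⟩

theorem formApprox_symm_of_norm_sub_le (hA : ‖A‖ ≤ 1) (hη : 0 ≤ η)
    (h : ∀ f, ‖T f - A.adjoint (S (A f))‖ ≤ η * ‖f‖)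
    (hS : ∀ w, inner ℝ (S (A (A.adjoint w))) (A (A.adjoint w)) = inner ℝ (S w) w) :
    FormApprox S T η := by
  have hA' : ∀ w, ‖A.adjoint w‖ ≤ ‖w‖ := fun w =>
    (A.adjoint.le_of_opNorm_le_of_le (by rwa [LinearIsometryEquiv.norm_map]) le_rfl).trans_eq
      (one_mul _)
  refine ⟨A.adjoint, hA', fun w => ?_⟩
  rw [abs_sub_comm, ← hS w]
  exact (abs_inner_sub_le_of_norm_sub_le h _).trans
    (mul_le_mul_of_nonneg_left (pow_le_pow_left₀ (norm_nonneg _) (hA' w) 2) hη)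

end FormApprox

section Lebesgue

variable {Ω : Type*} [MeasurableSpace Ω] {μ : Measure Ω}

theorem norm_Lp_sq (f : Lp ℝ 2 μ) : ‖f‖ ^ 2 = ∫ x, f x ^ 2 ∂μ := by
  rw [← real_inner_self_eq_norm_sq, L2.inner_def]
  simp only [real_inner_self_eq_norm_sq, Real.norm_eq_abs, sq_abs]

variable [IsProbabilityMeasure μ]

theorem integrable_Lp (f : Lp ℝ 2 μ) : Integrable f μ := (Lp.memLp f).integrable one_le_two

theorem norm_Lp_le_of_ae_le {f : Lp ℝ 2 μ} {r : ℝ} (hr : 0 ≤ r) (h : ∀ᵐ x ∂μ, ‖f x‖ ≤ r) :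
    ‖f‖ ≤ r := by
  simpa [measureUnivNNReal] using Lp.norm_le_of_ae_bound hr h

theorem integral_norm_le_norm_Lp (f : Lp ℝ 2 μ) : ∫ x, ‖f x‖ ∂μ ≤ ‖f‖ := by
  rw [integral_norm_eq_lintegral_enorm (Lp.aestronglyMeasurable f),
    ← eLpNorm_one_eq_lintegral_enorm, Lp.norm_def]
  exact ENNReal.toReal_mono (Lp.eLpNorm_ne_top f)
    (eLpNorm_le_eLpNorm_of_exponent_le one_le_two (Lp.aestronglyMeasurable f))

theorem le_inner_const_one {f : Lp ℝ 2 μ} {r : ℝ} (h : ∀ᵐ x ∂μ, r ≤ f x) :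
    r ≤ inner ℝ f (Lp.const 2 μ 1) := by
  calc r = ∫ _, r ∂μ := by simp
    _ ≤ ∫ x, f x ∂μ := integral_mono_ae (integrable_const r) (integrable_Lp f) h
    _ = inner ℝ f (Lp.const 2 μ 1) := by
      rw [L2.inner_def]
      refine integral_congr_ae ?_
      filter_upwards [Lp.coeFn_const (p := 2) (μ := μ) (1 : ℝ)] with x hx
      rw [hx, Function.const_apply]
      simp

end Lebesgue

section Discretization

variable {Ω : Type*} [MeasurableSpace Ω] {m : ℕ}

/-- The mass of the cell `c ⁻¹' {a}` of the partition of `Ω` that is given by `c`. -/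
def cellMass (μ : Measure Ω) (c : Ω → Fin m) (a : Fin m) : ℝ := μ.real (c ⁻¹' {a})

/-- The matrix of the discretization of an integral operator whose kernel takes the value `B a b` on
the product of the cells `a` and `b`, which have the masses `p a` and `p b`. -/
def cellMatrix (p : Fin m → ℝ) (B : Fin m → Fin m → ℝ) : Matrix (Fin m) (Fin m) ℝ :=
  Matrix.of fun a b => √(p a) * B a b * √(p b)

theorem cellMass_nonneg (μ : Measure Ω) (c : Ω → Fin m) (a : Fin m) : 0 ≤ cellMass μ c a :=
  measureReal_nonneg

theorem integral_comp_mul {μ : Measure Ω} {c : Ω → Fin m} (hc : Measurable c) (g : Fin m → ℝ)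
    {f : Ω → ℝ} (hf : Integrable f μ) :
    ∫ x, g (c x) * f x ∂μ = ∑ a, g a * ∫ x in c ⁻¹' {a}, f x ∂μ := by
  have hcell : ∀ a, MeasurableSet (c ⁻¹' {a}) := fun a => hc (measurableSet_singleton a)
  have hsum : ∀ x, g (c x) * f x = ∑ a, (c ⁻¹' {a}).indicator (fun x => g a * f x) x := fun x => by
    rw [Finset.sum_eq_single (c x)]
    · rw [Set.indicator_of_mem (show x ∈ c ⁻¹' {c x} from rfl)]
    · exact fun a _ ha => Set.indicator_of_notMem (s := c ⁻¹' {a}) (fun h => ha h.symm) _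
    · exact fun h => absurd (Finset.mem_univ _) h
  simp only [hsum]
  rw [integral_finsetSum _ fun a _ => (hf.const_mul (g a)).indicator (hcell a)]
  exact Finset.sum_congr rfl fun a _ => by rw [integral_indicator (hcell a), integral_const_mul]

variable {μ : Measure Ω} [IsProbabilityMeasure μ] {c : Ω → Fin m}

theorem integral_comp (hc : Measurable c) (g : Fin m → ℝ) :
    ∫ x, g (c x) ∂μ = ∑ a, g a * cellMass μ c a := by
  simpa [cellMass] using integral_comp_mul hc g (integrable_const (μ := μ) (1 : ℝ))

theorem cellMass_le_one (a : Fin m) : cellMass μ c a ≤ 1 := measureReal_le_one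

theorem ae_cellMass_ne_zero : ∀ᵐ x ∂μ, cellMass μ c (c x) ≠ 0 := by
  have h : ∀ a, ∀ᵐ x ∂μ, cellMass μ c a = 0 → c x ≠ a := fun a => by
    by_cases ha : cellMass μ c a = 0
    · have hnull : μ (c ⁻¹' {a}) = 0 := (measureReal_eq_zero_iff).1 ha
      filter_upwards [measure_eq_zero_iff_ae_notMem.1 hnull] with x hx _ using hx
    · exact Eventually.of_forall fun x h => absurd h ha
  filter_upwards [ae_all_iff.2 h] with x hx h0 using hx (c x) h0 rfl

theorem memLp_comp (hc : Measurable c) (g : Fin m → ℝ) : MemLp (fun x => g (c x)) 2 μ :=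
  MemLp.of_bound (C := ∑ a, ‖g a‖) ((measurable_of_countable g).comp hc).aestronglyMeasurable
    (Eventually.of_forall fun x => Finset.single_le_sum (f := fun a => ‖g a‖)
      (fun _ _ => norm_nonneg _) (Finset.mem_univ (c x)))

/-- The step function with the value `w a / √p a` on the cell `a` of mass `p a`; this normalization
makes the map an isometry if all masses are positive. On cells of mass `0` the step function is `0`
by the convention for division. -/
def stepMap (μ : Measure Ω) [IsProbabilityMeasure μ] (hc : Measurable c) :
    EuclideanSpace ℝ (Fin m) →L[ℝ] Lp ℝ 2 μ :=
  LinearMap.toContinuousLinearMap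
    { toFun := fun w => (memLp_comp hc fun a => w a / √(cellMass μ c a)).toLp
      map_add' := fun w z => by
        rw [← MemLp.toLp_add]
        exact MemLp.toLp_congr _ _ (Eventually.of_forall fun x => add_div _ _ _)
      map_smul' := fun r w => by
        rw [RingHom.id_apply, ← MemLp.toLp_const_smul]
        exact MemLp.toLp_congr _ _ (Eventually.of_forall fun x => mul_div_assoc _ _ _) }

theorem coeFn_stepMap (hc : Measurable c) (w : EuclideanSpace ℝ (Fin m)) :
    stepMap μ hc w =ᵐ[μ] fun x => w (c x) / √(cellMass μ c (c x)) :=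
  MemLp.coeFn_toLp (memLp_comp hc fun a => w a / √(cellMass μ c a))

theorem adjoint_stepMap_apply (hc : Measurable c) (f : Lp ℝ 2 μ) (a : Fin m) :
    (stepMap μ hc).adjoint f a = (∫ x in c ⁻¹' {a}, f x ∂μ) / √(cellMass μ c a) := by
  have hinner : (stepMap μ hc).adjoint f a =
      inner ℝ (stepMap μ hc (EuclideanSpace.single a 1)) f := by
    rw [← ContinuousLinearMap.adjoint_inner_right, EuclideanSpace.inner_single_left, map_one,
      one_mul]
  have hint : inner ℝ (stepMap μ hc (EuclideanSpace.single a 1)) f =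
      ∫ x, (EuclideanSpace.single a (1 : ℝ) (c x) / √(cellMass μ c (c x))) * f x ∂μ := by
    rw [L2.inner_def]
    refine integral_congr_ae ?_
    filter_upwards [coeFn_stepMap (μ := μ) hc (EuclideanSpace.single a 1)] with x hx
    rw [hx, real_inner_eq_re_inner]
    exact mul_comm _ _
  rw [hinner, hint, integral_comp_mul hc
    (fun b => EuclideanSpace.single a (1 : ℝ) b / √(cellMass μ c b)) (integrable_Lp f),
    Finset.sum_eq_single a]
  · rw [PiLp.single_apply, if_pos rfl, one_div, inv_mul_eq_div]
  · intro b _ hb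
    rw [PiLp.single_apply, if_neg hb, zero_div, zero_mul]
  · exact fun h => absurd (Finset.mem_univ _) h

theorem norm_stepMap_le_one (hc : Measurable c) : ‖stepMap μ hc‖ ≤ 1 := by
  refine ContinuousLinearMap.opNorm_le_bound _ zero_le_one fun w => ?_
  refine le_of_sq_le_sq ?_ (by positivity)
  have hint : ∫ x, stepMap μ hc w x ^ 2 ∂μ = ∫ x, (w (c x) / √(cellMass μ c (c x))) ^ 2 ∂μ := by
    refine integral_congr_ae ?_
    filter_upwards [coeFn_stepMap (μ := μ) hc w] with x hx
    rw [hx]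
  rw [one_mul, norm_Lp_sq, hint, integral_comp hc fun a => (w a / √(cellMass μ c a)) ^ 2,
    EuclideanSpace.norm_sq_eq]
  refine Finset.sum_le_sum fun a _ => ?_
  rw [div_pow, Real.sq_sqrt (cellMass_nonneg μ c a), Real.norm_eq_abs, sq_abs, div_mul_eq_mul_div,
    mul_div_assoc]
  exact mul_le_of_le_one_right (sq_nonneg _) (div_self_le_one _)

theorem sqrt_cellMass_mul_adjoint_stepMap (hc : Measurable c) (f : Lp ℝ 2 μ) (a : Fin m) :
    √(cellMass μ c a) * (stepMap μ hc).adjoint f a = ∫ x in c ⁻¹' {a}, f x ∂μ := by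
  rw [adjoint_stepMap_apply]
  rcases (cellMass_nonneg μ c a).eq_or_lt with h | h
  · have hnull : μ (c ⁻¹' {a}) = 0 := (measureReal_eq_zero_iff).1 h.symm
    rw [setIntegral_measure_zero _ hnull, zero_div, mul_zero]
  · exact mul_div_cancel₀ _ (Real.sqrt_pos.2 h).ne'

theorem sqrt_cellMass_mul_adjoint_stepMap_stepMap (hc : Measurable c)
    (w : EuclideanSpace ℝ (Fin m)) (a : Fin m) :
    √(cellMass μ c a) * (stepMap μ hc).adjoint (stepMap μ hc w) a = √(cellMass μ c a) * w a := by
  have hcell : MeasurableSet (c ⁻¹' {a}) := hc (measurableSet_singleton a)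
  have hint : ∫ x in c ⁻¹' {a}, stepMap μ hc w x ∂μ =
      ∫ _ in c ⁻¹' {a}, w a / √(cellMass μ c a) ∂μ := by
    refine setIntegral_congr_ae hcell ?_
    filter_upwards [coeFn_stepMap (μ := μ) hc w] with x hx hxa
    rw [hx, show c x = a from hxa]
  rw [sqrt_cellMass_mul_adjoint_stepMap, hint, setIntegral_const, smul_eq_mul]
  change cellMass μ c a * (w a / √(cellMass μ c a)) = _
  rw [mul_div_left_comm, Real.div_sqrt, mul_comm]

theorem toEuclideanLin_cellMatrix_apply (p : Fin m → ℝ) (B : Fin m → Fin m → ℝ)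
    (w : EuclideanSpace ℝ (Fin m)) (a : Fin m) :
    Matrix.toEuclideanLin (cellMatrix p B) w a = √(p a) * ∑ b, B a b * (√(p b) * w b) := by
  simp only [Matrix.toLpLin_apply, cellMatrix, Matrix.mulVec, dotProduct, Matrix.of_apply,
    Finset.mul_sum, mul_assoc]

theorem inner_toEuclideanLin_cellMatrix (p : Fin m → ℝ) (B : Fin m → Fin m → ℝ)
    (w : EuclideanSpace ℝ (Fin m)) :
    inner ℝ (Matrix.toEuclideanLin (cellMatrix p B) w) w =
      ∑ a, (√(p a) * w a) * ∑ b, B a b * (√(p b) * w b) := by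
  simp only [PiLp.inner_apply, toEuclideanLin_cellMatrix_apply, RCLike.inner_apply, conj_trivial]
  exact Finset.sum_congr rfl fun a _ => by ring

theorem inner_cellMatrix_adjoint_stepMap_stepMap (hc : Measurable c) (B : Fin m → Fin m → ℝ)
    (w : EuclideanSpace ℝ (Fin m)) :
    inner ℝ (Matrix.toEuclideanLin (cellMatrix (cellMass μ c) B)
      ((stepMap μ hc).adjoint (stepMap μ hc w))) ((stepMap μ hc).adjoint (stepMap μ hc w)) =
    inner ℝ (Matrix.toEuclideanLin (cellMatrix (cellMass μ c) B) w) w := by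
  simp only [inner_toEuclideanLin_cellMatrix, sqrt_cellMass_mul_adjoint_stepMap_stepMap]

theorem stepMap_cellMatrix_adjoint_stepMap (hc : Measurable c) (B : Fin m → Fin m → ℝ)
    (f : Lp ℝ 2 μ) :
    stepMap μ hc (Matrix.toEuclideanLin (cellMatrix (cellMass μ c) B)
      ((stepMap μ hc).adjoint f)) =ᵐ[μ] fun x => ∫ y, B (c x) (c y) * f y ∂μ := by
  filter_upwards [coeFn_stepMap (μ := μ) hc (Matrix.toEuclideanLin (cellMatrix (cellMass μ c) B)
    ((stepMap μ hc).adjoint f)), ae_cellMass_ne_zero (μ := μ) (c := c)] with x hx hne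
  rw [hx, toEuclideanLin_cellMatrix_apply, integral_comp_mul hc (B (c x)) (integrable_Lp f),
    mul_div_cancel_left₀ _ (Real.sqrt_ne_zero'.2 ((cellMass_nonneg μ c _).lt_of_ne' hne))]
  simp only [sqrt_cellMass_mul_adjoint_stepMap]

theorem norm_integralOperator_sub_le (κ : SmallWorldKernel) {D : Measure I}
    [IsProbabilityMeasure D] {c : I → Fin m} (hc : Measurable c) {B : Fin m → Fin m → ℝ} {η : ℝ}
    (hη : 0 ≤ η) (hB : ∀ x y, |κ.val x y - B (c x) (c y)| ≤ η) (f : Lp ℝ 2 D) :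
    ‖κ.integralOperator D f - stepMap D hc (Matrix.toEuclideanLin (cellMatrix (cellMass D c) B)
      ((stepMap D hc).adjoint f))‖ ≤ η * ‖f‖ := by
  refine norm_Lp_le_of_ae_le (by positivity) ?_
  filter_upwards [Lp.coeFn_sub (κ.integralOperator D f) (stepMap D hc (Matrix.toEuclideanLin
      (cellMatrix (cellMass D c) B) ((stepMap D hc).adjoint f))),
    MemLp.coeFn_toLp (κ.memLp_integral D f), stepMap_cellMatrix_adjoint_stepMap hc B f]
    with x hsub hT hstep
  have hint : Integrable (fun y => B (c x) (c y) * f y) D :=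
    (memLp_comp hc (B (c x))).integrable_mul (Lp.memLp f)
  rw [hsub, Pi.sub_apply, hstep]
  change ‖((κ.memLp_integral D f).toLp : I → ℝ) x - _‖ ≤ _
  rw [hT, ← integral_sub (κ.integrable_val_mul D f x) hint]
  calc ‖∫ y, κ.val x y * f y - B (c x) (c y) * f y ∂D‖
      ≤ ∫ y, η * ‖f y‖ ∂D := by
        refine norm_integral_le_of_norm_le ((integrable_Lp f).norm.const_mul η)
          (Eventually.of_forall fun y => ?_)
        rw [← sub_mul, norm_mul]
        exact mul_le_mul_of_nonneg_right (hB x y) (norm_nonneg _)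
    _ ≤ η * ‖f‖ := by
        rw [integral_const_mul]
        exact mul_le_mul_of_nonneg_left (integral_norm_le_norm_Lp f) hη

end Discretization

section CellMatrixPerturbation

theorem abs_sqrt_sub_sqrt_le {a b : ℝ} (ha : 0 ≤ a) (hb : 0 ≤ b) : |√a - √b| ≤ √|a - b| := by
  refine Real.abs_le_sqrt ?_
  have hfactor : a - b = (√a - √b) * (√a + √b) := by
    rw [mul_comm, ← sq_sub_sq, Real.sq_sqrt ha, Real.sq_sqrt hb]
  rw [hfactor, abs_mul, ← sq_abs, sq]
  refine mul_le_mul_of_nonneg_left ?_ (abs_nonneg _)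
  exact (abs_sub_le_of_nonneg_of_le (Real.sqrt_nonneg a) (le_add_of_nonneg_right
    (Real.sqrt_nonneg b)) (Real.sqrt_nonneg b) (le_add_of_nonneg_left (Real.sqrt_nonneg a))).trans
    (le_abs_self _)

variable {m : ℕ}

theorem abs_inner_toEuclideanLin_le {M : Matrix (Fin m) (Fin m) ℝ} {ε : ℝ}
    (hM : ∀ a b, |M a b| ≤ ε) (w : EuclideanSpace ℝ (Fin m)) :
    |inner ℝ (Matrix.toEuclideanLin M w) w| ≤ m * ε * ‖w‖ ^ 2 := by
  rcases isEmpty_or_nonempty (Fin m) with hm | ⟨⟨a₀⟩⟩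
  · simp [Subsingleton.elim w 0]
  have hε : 0 ≤ ε := (abs_nonneg _).trans (hM a₀ a₀)
  calc |inner ℝ (Matrix.toEuclideanLin M w) w|
      = |∑ a, ∑ b, M a b * w b * w a| := by
        simp only [PiLp.inner_apply, Matrix.toLpLin_apply, Matrix.mulVec, dotProduct,
          RCLike.inner_apply, conj_trivial, Finset.mul_sum, mul_comm]
    _ ≤ ∑ a, ∑ b, ε * |w b| * |w a| := by
        refine (Finset.abs_sum_le_sum_abs _ _).trans (Finset.sum_le_sum fun a _ =>
          (Finset.abs_sum_le_sum_abs _ _).trans (Finset.sum_le_sum fun b _ => ?_))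
        rw [abs_mul, abs_mul]
        gcongr
        exact hM a b
    _ = ε * (∑ a, |w a|) ^ 2 := by
        rw [sq, Finset.sum_mul_sum, Finset.mul_sum]
        refine Finset.sum_congr rfl fun a _ => ?_
        rw [Finset.mul_sum]
        exact Finset.sum_congr rfl fun b _ => by ring
    _ ≤ ε * (m * ∑ a, |w a| ^ 2) := by
        gcongr
        simpa using sq_sum_le_card_mul_sum_sq (s := Finset.univ) (f := fun a => |w a|)
    _ = m * ε * ‖w‖ ^ 2 := by
        rw [EuclideanSpace.norm_sq_eq]
        simp only [Real.norm_eq_abs]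
        ring

theorem abs_cellMatrix_sub_le {p q : Fin m → ℝ} {B : Fin m → Fin m → ℝ} {τ : ℝ}
    (hp : ∀ a, p a ∈ Set.Icc 0 1) (hq : ∀ a, q a ∈ Set.Icc 0 1) (hB : ∀ a b, |B a b| ≤ 1)
    (hpq : ∀ a, |p a - q a| ≤ τ) (a b : Fin m) :
    |(cellMatrix p B - cellMatrix q B) a b| ≤ 2 * √τ := by
  have hsqrt : ∀ a, |√(p a) - √(q a)| ≤ √τ := fun a =>
    (abs_sqrt_sub_sqrt_le (hp a).1 (hq a).1).trans (Real.sqrt_le_sqrt (hpq a))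
  have hone : ∀ {r : ℝ}, r ∈ Set.Icc (0 : ℝ) 1 → |√r| ≤ 1 := fun hr => by
    rw [abs_of_nonneg (Real.sqrt_nonneg _)]
    exact Real.sqrt_le_one.2 hr.2
  calc |(cellMatrix p B - cellMatrix q B) a b|
      = |B a b| * |(√(p a) - √(q a)) * √(p b) + √(q a) * (√(p b) - √(q b))| := by
        rw [← abs_mul]
        simp only [Matrix.sub_apply, cellMatrix, Matrix.of_apply]
        congr 1
        ring
    _ ≤ 1 * (√τ * 1 + 1 * √τ) := by
        refine mul_le_mul (hB a b) ((abs_add_le _ _).trans ?_) (abs_nonneg _) zero_le_one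
        rw [abs_mul, abs_mul]
        gcongr
        exacts [hsqrt a, hone (hp b), hone (hq a), hsqrt b]
    _ = 2 * √τ := by ring

theorem formApprox_cellMatrix {p q : Fin m → ℝ} {B : Fin m → Fin m → ℝ} {τ : ℝ}
    (hp : ∀ a, p a ∈ Set.Icc 0 1) (hq : ∀ a, q a ∈ Set.Icc 0 1) (hB : ∀ a b, |B a b| ≤ 1)
    (hpq : ∀ a, |p a - q a| ≤ τ) :
    FormApprox (Matrix.toEuclideanLin (cellMatrix p B)) (Matrix.toEuclideanLin (cellMatrix q B))
      (m * (2 * √τ)) := by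
  refine ⟨LinearMap.id, fun _ => le_rfl, fun w => ?_⟩
  rw [LinearMap.id_apply, ← inner_sub_left, ← LinearMap.sub_apply, ← map_sub]
  exact abs_inner_toEuclideanLin_le (abs_cellMatrix_sub_le hp hq hB hpq) w

end CellMatrixPerturbation

section EmpiricalMeasure

variable {Ω : Type*} [MeasurableSpace Ω] [MeasurableSingletonClass Ω] {n : ℕ}

/-- The empirical distribution of the sample points `x 1, …, x n`. -/
def empiricalMeasure (x : Fin n → Ω) : Measure Ω :=
  (n : ENNReal)⁻¹ • ∑ i, Measure.dirac (x i)

theorem integral_empiricalMeasure (x : Fin n → Ω) (f : Ω → ℝ) :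
    ∫ y, f y ∂empiricalMeasure x = (n : ℝ)⁻¹ * ∑ i, f (x i) := by
  rw [empiricalMeasure, integral_smul_measure, integral_finsetSum_measure fun i _ =>
    integrable_dirac enorm_lt_top]
  simp only [integral_dirac, ENNReal.toReal_inv, ENNReal.toReal_natCast, smul_eq_mul]

theorem ae_empiricalMeasure_iff {x : Fin n → Ω} {p : Ω → Prop} :
    (∀ᵐ y ∂empiricalMeasure x, p y) ↔ ∀ i, p (x i) := by
  rw [empiricalMeasure, Measure.ae_ennreal_smul_measure_iff
    (ENNReal.inv_ne_zero.2 (ENNReal.natCast_ne_top n)), ae_finsetSum_measure_iff]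
  simp only [ae_dirac_eq, eventually_pure, Finset.mem_univ, true_implies]

instance [NeZero n] (x : Fin n → Ω) : IsProbabilityMeasure (empiricalMeasure x) := by
  constructor
  simp [empiricalMeasure, ENNReal.inv_mul_cancel (NeZero.ne (n : ENNReal))]

/-- The isometry `f ↦ (f (x 1), …, f (x n)) / √n` from `L²` of the empirical distribution to the
Euclidean space. -/
def sampleMap (x : Fin n → Ω) : Lp ℝ 2 (empiricalMeasure x) →ₗᵢ[ℝ] EuclideanSpace ℝ (Fin n) where
  toFun f := WithLp.toLp 2 fun i => (√n)⁻¹ * f (x i)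
  map_add' f g := by
    ext i
    change (√n)⁻¹ * (f + g : Lp ℝ 2 (empiricalMeasure x)) (x i) = _
    rw [ae_empiricalMeasure_iff.1 (Lp.coeFn_add f g) i, Pi.add_apply, mul_add]
    rfl
  map_smul' r f := by
    ext i
    change (√n)⁻¹ * (r • f : Lp ℝ 2 (empiricalMeasure x)) (x i) = _
    rw [ae_empiricalMeasure_iff.1 (Lp.coeFn_smul r f) i, Pi.smul_apply, smul_eq_mul,
      mul_left_comm]
    rfl
  norm_map' f := by
    rw [← sq_eq_sq₀ (norm_nonneg _) (norm_nonneg _), norm_Lp_sq, integral_empiricalMeasure,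
      EuclideanSpace.norm_sq_eq, Finset.mul_sum]
    simp [mul_pow]

theorem sampleMap_apply (x : Fin n → Ω) (f : Lp ℝ 2 (empiricalMeasure x)) (i : Fin n) :
    sampleMap x f i = (√n)⁻¹ * f (x i) := rfl

theorem adjoint_sampleMap_sampleMap (x : Fin n → Ω) (f : Lp ℝ 2 (empiricalMeasure x)) :
    (sampleMap x).toContinuousLinearMap.adjoint ((sampleMap x) f) = f :=
  DFunLike.congr_fun ((ContinuousLinearMap.norm_map_iff_adjoint_comp_self
    (sampleMap x).toContinuousLinearMap).1 (sampleMap x).norm_map) f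

theorem norm_sampleMap_adjoint_le_one (x : Fin n → Ω) :
    ‖(sampleMap x).toContinuousLinearMap.adjoint‖ ≤ 1 := by
  rw [LinearIsometryEquiv.norm_map]
  exact (sampleMap x).norm_toContinuousLinearMap_le

end EmpiricalMeasure

section GramOperator

variable (κ : SmallWorldKernel)

theorem memLp_val (μ : Measure I) [IsProbabilityMeasure μ] (x : I) : MemLp (κ.val x) 2 μ :=
  MemLp.of_bound (C := 1)
    (κ.continuous_val.comp (by fun_prop : Continuous fun y : I => (x, y))).aestronglyMeasurable
    (Eventually.of_forall fun y => by
      rw [Real.norm_of_nonneg (κ.val_pos x y).le]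
      exact κ.val_le_one x y)

/-- The section `κ(x, ·)` of the kernel, as an element of `L²(μ)`. -/
def kernelSection (μ : Measure I) [IsProbabilityMeasure μ] (x : I) : Lp ℝ 2 μ :=
  (memLp_val κ μ x).toLp

theorem coeFn_integralOperator (μ : Measure I) [IsProbabilityMeasure μ] (f : Lp ℝ 2 μ) :
    κ.integralOperator μ f =ᵐ[μ] fun x => inner ℝ (kernelSection κ μ x) f := by
  filter_upwards [MemLp.coeFn_toLp (κ.memLp_integral μ f)] with x hx
  refine hx.trans ?_
  rw [L2.inner_def]
  refine integral_congr_ae ?_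
  filter_upwards [MemLp.coeFn_toLp (memLp_val κ μ x)] with y hy
  rw [kernelSection, hy, real_inner_eq_re_inner]
  exact mul_comm _ _

theorem norm_kernelSection_le_one (μ : Measure I) [IsProbabilityMeasure μ] (x : I) :
    ‖kernelSection κ μ x‖ ≤ 1 := by
  refine norm_Lp_le_of_ae_le zero_le_one ?_
  filter_upwards [MemLp.coeFn_toLp (memLp_val κ μ x)] with y hy
  rw [kernelSection, hy, Real.norm_of_nonneg (κ.val_pos x y).le]
  exact κ.val_le_one x y

variable {n : ℕ} [NeZero n] (x : Fin n → I)

theorem toEuclideanLin_smul_gramMatrix (v : EuclideanSpace ℝ (Fin n)) :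
    Matrix.toEuclideanLin ((n : ℝ)⁻¹ • gramMatrix κ x) v =
      sampleMap x (κ.integralOperator (empiricalMeasure x)
        ((sampleMap x).toContinuousLinearMap.adjoint v)) := by
  ext i
  rw [sampleMap_apply, ae_empiricalMeasure_iff.1 (coeFn_integralOperator κ _ _) i]
  beta_reduce
  rw [ContinuousLinearMap.adjoint_inner_right]
  have hsection : ∀ j, sampleMap x (kernelSection κ (empiricalMeasure x) (x i)) j =
      (√n)⁻¹ * κ.val (x i) (x j) := fun j => by
    rw [sampleMap_apply, kernelSection,
      ae_empiricalMeasure_iff.1 (MemLp.coeFn_toLp (memLp_val κ (empiricalMeasure x) (x i))) j]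
  have hn : (n : ℝ)⁻¹ = (√n)⁻¹ * (√n)⁻¹ := by
    rw [← mul_inv, Real.mul_self_sqrt (Nat.cast_nonneg n)]
  simp only [LinearIsometry.coe_toContinuousLinearMap, PiLp.inner_apply, hsection, hn,
    Matrix.toLpLin_apply, gramMatrix, Matrix.mulVec, dotProduct, Matrix.smul_apply,
    Matrix.of_apply, smul_eq_mul, RCLike.inner_apply, conj_trivial, Finset.mul_sum]
  exact Finset.sum_congr rfl fun j _ => by ring

theorem norm_toEuclideanLin_smul_gramMatrix_sub_le (v : EuclideanSpace ℝ (Fin n)) :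
    ‖Matrix.toEuclideanLin ((n : ℝ)⁻¹ • gramMatrix κ x) v -
      (sampleMap x).toContinuousLinearMap.adjoint.adjoint
        (κ.integralOperator (empiricalMeasure x)
          ((sampleMap x).toContinuousLinearMap.adjoint v))‖ ≤ 0 * ‖v‖ := by
  rw [ContinuousLinearMap.adjoint_adjoint, toEuclideanLin_smul_gramMatrix,
    LinearIsometry.coe_toContinuousLinearMap, sub_self, norm_zero, zero_mul]

theorem formApprox_gramMatrix_integralOperator :
    FormApprox (Matrix.toEuclideanLin ((n : ℝ)⁻¹ • gramMatrix κ x))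
      (κ.integralOperator (empiricalMeasure x)) 0 :=
  formApprox_of_norm_sub_le (norm_sampleMap_adjoint_le_one x)
    (norm_toEuclideanLin_smul_gramMatrix_sub_le κ x)

theorem formApprox_integralOperator_gramMatrix :
    FormApprox (κ.integralOperator (empiricalMeasure x))
      (Matrix.toEuclideanLin ((n : ℝ)⁻¹ • gramMatrix κ x)) 0 := by
  refine formApprox_symm_of_norm_sub_le (norm_sampleMap_adjoint_le_one x) le_rfl
    (norm_toEuclideanLin_smul_gramMatrix_sub_le κ x) fun f => ?_
  rw [ContinuousLinearMap.adjoint_adjoint, LinearIsometry.coe_toContinuousLinearMap,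
    adjoint_sampleMap_sampleMap]

end GramOperator

section Comparison

variable (κ : SmallWorldKernel) {m : ℕ} {c : I → Fin m} {B : Fin m → Fin m → ℝ} {η : ℝ}

theorem formApprox_integralOperator_cellMatrix (μ : Measure I) [IsProbabilityMeasure μ]
    (hc : Measurable c) (hη : 0 ≤ η) (hκ : ∀ x y, |κ.val x y - B (c x) (c y)| ≤ η) :
    FormApprox (κ.integralOperator μ) (Matrix.toEuclideanLin (cellMatrix (cellMass μ c) B)) η := by
  refine formApprox_of_norm_sub_le (A := (stepMap μ hc).adjoint) ?_ ?_
  · rw [LinearIsometryEquiv.norm_map]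
    exact norm_stepMap_le_one hc
  · rw [ContinuousLinearMap.adjoint_adjoint]
    exact norm_integralOperator_sub_le κ hc hη hκ

theorem formApprox_cellMatrix_integralOperator (μ : Measure I) [IsProbabilityMeasure μ]
    (hc : Measurable c) (hη : 0 ≤ η) (hκ : ∀ x y, |κ.val x y - B (c x) (c y)| ≤ η) :
    FormApprox (Matrix.toEuclideanLin (cellMatrix (cellMass μ c) B)) (κ.integralOperator μ) η := by
  refine formApprox_symm_of_norm_sub_le (A := (stepMap μ hc).adjoint) ?_ hη ?_ ?_
  · rw [LinearIsometryEquiv.norm_map]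
    exact norm_stepMap_le_one hc
  · rw [ContinuousLinearMap.adjoint_adjoint]
    exact norm_integralOperator_sub_le κ hc hη hκ
  · rw [ContinuousLinearMap.adjoint_adjoint]
    exact inner_cellMatrix_adjoint_stepMap_stepMap hc B

theorem formApprox_integralOperator {μ ν : Measure I} [IsProbabilityMeasure μ]
    [IsProbabilityMeasure ν] (hc : Measurable c) (hη : 0 ≤ η)
    (hκ : ∀ x y, |κ.val x y - B (c x) (c y)| ≤ η) (hB : ∀ a b, |B a b| ≤ 1) {τ : ℝ}
    (hμν : ∀ a, |cellMass μ c a - cellMass ν c a| ≤ τ) :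
    FormApprox (κ.integralOperator μ) (κ.integralOperator ν) (η + m * (2 * √τ) + η) := by
  refine ((formApprox_integralOperator_cellMatrix κ μ hc hη hκ).trans
    (formApprox_cellMatrix (fun a => ⟨cellMass_nonneg μ c a, cellMass_le_one a⟩)
      (fun a => ⟨cellMass_nonneg ν c a, cellMass_le_one a⟩) hB hμν) (by positivity)).trans
    (formApprox_cellMatrix_integralOperator κ ν hc hη hκ) hη

end Comparison

section Cells

/-- A Lipschitz constant of the kernel. -/
def SmallWorldKernel.lip (κ : SmallWorldKernel) : ℝ := κ.c₀ * κ.Δ / κ.c₁ ^ 2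

theorem SmallWorldKernel.c₁_pos (κ : SmallWorldKernel) : 0 < κ.c₁ := κ.c₀_pos.trans_le κ.c₀_le_c₁

theorem SmallWorldKernel.Δ_pos (κ : SmallWorldKernel) : 0 < κ.Δ := one_pos.trans κ.one_lt_Δ

theorem SmallWorldKernel.lip_pos (κ : SmallWorldKernel) : 0 < κ.lip :=
  div_pos (mul_pos κ.c₀_pos κ.Δ_pos) (pow_pos κ.c₁_pos 2)

theorem abs_rpow_sub_rpow_le {p u v : ℝ} (hp : 1 ≤ p) (hu : u ∈ Set.Icc (0 : ℝ) 1)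
    (hv : v ∈ Set.Icc (0 : ℝ) 1) : |u ^ p - v ^ p| ≤ p * |u - v| := by
  refine Convex.norm_image_sub_le_of_norm_hasDerivWithin_le (f := fun x : ℝ => x ^ p)
    (f' := fun x => p * x ^ (p - 1)) (C := p) (s := Set.Icc (0 : ℝ) 1) (x := v) (y := u)
    (fun x _ => (Real.hasDerivAt_rpow_const (Or.inr hp)).hasDerivWithinAt) (fun x hx => ?_)
    (convex_Icc 0 1) hv hu
  rw [Real.norm_of_nonneg (mul_nonneg (by linarith) (Real.rpow_nonneg hx.1 _))]
  exact mul_le_of_le_one_right (by linarith) (Real.rpow_le_one hx.1 hx.2 (by linarith))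

theorem abs_div_add_sub_div_add_le {a b u v : ℝ} (ha : 0 ≤ a) (hb : 0 < b) (hu : 0 ≤ u)
    (hv : 0 ≤ v) : |a / (u + b) - a / (v + b)| ≤ a / b ^ 2 * |u - v| := by
  have hub : 0 < u + b := add_pos_of_nonneg_of_pos hu hb
  have hvb : 0 < v + b := add_pos_of_nonneg_of_pos hv hb
  calc |a / (u + b) - a / (v + b)| = a * |u - v| / ((u + b) * (v + b)) := by
        rw [div_sub_div _ _ hub.ne' hvb.ne', abs_div, abs_of_pos (mul_pos hub hvb),
          show a * (v + b) - (u + b) * a = a * (v - u) by ring, abs_mul, abs_of_nonneg ha,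
          abs_sub_comm]
    _ ≤ a * |u - v| / b ^ 2 := by
        rw [sq]
        gcongr <;> linarith
    _ = a / b ^ 2 * |u - v| := by ring

theorem SmallWorldKernel.abs_val_sub_le (κ : SmallWorldKernel) (x y x' y' : I) :
    |κ.val x y - κ.val x' y'| ≤ κ.lip * (|(x : ℝ) - x'| + |(y : ℝ) - y'|) := by
  have hdist : ∀ a b : I, |(a : ℝ) - b| ∈ Set.Icc (0 : ℝ) 1 := fun a b =>
    ⟨abs_nonneg _, abs_le.2 ⟨by linarith [a.2.1, b.2.2], by linarith [a.2.2, b.2.1]⟩⟩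
  have htriangle : |(|(x : ℝ) - y| - |(x' : ℝ) - y'|)| ≤ |(x : ℝ) - x'| + |(y : ℝ) - y'| := by
    refine (abs_abs_sub_abs_le _ _).trans ?_
    rw [sub_sub_sub_comm]
    exact abs_sub _ _
  calc |κ.val x y - κ.val x' y'|
      ≤ κ.c₀ / κ.c₁ ^ 2 * |(|(x : ℝ) - y| ^ κ.Δ) - |(x' : ℝ) - y'| ^ κ.Δ| :=
        abs_div_add_sub_div_add_le κ.c₀_pos.le κ.c₁_pos (Real.rpow_nonneg (abs_nonneg _) _)
          (Real.rpow_nonneg (abs_nonneg _) _)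
    _ ≤ κ.c₀ / κ.c₁ ^ 2 * (κ.Δ * (|(x : ℝ) - x'| + |(y : ℝ) - y'|)) :=
        mul_le_mul_of_nonneg_left ((abs_rpow_sub_rpow_le κ.one_lt_Δ.le (hdist x y)
          (hdist x' y')).trans (mul_le_mul_of_nonneg_left htriangle κ.Δ_pos.le))
          (div_nonneg κ.c₀_pos.le (sq_nonneg _))
    _ = κ.lip * (|(x : ℝ) - x'| + |(y : ℝ) - y'|) := by
        rw [SmallWorldKernel.lip]
        ring

variable (m : ℕ)

/-- The index `a` of the cell `[a / m, (a + 1) / m)` that contains a point of the unit interval; the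
end point `1` has the cell `m` to itself. -/
def cellIndex (x : I) : Fin (m + 1) :=
  ⟨⌊(m : ℝ) * x⌋₊, Nat.lt_succ_of_le (Nat.floor_le_of_le
    (mul_le_of_le_one_right (Nat.cast_nonneg m) x.2.2))⟩

/-- The left end point `a / m` of the cell of index `a`. -/
def cellPoint (a : Fin (m + 1)) : I :=
  ⟨(a : ℝ) / m, by positivity,
    div_le_one_of_le₀ (by exact_mod_cast Nat.le_of_lt_succ a.2) (by positivity)⟩

theorem measurable_cellIndex : Measurable (cellIndex m) :=
  measurable_to_countable' fun a => by
    have hpreimage : cellIndex m ⁻¹' {a} = (fun x : I => ⌊(m : ℝ) * x⌋₊) ⁻¹' {(a : ℕ)} :=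
      Set.ext fun x => Fin.ext_iff
    rw [hpreimage]
    exact (Nat.measurable_floor.comp (measurable_subtype_coe.const_mul _))
      (measurableSet_singleton _)

variable {m}

theorem abs_sub_cellPoint_le (hm : m ≠ 0) (x : I) :
    |(x : ℝ) - cellPoint m (cellIndex m x)| ≤ 1 / m := by
  have hm' : (0 : ℝ) < m := by positivity
  have hcell : (x : ℝ) - cellPoint m (cellIndex m x) = ((m : ℝ) * x - ⌊(m : ℝ) * x⌋₊) / m := by
    rw [sub_div, mul_div_cancel_left₀ _ hm'.ne']
    rfl
  rw [hcell, abs_div, abs_of_pos hm', abs_of_nonneg (sub_nonneg.2 (Nat.floor_le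
    (mul_nonneg hm'.le x.2.1)))]
  gcongr
  exact (sub_lt_iff_lt_add'.2 (Nat.lt_floor_add_one _)).le

variable (κ : SmallWorldKernel)

/-- The kernel sampled at the left end points of the cells. -/
def cellKernel (m : ℕ) (a b : Fin (m + 1)) : ℝ := κ.val (cellPoint m a) (cellPoint m b)

theorem abs_cellKernel_le_one (a b : Fin (m + 1)) : |cellKernel κ m a b| ≤ 1 := by
  rw [cellKernel, abs_of_pos (κ.val_pos _ _)]
  exact κ.val_le_one _ _

theorem abs_val_sub_cellKernel_le (hm : m ≠ 0) (x y : I) :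
    |κ.val x y - cellKernel κ m (cellIndex m x) (cellIndex m y)| ≤ κ.lip * (2 / m) := by
  refine (κ.abs_val_sub_le _ _ _ _).trans (mul_le_mul_of_nonneg_left ?_ κ.lip_pos.le)
  refine (add_le_add (abs_sub_cellPoint_le hm x) (abs_sub_cellPoint_le hm y)).trans_eq ?_
  ring

/-- The error of replacing one distribution by another one in the integral operator, if their
masses on the cells of size `1 / m` differ by at most `τ`. -/
def discretizationError (m : ℕ) (τ : ℝ) : ℝ :=
  κ.lip * (2 / m) + (m + 1 : ℕ) * (2 * √τ) + κ.lip * (2 / m)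

theorem discretizationError_nonneg (m : ℕ) (τ : ℝ) : 0 ≤ discretizationError κ m τ := by
  have hη : 0 ≤ κ.lip * (2 / m) := mul_nonneg κ.lip_pos.le (by positivity)
  exact add_nonneg (add_nonneg hη (by positivity)) hη

variable {D : Measure I} [IsProbabilityMeasure D] {τ : ℝ} {n : ℕ} [NeZero n] {x : Fin n → I}

theorem formApprox_integralOperator_gramMatrix_of_cellMass (hm : m ≠ 0)
    (hτ : ∀ a, |cellMass (empiricalMeasure x) (cellIndex m) a - cellMass D (cellIndex m) a| ≤ τ) :
    FormApprox (κ.integralOperator D) (Matrix.toEuclideanLin ((n : ℝ)⁻¹ • gramMatrix κ x))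
      (discretizationError κ m τ) := by
  have hη : 0 ≤ κ.lip * (2 / m) := mul_nonneg κ.lip_pos.le (by positivity)
  rw [← add_zero (discretizationError κ m τ)]
  exact (formApprox_integralOperator κ (measurable_cellIndex m) hη
    (abs_val_sub_cellKernel_le κ hm) (abs_cellKernel_le_one κ) fun a =>
      (abs_sub_comm _ _).trans_le (hτ a)).trans (formApprox_integralOperator_gramMatrix κ x) le_rfl

theorem formApprox_gramMatrix_integralOperator_of_cellMass (hm : m ≠ 0)
    (hτ : ∀ a, |cellMass (empiricalMeasure x) (cellIndex m) a - cellMass D (cellIndex m) a| ≤ τ) :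
    FormApprox (Matrix.toEuclideanLin ((n : ℝ)⁻¹ • gramMatrix κ x)) (κ.integralOperator D)
      (discretizationError κ m τ) := by
  have hη : 0 ≤ κ.lip * (2 / m) := mul_nonneg κ.lip_pos.le (by positivity)
  rw [← zero_add (discretizationError κ m τ)]
  refine (formApprox_gramMatrix_integralOperator κ x).trans (formApprox_integralOperator κ
    (measurable_cellIndex m) hη (abs_val_sub_cellKernel_le κ hm) (abs_cellKernel_le_one κ) hτ)
    (discretizationError_nonneg κ m τ)

end Cells

section IntegralOperator

variable (κ : SmallWorldKernel) (D : Measure I) [IsProbabilityMeasure D]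

theorem norm_integralOperator_le (f : Lp ℝ 2 D) : ‖κ.integralOperator D f‖ ≤ ‖f‖ := by
  refine norm_Lp_le_of_ae_le (norm_nonneg f) ?_
  filter_upwards [coeFn_integralOperator κ D f] with x hx
  rw [hx]
  exact (norm_inner_le_norm _ _).trans
    (mul_le_of_le_one_left (norm_nonneg f) (norm_kernelSection_le_one κ D x))

/-- The integral operator as a continuous linear map. -/
def integralCLM : Lp ℝ 2 D →L[ℝ] Lp ℝ 2 D :=
  (κ.integralOperator D).mkContinuous 1 fun f => by
    rw [one_mul]
    exact norm_integralOperator_le κ D f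

/-- The integral operator whose kernel is constant on the products of the cells of size `1 / m`. -/
def cellOperator (m : ℕ) : Lp ℝ 2 D →L[ℝ] Lp ℝ 2 D :=
  stepMap D (measurable_cellIndex m) ∘L
    (Matrix.toEuclideanLin
      (cellMatrix (cellMass D (cellIndex m)) (cellKernel κ m))).toContinuousLinearMap ∘L
    (stepMap D (measurable_cellIndex m)).adjoint

theorem isHermitian_cellMatrix {m : ℕ} (p : Fin m → ℝ) {B : Fin m → Fin m → ℝ}
    (hB : ∀ a b, B a b = B b a) : (cellMatrix p B).IsHermitian := by
  ext a b
  simp only [cellMatrix, Matrix.conjTranspose_apply, Matrix.of_apply, star_trivial, hB b a]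
  ring

theorem isSelfAdjoint_cellOperator (m : ℕ) : IsSelfAdjoint (cellOperator κ D m) :=
  IsSelfAdjoint.conj_adjoint (ContinuousLinearMap.isSelfAdjoint_iff_isSymmetric.2
    (Matrix.isSymmetric_toEuclideanLin_iff.2
      (isHermitian_cellMatrix _ fun _ _ => κ.val_comm _ _))) _

theorem isCompactOperator_cellOperator (m : ℕ) : IsCompactOperator (cellOperator κ D m) :=
  (isCompactOperator_of_locallyCompactSpace_dom (_ ∘L _)).clm_comp
    (stepMap D (measurable_cellIndex m))

theorem norm_integralCLM_sub_cellOperator_le {m : ℕ} (hm : m ≠ 0) :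
    ‖integralCLM κ D - cellOperator κ D m‖ ≤ κ.lip * (2 / m) := by
  have hη : 0 ≤ κ.lip * (2 / m) := mul_nonneg κ.lip_pos.le (by positivity)
  exact ContinuousLinearMap.opNorm_le_bound _ hη (norm_integralOperator_sub_le κ
    (measurable_cellIndex m) hη (abs_val_sub_cellKernel_le κ hm))

theorem tendsto_cellOperator : Tendsto (cellOperator κ D) atTop (nhds (integralCLM κ D)) := by
  refine tendsto_iff_norm_sub_tendsto_zero.2 (squeeze_zero' (.of_forall fun m => norm_nonneg _)
    ((eventually_ne_atTop 0).mono fun m hm => (norm_sub_rev _ _).trans_le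
      (norm_integralCLM_sub_cellOperator_le κ D hm)) ?_)
  simpa only [mul_zero] using
    (tendsto_const_nhds.div_atTop tendsto_natCast_atTop_atTop).const_mul κ.lip

theorem isCompactOperator_integralCLM : IsCompactOperator (integralCLM κ D) :=
  isCompactOperator_of_tendsto (tendsto_cellOperator κ D)
    (.of_forall (isCompactOperator_cellOperator κ D))

theorem isSymmetric_integralCLM : (integralCLM κ D).IsSymmetric := by
  refine ContinuousLinearMap.isSelfAdjoint_iff_isSymmetric.1 ?_
  exact (isClosed_eq continuous_star continuous_id).mem_of_tendsto (tendsto_cellOperator κ D)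
    (.of_forall (isSelfAdjoint_cellOperator κ D))

theorem sum_norm_sq_integralCLM_le_one {ι : Type*} {v : ι → Lp ℝ 2 D} (hv : Orthonormal ℝ v)
    (s : Finset ι) : ∑ i ∈ s, ‖integralCLM κ D (v i)‖ ^ 2 ≤ 1 := by
  have hsq : ∀ i ∈ s, Integrable (fun x => integralCLM κ D (v i) x ^ 2) D := fun i _ =>
    (Lp.memLp _).integrable_sq
  simp only [norm_Lp_sq]
  rw [← integral_finsetSum _ hsq]
  refine (integral_mono_ae (integrable_finsetSum _ hsq) (integrable_const (1 : ℝ)) ?_).trans_eq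
    (by simp only [integral_const, probReal_univ, one_smul])
  have hsections : ∀ᵐ x ∂D, ∀ i ∈ s,
      integralCLM κ D (v i) x = inner ℝ (kernelSection κ D x) (v i) :=
    (Finset.eventually_all s).2 fun i _ => coeFn_integralOperator κ D (v i)
  filter_upwards [hsections] with x hx
  calc ∑ i ∈ s, integralCLM κ D (v i) x ^ 2 = ∑ i ∈ s, ‖inner ℝ (v i) (kernelSection κ D x)‖ ^ 2 :=
        Finset.sum_congr rfl fun i hi => by
          rw [hx i hi, Real.norm_eq_abs, sq_abs, real_inner_comm]
    _ ≤ ‖kernelSection κ D x‖ ^ 2 := hv.sum_inner_products_le _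
    _ ≤ 1 := pow_le_one₀ (norm_nonneg _) (norm_kernelSection_le_one κ D x)

end IntegralOperator

section CompactSymmetric

open Module.End

variable {E : Type*} [NormedAddCommGroup E] [InnerProductSpace ℝ E] [CompleteSpace E]
  {T : E →L[ℝ] E}

theorem exists_hasSum_eigenvectors (hT : IsCompactOperator T) (hs : T.IsSymmetric) (v : E) :
    ∃ w : ℝ → E, (∀ μ, w μ ∈ eigenspace (T : Module.End ℝ E) μ) ∧ HasSum w v := by
  have hclosed : ∀ μ, IsClosed (eigenspace (T : Module.End ℝ E) μ : Set E) := fun μ => by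
    rw [eigenspace_def]
    exact (T - μ • (1 : E →L[ℝ] E)).isClosed_ker
  have : ∀ μ, CompleteSpace (eigenspace (T : Module.End ℝ E) μ) := fun μ =>
    (hclosed μ).completeSpace_coe
  have hsum := IsHilbertSum.mkInternal _ hs.orthogonalFamily_eigenspaces
    (Submodule.topologicalClosure_eq_top_iff.2
      (ContinuousLinearMap.orthogonalComplement_iSup_eigenspaces_eq_bot hT hs)).ge
  refine ⟨fun μ => hsum.linearIsometryEquiv v μ, fun μ => Subtype.coe_prop _, ?_⟩
  simpa using hsum.hasSum_linearIsometryEquiv_symm (hsum.linearIsometryEquiv v)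

theorem inner_apply_self_le_of_orthogonal (hT : IsCompactOperator T) (hs : T.IsSymmetric) {s : ℝ}
    {v : E} (h : ∀ μ, s < μ → ∀ u ∈ eigenspace (T : Module.End ℝ E) μ, inner ℝ u v = 0) :
    inner ℝ (T v) v ≤ s * ‖v‖ ^ 2 := by
  obtain ⟨w, hw, hwv⟩ := exists_hasSum_eigenvectors hT hs v
  have hcoord : ∀ μ, inner ℝ (w μ) v = ‖w μ‖ ^ 2 := fun μ => by
    rw [← real_inner_self_eq_norm_sq]
    refine (hwv.mapL (innerSL ℝ (w μ))).unique (hasSum_single μ fun ν hν => ?_)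
    exact hs.orthogonalFamily_eigenspaces hν.symm ⟨w μ, hw μ⟩ ⟨w ν, hw ν⟩
  have hform := (hwv.mapL T).mapL (innerSL ℝ v)
  have hnorm := (hwv.mapL (innerSL ℝ v)).mul_left s
  simp only [innerSL_apply_apply, real_inner_self_eq_norm_sq] at hform hnorm
  rw [real_inner_comm]
  refine hasSum_le (fun μ => ?_) hform hnorm
  rw [show T (w μ) = μ • w μ from mem_eigenspace_iff.1 (hw μ), inner_smul_right, real_inner_comm]
  rcases le_or_gt μ s with hμ | hμ
  · exact mul_le_mul_of_nonneg_right hμ (hcoord μ ▸ sq_nonneg _)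
  · rw [h μ hμ (w μ) (hw μ), mul_zero, mul_zero]

end CompactSymmetric

section EigenvalueSequence

open Module.End

variable {E : Type} [NormedAddCommGroup E] [InnerProductSpace ℝ E] [CompleteSpace E]
  {T : E →L[ℝ] E} {lam : ℕ → ℝ}

namespace IsEigenvalueSequence

theorem exists_orthonormal_span_eq (h : IsEigenvalueSequence (T : Module.End ℝ E) lam)
    (hT : IsCompactOperator T) {μ : ℝ} (hμ : μ ≠ 0) :
    ∃ g : {i // lam i = μ} → E, Orthonormal ℝ g ∧
      Submodule.span ℝ (Set.range g) = eigenspace (T : Module.End ℝ E) μ := by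
  have : FiniteDimensional ℝ (eigenspace (T : Module.End ℝ E) μ) :=
    T.finite_dimensional_eigenspace hT μ hμ
  have hcard := h.multiplicity μ hμ
  rw [← Module.finrank_eq_rank, ← Cardinal.mk_fin] at hcard
  obtain ⟨q⟩ := Cardinal.eq.1 hcard
  let b := stdOrthonormalBasis ℝ (eigenspace (T : Module.End ℝ E) μ)
  refine ⟨fun i => b (q i), ((b.orthonormal.comp q q.injective).comp_linearIsometry
    (eigenspace (T : Module.End ℝ E) μ).subtypeₗᵢ), ?_⟩
  have hrange : (Set.range fun i => (b (q i) : E)) =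
      (eigenspace (T : Module.End ℝ E) μ).subtype '' Set.range b.toBasis := by
    rw [← Set.range_comp, b.coe_toBasis]
    exact q.surjective.range_comp fun j => (b j : E)
  rw [hrange, Submodule.span_image, b.toBasis.span_eq, Submodule.map_subtype_top]

theorem exists_eigenvectors (h : IsEigenvalueSequence (T : Module.End ℝ E) lam)
    (hT : IsCompactOperator T) (hs : T.IsSymmetric) :
    ∃ e : ℕ → E, Orthonormal ℝ (fun i : {i // lam i ≠ 0} => e i) ∧
      (∀ i, lam i ≠ 0 → T (e i) = lam i • e i) ∧
      ∀ k v, (∀ i < k, inner ℝ (e i) v = 0) → inner ℝ (T v) v ≤ lam k * ‖v‖ ^ 2 := by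
  have hbasis : ∀ μ, ∃ g : {i // lam i = μ} → E, μ ≠ 0 → Orthonormal ℝ g ∧
      Submodule.span ℝ (Set.range g) = eigenspace (T : Module.End ℝ E) μ := fun μ => by
    rcases eq_or_ne μ 0 with hμ | hμ
    · exact ⟨0, fun hμ' => absurd hμ hμ'⟩
    · exact (h.exists_orthonormal_span_eq hT hμ).imp fun g hg _ => hg
  choose g hg using hbasis
  let e : ℕ → E := fun i => g (lam i) ⟨i, rfl⟩
  have he : ∀ μ (i : {i // lam i = μ}), e i = g μ i := by
    rintro _ ⟨i, rfl⟩
    rfl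
  have hmem : ∀ i, lam i ≠ 0 → e i ∈ eigenspace (T : Module.End ℝ E) (lam i) := fun i hi => by
    rw [← (hg _ hi).2]
    exact Submodule.subset_span (Set.mem_range_self _)
  refine ⟨e, ⟨fun i => (hg _ i.2).1.1 _, fun i j hij => ?_⟩, fun i hi => mem_eigenspace_iff.1
    (hmem i hi), fun k v hv => inner_apply_self_le_of_orthogonal hT hs fun μ hμ u hu => ?_⟩
  · rcases eq_or_ne (lam i) (lam j) with hlam | hlam
    · beta_reduce
      rw [he (lam j) ⟨i, hlam⟩, he (lam j) ⟨j, rfl⟩]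
      exact (hg _ j.2).1.2 fun hindex => hij (Subtype.ext (Subtype.mk.inj hindex))
    · exact hs.orthogonalFamily_eigenspaces hlam ⟨e i, hmem i i.2⟩ ⟨e j, hmem j j.2⟩
  · rw [← (hg μ ((h.nonneg k).trans_lt hμ).ne').2] at hu
    refine Submodule.mem_orthogonal_singleton_iff_inner_left.1 (Submodule.span_le.2 ?_ hu)
    rintro _ ⟨⟨i, rfl⟩, rfl⟩
    exact Submodule.mem_orthogonal_singleton_iff_inner_left.2
      (hv i (lt_of_not_ge fun hki => (h.antitone hki).not_gt hμ))

theorem exists_orthonormal_eigenvectors (h : IsEigenvalueSequence (T : Module.End ℝ E) lam)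
    (hT : IsCompactOperator T) (hs : T.IsSymmetric) {k : ℕ} (hk : 0 < lam k) :
    ∃ u : Fin (k + 1) → E, Orthonormal ℝ u ∧ ∀ i, T (u i) = lam i • u i := by
  obtain ⟨e, he, hTe, -⟩ := h.exists_eigenvectors hT hs
  have hne : ∀ i : Fin (k + 1), lam i ≠ 0 := fun i =>
    (hk.trans_le (h.antitone (Nat.lt_succ_iff.1 i.2))).ne'
  refine ⟨fun i => e i, ?_, fun i => hTe i (hne i)⟩
  exact he.comp (fun i : Fin (k + 1) => ⟨i, hne i⟩) fun i j hij =>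
    Fin.ext (congrArg Subtype.val hij)

theorem hasFormBound (h : IsEigenvalueSequence (T : Module.End ℝ E) lam)
    (hT : IsCompactOperator T) (hs : T.IsSymmetric) {k : ℕ} (hk : 0 < lam k) :
    HasFormBound (T : E →ₗ[ℝ] E) (lam k) (k + 1) := by
  obtain ⟨u, hu, hTu⟩ := h.exists_orthonormal_eigenvectors hT hs hk
  exact hasFormBound_of_orthonormal hu hTu fun i => h.antitone (Nat.lt_succ_iff.1 i.2)

/-- Among the vectors of a space of dimension `k + 1` there is one that is orthogonal to the first
`k` eigenvectors. -/
theorem le_of_hasFormBound (h : IsEigenvalueSequence (T : Module.End ℝ E) lam)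
    (hT : IsCompactOperator T) (hs : T.IsSymmetric) {k : ℕ} {θ : ℝ}
    (hk : HasFormBound (T : E →ₗ[ℝ] E) θ (k + 1)) : θ ≤ lam k := by
  obtain ⟨e, -, -, he⟩ := h.exists_eigenvectors hT hs
  obtain ⟨ι, hι, hθ⟩ := hk
  let coords : (Fin (k + 1) → ℝ) →ₗ[ℝ] (Fin k → ℝ) :=
    LinearMap.pi fun i => (innerₛₗ ℝ (e i)) ∘ₗ ι
  have hker : LinearMap.ker coords ≠ ⊥ := LinearMap.ker_ne_bot_of_finrank_lt (by simp)
  obtain ⟨w, hw, hw0⟩ := (Submodule.ne_bot_iff _).1 hker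
  have hιw : 0 < ‖ι w‖ := norm_pos_iff.2 ((map_ne_zero_iff ι hι).2 hw0)
  refine le_of_mul_le_mul_right ((hθ w).trans (he k (ι w) fun i hi => ?_)) (pow_pos hιw 2)
  exact congrFun (LinearMap.mem_ker.1 hw) ⟨i, hi⟩

theorem inner_nonneg (h : IsEigenvalueSequence (T : Module.End ℝ E) lam)
    (hT : IsCompactOperator T) (hs : T.IsSymmetric) (v : E) : 0 ≤ inner ℝ (T v) v := by
  have hneg : inner ℝ ((-T) v) v ≤ 0 * ‖v‖ ^ 2 := by
    have hsneg : (-T).IsSymmetric := fun u w => by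
      change inner ℝ (-T u) w = inner ℝ u (-T w)
      rw [inner_neg_left, inner_neg_right]
      exact congrArg _ (hs u w)
    refine inner_apply_self_le_of_orthogonal hT.neg hsneg fun μ hμ u hu => ?_
    have hempty : IsEmpty {i // lam i = -μ} :=
      ⟨fun i => (neg_lt_zero.2 hμ).not_ge (i.2 ▸ h.nonneg i)⟩
    have hbot : eigenspace (T : Module.End ℝ E) (-μ) = ⊥ := by
      rw [← Submodule.rank_eq_zero, ← h.multiplicity (-μ) (neg_ne_zero.2 hμ.ne'),
        Cardinal.mk_eq_zero]
    have hu' : u ∈ eigenspace (T : Module.End ℝ E) (-μ) := by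
      rw [mem_eigenspace_iff] at hu ⊢
      rw [neg_smul, ← hu]
      exact (neg_neg _).symm
    rw [hbot, Submodule.mem_bot] at hu'
    rw [hu', inner_zero_left]
  rwa [zero_mul, neg_apply, inner_neg_left, neg_nonpos] at hneg

section FormApprox

variable {F : Type*} [NormedAddCommGroup F] [InnerProductSpace ℝ F] [FiniteDimensional ℝ F]
  {S : F →ₗ[ℝ] F} {η : ℝ}

theorem sub_le_singularValues (h : IsEigenvalueSequence (T : Module.End ℝ E) lam)
    (hT : IsCompactOperator T) (hs : T.IsSymmetric) (hη : 0 ≤ η)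
    (hTS : FormApprox (T : E →ₗ[ℝ] E) S η) (k : ℕ) : lam k - η ≤ S.singularValues k := by
  rcases le_or_gt (lam k) η with hk | hk
  · exact (sub_nonpos.2 hk).trans (S.singularValues_nonneg k)
  · exact (hTS.hasFormBound (h.hasFormBound hT hs (hη.trans_lt hk)) hk).le_singularValues

theorem singularValues_sub_le (h : IsEigenvalueSequence (T : Module.End ℝ E) lam)
    (hT : IsCompactOperator T) (hs : T.IsSymmetric) (hη : 0 ≤ η) (hS : S.IsSymmetric)
    (hST : FormApprox S (T : E →ₗ[ℝ] E) η) (k : ℕ) : S.singularValues k - η ≤ lam k := by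
  rcases le_or_gt (S.singularValues k) η with hk | hk
  · exact (sub_nonpos.2 hk).trans (h.nonneg k)
  · exact h.le_of_hasFormBound hT hs (hST.hasFormBound (hasFormBound_singularValues hS hη
      (hST.neg_mul_norm_sq_le_inner (h.inner_nonneg hT hs)) hk) hk)

end FormApprox

end IsEigenvalueSequence

end EigenvalueSequence

section KernelSpectrum

variable {κ : SmallWorldKernel} {D : Measure I} [IsProbabilityMeasure D] {lam : ℕ → ℝ}

theorem SmallWorldKernel.div_le_val (κ : SmallWorldKernel) (x y : I) :
    κ.c₀ / (1 + κ.c₁) ≤ κ.val x y := by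
  have hdist : |(x : ℝ) - y| ^ κ.Δ ≤ 1 := Real.rpow_le_one (abs_nonneg _)
    (abs_le.2 ⟨by linarith [x.2.1, y.2.2], by linarith [x.2.2, y.2.1]⟩) κ.Δ_pos.le
  exact div_le_div_of_nonneg_left κ.c₀_pos.le (κ.denom_pos x y) (add_le_add_left hdist _)

theorem inner_integralOperator_const_pos :
    0 < inner ℝ (κ.integralOperator D (Lp.const 2 D 1)) (Lp.const 2 D 1) := by
  refine (div_pos κ.c₀_pos (add_pos one_pos κ.c₁_pos)).trans_le (le_inner_const_one ?_)
  filter_upwards [coeFn_integralOperator κ D (Lp.const 2 D 1)] with x hx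
  rw [hx]
  refine le_inner_const_one ?_
  filter_upwards [MemLp.coeFn_toLp (memLp_val κ D x)] with y hy
  rw [kernelSection, hy]
  exact κ.div_le_val x y

theorem eigenvalue_zero_pos (hlam : IsEigenvalueSequence (κ.integralOperator D) lam) :
    0 < lam 0 := by
  obtain ⟨e, -, -, he⟩ := IsEigenvalueSequence.exists_eigenvectors (T := integralCLM κ D) hlam
    (isCompactOperator_integralCLM κ D) (isSymmetric_integralCLM κ D)
  refine pos_of_mul_pos_left (inner_integralOperator_const_pos.trans_le
    (he 0 (Lp.const 2 D 1) fun i hi => absurd hi i.not_lt_zero)) (sq_nonneg _)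

theorem add_one_mul_eigenvalue_sq_le_one (hlam : IsEigenvalueSequence (κ.integralOperator D) lam)
    (k : ℕ) : (k + 1) * lam k ^ 2 ≤ 1 := by
  rcases (hlam.nonneg k).eq_or_lt with hk | hk
  · rw [← hk]
    norm_num
  obtain ⟨u, hu, hTu⟩ := IsEigenvalueSequence.exists_orthonormal_eigenvectors
    (T := integralCLM κ D) hlam (isCompactOperator_integralCLM κ D) (isSymmetric_integralCLM κ D) hk
  refine le_trans ?_ (sum_norm_sq_integralCLM_le_one κ D hu Finset.univ)
  simp only [hTu, norm_smul, hu.1, mul_one, Real.norm_eq_abs, sq_abs]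
  calc ((k : ℝ) + 1) * lam k ^ 2 = ∑ _i : Fin (k + 1), lam k ^ 2 := by simp
    _ ≤ ∑ i : Fin (k + 1), lam i ^ 2 := Finset.sum_le_sum fun i _ =>
        pow_le_pow_left₀ hk.le (hlam.antitone (Nat.lt_succ_iff.1 i.2)) 2

theorem exists_eigengap_pos (hlam : IsEigenvalueSequence (κ.integralOperator D) lam) :
    ∃ k, 1 ≤ k ∧ 0 < eigengap lam k := by
  by_contra! hgap
  have hconst : ∀ k, lam 0 ≤ lam k := fun k => by
    induction k with
    | zero => exact le_rfl
    | succ k ih => exact ih.trans (sub_nonpos.1 (hgap (k + 1) (Nat.le_add_left 1 k)))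
  have hpos : 0 < lam 0 ^ 2 := pow_pos (eigenvalue_zero_pos hlam) 2
  obtain ⟨k, hk⟩ := exists_nat_gt (lam 0 ^ 2)⁻¹
  have hle : (k + 1) * lam 0 ^ 2 ≤ 1 := (mul_le_mul_of_nonneg_left
    (pow_le_pow_left₀ (hlam.nonneg 0) (hconst k) 2) (by positivity)).trans
    (add_one_mul_eigenvalue_sq_le_one hlam k)
  rw [inv_lt_iff_one_lt_mul₀ hpos] at hk
  linarith

variable {n m : ℕ} [NeZero n] {x : Fin n → I} {τ : ℝ}

theorem neg_discretizationError_mul_le_inner_gramMatrix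
    (hlam : IsEigenvalueSequence (κ.integralOperator D) lam) (hm : m ≠ 0)
    (hτ : ∀ a, |cellMass (empiricalMeasure x) (cellIndex m) a - cellMass D (cellIndex m) a| ≤ τ)
    (v : EuclideanSpace ℝ (Fin n)) : -discretizationError κ m τ * ‖v‖ ^ 2 ≤
      inner ℝ (Matrix.toEuclideanLin ((n : ℝ)⁻¹ • gramMatrix κ x) v) v :=
  (formApprox_gramMatrix_integralOperator_of_cellMass κ hm hτ).neg_mul_norm_sq_le_inner
    (IsEigenvalueSequence.inner_nonneg (T := integralCLM κ D) hlam
      (isCompactOperator_integralCLM κ D) (isSymmetric_integralCLM κ D)) v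

theorem abs_singularValues_gramMatrix_sub_le
    (hlam : IsEigenvalueSequence (κ.integralOperator D) lam) (hm : m ≠ 0)
    (hτ : ∀ a, |cellMass (empiricalMeasure x) (cellIndex m) a - cellMass D (cellIndex m) a| ≤ τ)
    (k : ℕ) : |(Matrix.toEuclideanLin ((n : ℝ)⁻¹ • gramMatrix κ x)).singularValues k - lam k| ≤
      discretizationError κ m τ := by
  have hη := discretizationError_nonneg κ m τ
  have hsymm : (Matrix.toEuclideanLin ((n : ℝ)⁻¹ • gramMatrix κ x)).IsSymmetric :=
    Matrix.isSymmetric_toEuclideanLin_iff.2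
      ((isHermitian_gramMatrix κ x).smul (IsSelfAdjoint.all _))
  exact abs_sub_le_iff.2 ⟨sub_le_comm.1 (IsEigenvalueSequence.singularValues_sub_le
    (T := integralCLM κ D) hlam (isCompactOperator_integralCLM κ D) (isSymmetric_integralCLM κ D)
    hη hsymm (formApprox_gramMatrix_integralOperator_of_cellMass κ hm hτ) k),
    sub_le_comm.1 (IsEigenvalueSequence.sub_le_singularValues
    (T := integralCLM κ D) hlam (isCompactOperator_integralCLM κ D) (isSymmetric_integralCLM κ D)
    hη (formApprox_integralOperator_gramMatrix_of_cellMass κ hm hτ) k)⟩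

end KernelSpectrum

section CellConcentration

variable {Ω : Type*} [MeasurableSpace Ω] {n m : ℕ} {c : Ω → Fin m}

theorem integral_indicator_cell (hc : Measurable c) (μ : Measure Ω) (a : Fin m) :
    ∫ y, (c ⁻¹' {a}).indicator 1 y ∂μ = cellMass μ c a :=
  integral_indicator_one (hc (measurableSet_singleton a))

theorem measurable_indicator_cell (hc : Measurable c) (a : Fin m) :
    Measurable ((c ⁻¹' {a}).indicator (1 : Ω → ℝ)) :=
  measurable_one.indicator (hc (measurableSet_singleton a))

/-- The event that the empirical mass of some cell deviates by more than `τ` from its mass. -/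
def cellDeviation (D : Measure Ω) (n : ℕ) (c : Ω → Fin m) (τ : ℝ) : Set (Fin n → Ω) :=
  {x | ∃ a, τ < |cellMass (empiricalMeasure x) c a - cellMass D c a|}

variable [MeasurableSingletonClass Ω]

theorem measurableSet_cellDeviation (D : Measure Ω) (n : ℕ) (hc : Measurable c) (τ : ℝ) :
    MeasurableSet (cellDeviation D n c τ) := by
  simp only [cellDeviation, Set.ofPred_exists, ← integral_indicator_cell hc,
    integral_empiricalMeasure]
  refine MeasurableSet.iUnion fun a => measurableSet_lt measurable_const ?_
  have := measurable_indicator_cell hc a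
  fun_prop

variable {D : Measure Ω} [IsProbabilityMeasure D] [NeZero n] {τ : ℝ}

section Hoeffding

variable {g : Ω → ℝ}

theorem pi_integral_empiricalMeasure_sub_ge_le (hg : Measurable g)
    (hg01 : ∀ x, g x ∈ Set.Icc (0 : ℝ) 1) (hτ : 0 ≤ τ) :
    Measure.pi (fun _ : Fin n => D)
        {x | τ ≤ ∫ y, g y ∂empiricalMeasure x - ∫ y, g y ∂D} ≤
      ENNReal.ofReal (Real.exp (-(2 * n * τ ^ 2))) := by
  have hn : (0 : ℝ) < n := Nat.cast_pos.2 (NeZero.pos n)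
  set P := Measure.pi (fun _ : Fin n => D)
  have hindep : iIndepFun (fun (i : Fin n) (x : Fin n → Ω) => g (x i) - ∫ y, g y ∂D) P :=
    iIndepFun_pi (X := fun _ y => g y - ∫ y, g y ∂D) fun _ => (hg.sub_const _).aemeasurable
  have hsubgaussian : ∀ i ∈ (Finset.univ : Finset (Fin n)), HasSubgaussianMGF
      (fun x : Fin n → Ω => g (x i) - ∫ y, g y ∂D) ((‖(1 : ℝ) - 0‖₊ / 2) ^ 2) P := by
    intro i _
    rw [← integral_comp_eval (μ := fun _ : Fin n => D) (i := i) hg.aestronglyMeasurable]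
    exact hasSubgaussianMGF_of_mem_Icc (hg.comp (measurable_pi_apply i)).aemeasurable
      (.of_forall fun x => hg01 _)
  have hevent : {x : Fin n → Ω | τ ≤ ∫ y, g y ∂empiricalMeasure x - ∫ y, g y ∂D} =
      {x | n * τ ≤ ∑ i, (g (x i) - ∫ y, g y ∂D)} := by
    ext x
    rw [Set.mem_ofPred_eq, Set.mem_ofPred_eq, integral_empiricalMeasure, Finset.sum_sub_distrib,
      Finset.sum_const, Finset.card_univ, Fintype.card_fin, nsmul_eq_mul,
      ← mul_le_mul_iff_right₀ hn, mul_sub, mul_inv_cancel_left₀ hn.ne']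
  rw [hevent, ← ofReal_measureReal]
  refine ENNReal.ofReal_le_ofReal ((HasSubgaussianMGF.measure_sum_ge_le_of_iIndepFun hindep
    hsubgaussian (mul_nonneg hn.le hτ)).trans_eq (congrArg Real.exp ?_))
  simp only [sub_zero, nnnorm_one, Finset.sum_const, Finset.card_univ, Fintype.card_fin,
    nsmul_eq_mul]
  push_cast
  field_simp

theorem pi_abs_integral_empiricalMeasure_sub_gt_le (hg : Measurable g)
    (hg01 : ∀ x, g x ∈ Set.Icc (0 : ℝ) 1) (hτ : 0 ≤ τ) :
    Measure.pi (fun _ : Fin n => D)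
        {x | τ < |∫ y, g y ∂empiricalMeasure x - ∫ y, g y ∂D|} ≤
      ENNReal.ofReal (2 * Real.exp (-(2 * n * τ ^ 2))) := by
  have hcompl : ∀ (μ : Measure Ω) [IsProbabilityMeasure μ],
      ∫ y, (1 - g y) ∂μ = 1 - ∫ y, g y ∂μ := fun μ _ => by
    rw [integral_sub (integrable_const _)
      (Integrable.of_mem_Icc 0 1 hg.aemeasurable (.of_forall hg01))]
    simp
  rw [two_mul, ENNReal.ofReal_add (Real.exp_pos _).le (Real.exp_pos _).le]
  refine (measure_mono fun x hx => ?_).trans ((measure_union_le _ _).trans (add_le_add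
    (pi_integral_empiricalMeasure_sub_ge_le hg hg01 hτ)
    (pi_integral_empiricalMeasure_sub_ge_le (g := fun y => 1 - g y) (hg.const_sub 1)
      (fun y => ⟨sub_nonneg.2 (hg01 y).2, sub_le_self _ (hg01 y).1⟩) hτ)))
  rcases lt_abs.1 (Set.mem_ofPred_eq ▸ hx) with hx | hx
  · exact Or.inl hx.le
  · refine Or.inr ?_
    simp only [Set.mem_ofPred_eq, hcompl]
    linarith

end Hoeffding

theorem pi_cellDeviation_le (hc : Measurable c) (hτ : 0 ≤ τ) :
    Measure.pi (fun _ : Fin n => D) (cellDeviation D n c τ) ≤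
      ENNReal.ofReal (m * (2 * Real.exp (-(2 * n * τ ^ 2)))) := by
  simp only [cellDeviation, Set.ofPred_exists, ← integral_indicator_cell hc]
  refine (measure_iUnion_le _).trans ?_
  rw [tsum_fintype]
  refine (Finset.sum_le_sum fun a _ => pi_abs_integral_empiricalMeasure_sub_gt_le
    (measurable_indicator_cell hc a) (fun x => ?_) hτ).trans_eq ?_
  · exact ⟨Set.indicator_nonneg (fun _ _ => zero_le_one) _,
      Set.indicator_le_self' (f := 1) (fun _ _ => zero_le_one) _⟩
  · rw [Finset.sum_const, Finset.card_univ, Fintype.card_fin, nsmul_eq_mul,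
      ENNReal.ofReal_mul (Nat.cast_nonneg m), ENNReal.ofReal_natCast]

end CellConcentration

section Polar

variable {m n : Type*} [Fintype m] [Fintype n]

theorem sum_sq_eq_trace (M : Matrix m n ℝ) : ∑ i, ∑ j, M i j ^ 2 = (Mᵀ * M).trace := by
  simp only [Matrix.trace, Matrix.diag, Matrix.mul_apply, Matrix.transpose_apply, ← sq]
  exact Finset.sum_comm

variable [DecidableEq n]

theorem sum_sq_orthogonal_mul {W : Matrix n n ℝ} (hW : W ∈ Matrix.orthogonalGroup n ℝ)
    (M : Matrix n n ℝ) : ∑ i, ∑ j, (W * M) i j ^ 2 = ∑ i, ∑ j, M i j ^ 2 := by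
  rw [sum_sq_eq_trace, sum_sq_eq_trace, Matrix.transpose_mul, Matrix.mul_assoc,
    ← Matrix.mul_assoc Wᵀ, (Matrix.mem_orthogonalGroup_iff' n ℝ).1 hW, one_mul]

theorem sum_sq_conjStarAlgAut_diagonal (U : Matrix.orthogonalGroup n ℝ) (g : n → ℝ) :
    ∑ i, ∑ j, Unitary.conjStarAlgAut ℝ _ U (Matrix.diagonal g) i j ^ 2 = ∑ i, g i ^ 2 := by
  rw [sum_sq_eq_trace, ← Matrix.conjTranspose_eq_transpose_of_trivial,
    ← Matrix.star_eq_conjTranspose, ← map_star, ← map_mul, Unitary.conjStarAlgAut_apply,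
    Matrix.trace_mul_comm, ← mul_assoc, Unitary.coe_star_mul_self, one_mul,
    Matrix.star_eq_conjTranspose, Matrix.diagonal_conjTranspose, Matrix.diagonal_mul_diagonal,
    Matrix.trace_diagonal]
  simp only [star_trivial, ← sq]

theorem sum_sq_conjStarAlgAut_diagonal_sub_one (U : Matrix.orthogonalGroup n ℝ) (g : n → ℝ) :
    ∑ i, ∑ j, (Unitary.conjStarAlgAut ℝ _ U (Matrix.diagonal g) - 1) i j ^ 2 =
      ∑ i, (g i - 1) ^ 2 := by
  rw [← map_one (Unitary.conjStarAlgAut ℝ (Matrix n n ℝ) U), ← map_sub, ← Matrix.diagonal_one,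
    Matrix.diagonal_sub, sum_sq_conjStarAlgAut_diagonal]

theorem exists_orthogonal_mul_eq {G : Matrix n n ℝ} (hG : (Gᵀ * G).IsHermitian)
    (hpos : ∀ i, 0 < hG.eigenvalues i) :
    ∃ W ∈ Matrix.orthogonalGroup n ℝ,
      W * Unitary.conjStarAlgAut ℝ _ hG.eigenvectorUnitary
        (Matrix.diagonal fun i => √(hG.eigenvalues i)) = G := by
  set φ := Unitary.conjStarAlgAut ℝ (Matrix n n ℝ) hG.eigenvectorUnitary
  have hsqrt : ∀ i, √(hG.eigenvalues i) ≠ 0 := fun i => (Real.sqrt_pos.2 (hpos i)).ne'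
  set T := φ (Matrix.diagonal fun i => (√(hG.eigenvalues i))⁻¹) with hT
  have hTT : Tᵀ = T := by
    rw [← Matrix.conjTranspose_eq_transpose_of_trivial, ← Matrix.star_eq_conjTranspose, hT,
      ← map_star, Matrix.star_eq_conjTranspose, Matrix.diagonal_conjTranspose, star_trivial]
  have hTGGT : T * (Gᵀ * G) * T = 1 := by
    rw [hG.spectral_theorem, ← map_mul, ← map_mul, Matrix.diagonal_mul_diagonal,
      Matrix.diagonal_mul_diagonal, ← map_one φ, ← Matrix.diagonal_one]
    refine congrArg φ (congrArg Matrix.diagonal (funext fun i => ?_))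
    have := Real.mul_self_sqrt (hpos i).le
    field_simp [hsqrt i]
    simpa [sq] using this.symm
  refine ⟨G * T, (Matrix.mem_orthogonalGroup_iff' n ℝ).2 ?_, ?_⟩
  · change (G * T)ᵀ * (G * T) = 1
    rw [Matrix.transpose_mul, hTT, ← hTGGT]
    simp only [Matrix.mul_assoc]
  · rw [mul_assoc, ← map_mul, Matrix.diagonal_mul_diagonal]
    simp only [inv_mul_cancel₀ (hsqrt _), Matrix.diagonal_one, map_one, mul_one]

theorem sqrt_sub_one_sq_le {a : ℝ} (ha : 0 ≤ a) : (√a - 1) ^ 2 ≤ (a - 1) ^ 2 := by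
  obtain ⟨b, hb, rfl⟩ : ∃ b, 0 ≤ b ∧ b ^ 2 = a := ⟨√a, Real.sqrt_nonneg a, Real.sq_sqrt ha⟩
  rw [Real.sqrt_sq hb, show b ^ 2 - 1 = (b - 1) * (b + 1) by ring, mul_pow]
  exact le_mul_of_one_le_right (sq_nonneg _) (one_le_pow₀ (by linarith))

theorem exists_orthogonal_sum_sq_sub_le {G : Matrix n n ℝ}
    (hG : ∑ i, ∑ j, (Gᵀ * G - 1) i j ^ 2 < 1) :
    ∃ W ∈ Matrix.orthogonalGroup n ℝ,
      ∑ i, ∑ j, (W - G) i j ^ 2 ≤ ∑ i, ∑ j, (Gᵀ * G - 1) i j ^ 2 := by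
  have hH : (Gᵀ * G).IsHermitian := Matrix.isHermitian_conjTranspose_mul_self G
  have hsum : ∑ i, ∑ j, (Gᵀ * G - 1) i j ^ 2 = ∑ i, (hH.eigenvalues i - 1) ^ 2 := by
    conv_lhs => rw [hH.spectral_theorem]
    exact sum_sq_conjStarAlgAut_diagonal_sub_one _ _
  have hpos : ∀ i, 0 < hH.eigenvalues i := fun i => by
    have := (Finset.single_le_sum (f := fun i => (hH.eigenvalues i - 1) ^ 2)
      (fun _ _ => sq_nonneg _) (Finset.mem_univ i)).trans_lt (hsum ▸ hG)
    nlinarith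
  obtain ⟨W, hW, hWG⟩ := exists_orthogonal_mul_eq hH hpos
  refine ⟨W, hW, ?_⟩
  calc ∑ i, ∑ j, (W - G) i j ^ 2
      = ∑ i, ∑ j, (G - W) i j ^ 2 := by simp only [Matrix.sub_apply, sub_sq_comm]
    _ = ∑ i, (√(hH.eigenvalues i) - 1) ^ 2 := by
      conv_lhs => rw [← hWG]
      rw [← mul_sub_one, sum_sq_orthogonal_mul hW, sum_sq_conjStarAlgAut_diagonal_sub_one]
    _ ≤ ∑ i, (hH.eigenvalues i - 1) ^ 2 :=
      Finset.sum_le_sum fun i _ => sqrt_sub_one_sq_le (hpos i).le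
    _ = _ := hsum.symm

end Polar

section SubspacePerturbation

variable {E : Type*} [NormedAddCommGroup E] [InnerProductSpace ℝ E]

theorem mul_norm_le_norm_of_mul_norm_sq_le_inner {x z : E} {c : ℝ}
    (h : c * ‖x‖ ^ 2 ≤ inner ℝ z x) : c * ‖x‖ ≤ ‖z‖ := by
  rcases (norm_nonneg x).eq_or_lt with h0 | h0
  · simp [← h0]
  · refine le_of_mul_le_mul_right ?_ h0
    rw [mul_assoc, ← sq]
    exact h.trans (real_inner_le_norm z x)

theorem mul_norm_sub_smul_le_norm_sub_sq_smul {R : E →ₗ[ℝ] E} (hR : ∀ x, 0 ≤ inner ℝ (R x) x)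
    (μ : ℝ) (v : E) : μ * ‖R v - μ • v‖ ≤ ‖R (R v) - μ ^ 2 • v‖ := by
  set x := R v - μ • v with hx
  have hfactor : R (R v) - μ ^ 2 • v = R x + μ • x := by
    rw [hx, map_sub, map_smul, smul_sub, smul_smul, ← sq]
    abel
  refine mul_norm_le_norm_of_mul_norm_sq_le_inner ?_
  rw [hfactor, inner_add_left, real_inner_smul_left, real_inner_self_eq_norm_sq]
  exact le_add_of_nonneg_left (hR x)

variable {ι : Type*} [Fintype ι]

/-- The operator `∑ i, a i ⟨u i, ·⟩ u i`; for orthonormal `u` its eigenvalues are `a i` on `u i`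
and zero on the orthogonal complement. -/
def spectralOperator (u : ι → E) (a : ι → ℝ) : E →ₗ[ℝ] E :=
  ∑ i, a i • (innerₗ E (u i)).smulRight (u i)

theorem spectralOperator_apply (u : ι → E) (a : ι → ℝ) (v : E) :
    spectralOperator u a v = ∑ i, (a i * inner ℝ (u i) v) • u i := by
  simp [spectralOperator, smul_smul]

theorem inner_spectralOperator_self_nonneg (u : ι → E) {a : ι → ℝ} (ha : ∀ i, 0 ≤ a i) (v : E) :
    0 ≤ inner ℝ (spectralOperator u a v) v := by
  rw [spectralOperator_apply, sum_inner]
  refine Finset.sum_nonneg fun i _ => ?_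
  rw [real_inner_smul_left, mul_assoc]
  exact mul_nonneg (ha i) (mul_self_nonneg _)

theorem apply_spectralOperator_one {u : ι → E} {P : E →ₗ[ℝ] E} {s : ι → ℝ}
    (hPu : ∀ i, P (u i) = s i • u i) (v : E) :
    P (spectralOperator u 1 v) = spectralOperator u s v := by
  simp only [spectralOperator_apply, map_sum, map_smul, hPu, smul_smul, Pi.one_apply, one_mul,
    mul_comm (s _)]

theorem sum_inner_sq_le {u : ι → E} (hu : Orthonormal ℝ u) (w : E) :
    ∑ i, inner ℝ (u i) w ^ 2 ≤ ‖w‖ ^ 2 := by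
  simpa using hu.sum_inner_products_le w (s := Finset.univ)

theorem exists_orthogonal_sum_sq_sub_inner_le [DecidableEq ι] (u : ι → E) {v : ι → E}
    (hv : Orthonormal ℝ v)
    (hproj : ∑ j, ‖v j - spectralOperator u 1 (v j)‖ ^ 2 < 1) :
    ∃ W ∈ Matrix.orthogonalGroup ι ℝ, ∑ j, ∑ i, (W i j - inner ℝ (u i) (v j)) ^ 2 ≤
      ∑ j, ‖v j - spectralOperator u 1 (v j)‖ ^ 2 := by
  set G : Matrix ι ι ℝ := Matrix.of fun i j => inner ℝ (u i) (v j) with hG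
  have hentry : ∀ i j, (Gᵀ * G - 1) i j =
      -inner ℝ (v i) (v j - spectralOperator u 1 (v j)) := fun i j => by
    rw [inner_sub_right, orthonormal_iff_ite.1 hv, Matrix.sub_apply, Matrix.one_apply, neg_sub,
      spectralOperator_apply, inner_sum, Matrix.mul_apply]
    simp [hG, real_inner_smul_right, real_inner_comm, mul_comm]
  have hgram : ∑ i, ∑ j, (Gᵀ * G - 1) i j ^ 2 ≤ ∑ j, ‖v j - spectralOperator u 1 (v j)‖ ^ 2 := by
    rw [Finset.sum_comm]
    refine Finset.sum_le_sum fun j _ => ?_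
    simp only [hentry, neg_sq]
    exact sum_inner_sq_le hv _
  obtain ⟨W, hW, hWG⟩ := exists_orthogonal_sum_sq_sub_le (hgram.trans_lt hproj)
  exact ⟨W, hW, Finset.sum_comm.trans_le (hWG.trans hgram)⟩

variable {u : ι → E}

theorem norm_sq_sum_smul (hu : Orthonormal ℝ u) (a : ι → ℝ) :
    ‖∑ i, a i • u i‖ ^ 2 = ∑ i, a i ^ 2 := by
  rw [← real_inner_self_eq_norm_sq, hu.inner_sum a a Finset.univ]
  simp only [conj_trivial, ← sq]

theorem inner_spectralOperator (hu : Orthonormal ℝ u) (a : ι → ℝ) (i : ι) (v : E) :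
    inner ℝ (u i) (spectralOperator u a v) = a i * inner ℝ (u i) v := by
  rw [spectralOperator_apply, hu.inner_right_fintype]

theorem spectralOperator_spectralOperator (hu : Orthonormal ℝ u) (a b : ι → ℝ) (v : E) :
    spectralOperator u a (spectralOperator u b v) = spectralOperator u (a * b) v := by
  rw [spectralOperator_apply, spectralOperator_apply u (a * b)]
  simp only [inner_spectralOperator hu, Pi.mul_apply, mul_assoc]

theorem sub_mul_norm_sub_spectralOperator_one_le (hu : Orthonormal ℝ u) {P : E →ₗ[ℝ] E}
    {s : ι → ℝ} (hPu : ∀ i, P (u i) = s i • u i) {s' : ℝ}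
    (hoff : ∀ y, (∀ i, inner ℝ (u i) y = 0) → inner ℝ (P y) y ≤ s' * ‖y‖ ^ 2) (l : ℝ) (v : E) :
    (l - s') * ‖v - spectralOperator u 1 v‖ ≤ ‖P v - l • v‖ := by
  set y := v - spectralOperator u 1 v with hy
  have hyu : ∀ i, inner ℝ (u i) y = 0 := fun i => by
    rw [hy, inner_sub_right, inner_spectralOperator hu, Pi.one_apply, one_mul, sub_self]
  have horth : ∀ a, inner ℝ (spectralOperator u a v) y = 0 := fun a => by
    rw [spectralOperator_apply, sum_inner]
    exact Finset.sum_eq_zero fun i _ => by rw [real_inner_smul_left, hyu, mul_zero]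
  have hv : v = spectralOperator u 1 v + y := (add_sub_cancel _ _).symm
  have hinner : inner ℝ (l • v - P v) y = l * ‖y‖ ^ 2 - inner ℝ (P y) y := by
    conv_lhs => rw [hv]
    rw [map_add, apply_spectralOperator_one hPu, inner_sub_left, real_inner_smul_left,
      inner_add_left, inner_add_left, horth, horth, zero_add, zero_add, real_inner_self_eq_norm_sq]
  rw [norm_sub_rev (P v)]
  refine mul_norm_le_norm_of_mul_norm_sq_le_inner ?_
  rw [hinner, sub_mul]
  exact sub_le_sub_left (hoff y hyu) _

theorem norm_spectralOperator_sub_smul_le (hu : Orthonormal ℝ u) {P : E →ₗ[ℝ] E}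
    (hP : P.IsSymmetric) {s : ι → ℝ} (hPu : ∀ i, P (u i) = s i • u i) {l : ℝ} (hl : 0 ≤ l) (v : E) :
    ‖spectralOperator u s v - l • v‖ ≤ ‖P v - l • v‖ + l * ‖v - spectralOperator u 1 v‖ := by
  have hproj : spectralOperator u s v - l • v =
      spectralOperator u 1 (P v - l • v) - l • (v - spectralOperator u 1 v) := by
    have hPs : spectralOperator u 1 (P v) = spectralOperator u s v := by
      simp only [spectralOperator_apply, ← hP (u _) v, hPu, real_inner_smul_left, Pi.one_apply,
        one_mul]
    rw [map_sub, map_smul, hPs, smul_sub]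
    abel
  have hcontr : ‖spectralOperator u 1 (P v - l • v)‖ ≤ ‖P v - l • v‖ := by
    refine le_of_sq_le_sq ?_ (norm_nonneg _)
    simp only [spectralOperator_apply, Pi.one_apply, one_mul, norm_sq_sum_smul hu]
    exact sum_inner_sq_le hu _
  rw [hproj]
  refine (norm_sub_le _ _).trans (add_le_add hcontr ?_)
  rw [norm_smul, Real.norm_of_nonneg hl]

theorem sqrt_mul_norm_spectralOperator_sqrt_sub_le (hu : Orthonormal ℝ u) {P : E →ₗ[ℝ] E}
    (hP : P.IsSymmetric) {s : ι → ℝ} (hs : ∀ i, 0 ≤ s i) (hPu : ∀ i, P (u i) = s i • u i) {l : ℝ}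
    (hl : 0 ≤ l) (v : E) :
    √l * ‖spectralOperator u (fun i => √(s i)) v - √l • v‖ ≤
      ‖P v - l • v‖ + l * ‖v - spectralOperator u 1 v‖ := by
  have hsqrt : (fun i => √(s i)) * (fun i => √(s i)) = s :=
    funext fun i => Real.mul_self_sqrt (hs i)
  refine le_trans ?_ (norm_spectralOperator_sub_smul_le hu hP hPu hl v)
  simpa only [spectralOperator_spectralOperator hu, hsqrt, Real.sq_sqrt hl] using
    mul_norm_sub_smul_le_norm_sub_sq_smul
      (inner_spectralOperator_self_nonneg u fun i => Real.sqrt_nonneg (s i)) √l v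

theorem norm_spectralOperator_sqrt_sub_le (hu : Orthonormal ℝ u) {P : E →ₗ[ℝ] E}
    (hP : P.IsSymmetric) {s : ι → ℝ} (hs : ∀ i, 0 ≤ s i) (hPu : ∀ i, P (u i) = s i • u i)
    {l b g r : ℝ} (hg : 0 < g) (hgl : g ≤ l) (hlb : l ≤ b) {v : E} (hv : ‖P v - l • v‖ ≤ g * r)
    (hproj : ‖v - spectralOperator u 1 v‖ ≤ r) :
    ‖spectralOperator u (fun i => √(s i)) v - √l • v‖ ≤ 2 * √b * r := by
  have hl : 0 < l := hg.trans_le hgl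
  have hr : 0 ≤ r := (norm_nonneg _).trans hproj
  refine le_of_mul_le_mul_left ?_ (Real.sqrt_pos.2 hl)
  calc √l * ‖spectralOperator u (fun i => √(s i)) v - √l • v‖
      ≤ ‖P v - l • v‖ + l * ‖v - spectralOperator u 1 v‖ :=
        sqrt_mul_norm_spectralOperator_sqrt_sub_le hu hP hs hPu hl.le v
    _ ≤ l * r + l * r := by gcongr; exact hv.trans (by gcongr)
    _ = √l * (2 * √l * r) := by linear_combination (-2 * r) * Real.mul_self_sqrt hl.le
    _ ≤ √l * (2 * √b * r) := by gcongr

theorem norm_sq_sum_sqrt_mul_smul_sub_le (hu : Orthonormal ℝ u) {s : ι → ℝ}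
    (hs : ∀ i, 0 ≤ s i) {b : ℝ} (hsb : ∀ i, s i ≤ b) (w : ι → ℝ) (v z : E) :
    ‖∑ i, (√(s i) * w i) • u i - z‖ ^ 2 ≤
      2 * ‖spectralOperator u (fun i => √(s i)) v - z‖ ^ 2 +
        2 * (b * ∑ i, (w i - inner ℝ (u i) v) ^ 2) := by
  set x := spectralOperator u (fun i => √(s i)) v - z with hx
  set y := ∑ i, (√(s i) * (w i - inner ℝ (u i) v)) • u i with hy
  have hsum : ∑ i, (√(s i) * w i) • u i - z = x + y := by
    simp only [hx, hy, spectralOperator_apply, mul_sub, sub_smul, Finset.sum_sub_distrib]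
    abel
  have hynorm : ‖y‖ ^ 2 ≤ b * ∑ i, (w i - inner ℝ (u i) v) ^ 2 := by
    rw [hy, norm_sq_sum_smul hu, Finset.mul_sum]
    refine Finset.sum_le_sum fun i _ => ?_
    rw [mul_pow, Real.sq_sqrt (hs i)]
    exact mul_le_mul_of_nonneg_right (hsb i) (sq_nonneg _)
  rw [hsum]
  have := pow_le_pow_left₀ (norm_nonneg _) (norm_add_le x y) 2
  linarith [add_sq_le (a := ‖x‖) (b := ‖y‖)]

theorem exists_orthogonal_alignment [DecidableEq ι] (hu : Orthonormal ℝ u) {v : ι → E}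
    (hv : Orthonormal ℝ v) {P Q : E →ₗ[ℝ] E} (hP : P.IsSymmetric) {s l : ι → ℝ}
    (hPu : ∀ i, P (u i) = s i • u i) (hQv : ∀ j, Q (v j) = l j • v j) {s' g b r : ℝ} (hg : 0 < g)
    (hPQ : ∀ w, ‖(P - Q) w‖ ≤ g * r * ‖w‖)
    (hoff : ∀ y, (∀ i, inner ℝ (u i) y = 0) → inner ℝ (P y) y ≤ s' * ‖y‖ ^ 2) (hs' : 0 ≤ s')
    (hgap : ∀ j, s' + g ≤ l j) (hs : ∀ i, 0 ≤ s i) (hsb : ∀ i, s i ≤ b) (hlb : ∀ j, l j ≤ b)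
    (hsmall : Fintype.card ι * r ^ 2 < 1) :
    ∃ W ∈ Matrix.orthogonalGroup ι ℝ,
      ∑ j, ‖∑ i, (√(s i) * W i j) • u i - √(l j) • v j‖ ^ 2 ≤
        10 * b * (Fintype.card ι * r ^ 2) := by
  have hres : ∀ j, ‖P (v j) - l j • v j‖ ≤ g * r := fun j => by
    simpa only [LinearMap.sub_apply, hQv, hv.1 j, mul_one] using hPQ (v j)
  have hproj : ∀ j, ‖v j - spectralOperator u 1 (v j)‖ ≤ r := fun j => by
    refine le_of_mul_le_mul_left (le_trans ?_ (hres j)) hg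
    refine le_trans ?_ (sub_mul_norm_sub_spectralOperator_one_le hu hPu hoff (l j) (v j))
    exact mul_le_mul_of_nonneg_right (le_sub_iff_add_le'.2 (hgap j)) (norm_nonneg _)
  have hprojsum : ∑ j, ‖v j - spectralOperator u 1 (v j)‖ ^ 2 ≤ Fintype.card ι * r ^ 2 := by
    simpa using Finset.sum_le_card_nsmul Finset.univ _ _ fun j _ =>
      pow_le_pow_left₀ (norm_nonneg _) (hproj j) 2
  obtain ⟨W, hW, hWG⟩ := exists_orthogonal_sum_sq_sub_inner_le u hv (hprojsum.trans_lt hsmall)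
  refine ⟨W, hW, ?_⟩
  have hcol : ∀ j, ‖∑ i, (√(s i) * W i j) • u i - √(l j) • v j‖ ^ 2 ≤
      2 * (4 * b * r ^ 2) + 2 * (b * ∑ i, (W i j - inner ℝ (u i) (v j)) ^ 2) := fun j => by
    have hlj := (le_add_of_nonneg_left hs').trans (hgap j)
    have hx := pow_le_pow_left₀ (norm_nonneg _) (norm_spectralOperator_sqrt_sub_le hu hP hs hPu
      hg hlj (hlb j) (hres j) (hproj j)) 2
    rw [mul_pow, mul_pow, Real.sq_sqrt (hg.le.trans (hlj.trans (hlb j)))] at hx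
    linarith [norm_sq_sum_sqrt_mul_smul_sub_le hu hs hsb (W · j) (v j) (√(l j) • v j)]
  rcases isEmpty_or_nonempty ι with hι | ⟨⟨i⟩⟩
  · simp
  have hb : 0 ≤ b := (hs i).trans (hsb i)
  calc ∑ j, ‖∑ i, (√(s i) * W i j) • u i - √(l j) • v j‖ ^ 2
      ≤ ∑ j, (2 * (4 * b * r ^ 2) + 2 * (b * ∑ i, (W i j - inner ℝ (u i) (v j)) ^ 2)) :=
        Finset.sum_le_sum fun j _ => hcol j
    _ = Fintype.card ι * (2 * (4 * b * r ^ 2)) +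
          2 * (b * ∑ j, ∑ i, (W i j - inner ℝ (u i) (v j)) ^ 2) := by
      rw [Finset.sum_add_distrib, Finset.sum_const, Finset.card_univ, nsmul_eq_mul,
        ← Finset.mul_sum, ← Finset.mul_sum]
    _ ≤ Fintype.card ι * (2 * (4 * b * r ^ 2)) + 2 * (b * (Fintype.card ι * r ^ 2)) := by
      gcongr
      exact hWG.trans hprojsum
    _ = 10 * b * (Fintype.card ι * r ^ 2) := by ring

end SubspacePerturbation

section SingularValueDecomposition

section Rescaling

variable {n d : ℕ} {c : ℝ}

theorem frobeniusNorm_smul {m : ℕ} (hc : 0 ≤ c) (M : Matrix (Fin m) (Fin n) ℝ) :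
    frobeniusNorm (c • M) = c * frobeniusNorm M := by
  let _ := Matrix.frobeniusSeminormedAddCommGroup (m := Fin m) (n := Fin n) (α := ℝ)
  let _ := Matrix.frobeniusNormedSpace (m := Fin m) (n := Fin n) (α := ℝ) (R := ℝ)
  exact (norm_smul c M).trans (by rw [Real.norm_of_nonneg hc]; rfl)

theorem singularValue_smul (hc : 0 < c) (M : Matrix (Fin n) (Fin n) ℝ) (i : ℕ) :
    singularValue (c • M) i = c * singularValue M i := by
  rw [singularValue, map_smul, singularValues_smul _ hc, singularValue]

theorem IsSVD.smul (hc : 0 < c) {M U V : Matrix (Fin n) (Fin n) ℝ} (h : IsSVD M U V) :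
    IsSVD (c • M) U V := by
  refine ⟨h.1, h.2.1, ?_⟩
  have hdiag : (Matrix.diagonal fun i : Fin n => singularValue (c • M) (i + 1)) =
      c • Matrix.diagonal fun i : Fin n => singularValue M (i + 1) := by
    rw [← Matrix.diagonal_smul]
    exact congrArg _ (funext fun i => singularValue_smul hc M _)
  rw [hdiag, Matrix.mul_smul, Matrix.smul_mul]
  exact congrArg _ h.2.2

theorem topEmbedding_smul (hc : 0 < c) (h : d ≤ n) (M U : Matrix (Fin n) (Fin n) ℝ) :
    topEmbedding h (c • M) U = √c • topEmbedding h M U := by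
  unfold topEmbedding
  rw [← Matrix.mul_smul, ← Matrix.diagonal_smul]
  congr 2
  funext j
  rw [singularValue_smul hc, Real.sqrt_mul hc.le]
  rfl

end Rescaling

section Symmetric

variable {ι E : Type*} [Fintype ι] [NormedAddCommGroup E] [InnerProductSpace ℝ E]

theorem norm_apply_le_of_apply_apply_eq {T : E →ₗ[ℝ] E} (hT : T.IsSymmetric)
    (e : OrthonormalBasis ι ℝ E) {a : ι → ℝ} (ha : ∀ i, T (T (e i)) = a i ^ 2 • e i)
    (ha0 : ∀ i, 0 ≤ a i) {s : ℝ} (hs : 0 ≤ s) {y : E}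
    (hy : ∀ i, inner ℝ (e i) y = 0 ∨ a i ≤ s) : ‖T y‖ ≤ s * ‖y‖ := by
  refine le_of_sq_le_sq ?_ (mul_nonneg hs (norm_nonneg y))
  have hTy : ‖T y‖ ^ 2 = ∑ i, a i ^ 2 * inner ℝ (e i) y ^ 2 := by
    rw [← real_inner_self_eq_norm_sq, hT, ← e.sum_inner_mul_inner]
    refine Finset.sum_congr rfl fun i _ => ?_
    rw [← hT, ← hT, ha, real_inner_smul_left, real_inner_comm]
    ring
  rw [hTy, mul_pow, ← e.sum_sq_inner_right, Finset.mul_sum]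
  refine Finset.sum_le_sum fun i _ => ?_
  rcases hy i with h | h
  · simp [h]
  · gcongr
    exact ha0 i

end Symmetric

variable {n d : ℕ} {M U V : Matrix (Fin n) (Fin n) ℝ}

theorem orthonormal_toLp_col (hU : U ∈ Matrix.orthogonalGroup (Fin n) ℝ) :
    Orthonormal ℝ fun j => WithLp.toLp 2 (U.col j) := by
  rw [orthonormal_iff_ite]
  intro i j
  rw [← Matrix.one_apply, ← (Matrix.mem_orthogonalGroup_iff' (Fin n) ℝ).1 hU, Matrix.mul_apply]
  simp [PiLp.inner_apply, mul_comm]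

/-- The orthonormal basis formed by the columns of an orthogonal matrix. -/
def columnBasis (hU : U ∈ Matrix.orthogonalGroup (Fin n) ℝ) :
    OrthonormalBasis (Fin n) ℝ (EuclideanSpace ℝ (Fin n)) :=
  OrthonormalBasis.mk (orthonormal_toLp_col hU)
    ((orthonormal_toLp_col hU).linearIndependent.span_eq_top_of_card_eq_finrank' (by simp)).ge

theorem columnBasis_apply (hU : U ∈ Matrix.orthogonalGroup (Fin n) ℝ) (i j : Fin n) :
    columnBasis hU j i = U i j := by
  rw [columnBasis, OrthonormalBasis.coe_mk]
  rfl

theorem toEuclideanLin_columnBasis (hU : U ∈ Matrix.orthogonalGroup (Fin n) ℝ) (j : Fin n) :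
    Matrix.toEuclideanLin M (columnBasis hU j) = WithLp.toLp 2 ((M * U).col j) := by
  rw [columnBasis, OrthonormalBasis.coe_mk]
  rfl

theorem IsSVD.mul_mul_eq (h : IsSVD M U V) (hM : M.IsHermitian) :
    M * (M * U) = U * Matrix.diagonal fun i : Fin n => singularValue M (i + 1) ^ 2 := by
  have hU := (Matrix.mem_orthogonalGroup_iff' (Fin n) ℝ).1 h.1
  have hV := (Matrix.mem_orthogonalGroup_iff' (Fin n) ℝ).1 h.2.1
  obtain ⟨S, hS⟩ : ∃ S, S = Matrix.diagonal fun i : Fin n => singularValue M (i + 1) := ⟨_, rfl⟩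
  have hMV : M * V = U * S := by rw [h.2.2, ← hS, mul_assoc, hV, mul_one]
  have hMU : M * U = V * S := by
    rw [← hM.eq, Matrix.conjTranspose_eq_transpose_of_trivial, h.2.2, ← hS]
    simp only [Matrix.transpose_mul, Matrix.transpose_transpose, mul_assoc, hU, mul_one]
    rw [hS, Matrix.diagonal_transpose]
  rw [hMU, ← mul_assoc, hMV, mul_assoc, hS, Matrix.diagonal_mul_diagonal]
  simp only [sq]

theorem IsSVD.apply_apply_columnBasis (h : IsSVD M U V) (hM : M.IsHermitian) (j : Fin n) :
    Matrix.toEuclideanLin M (Matrix.toEuclideanLin M (columnBasis h.1 j)) =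
      singularValue M (j + 1) ^ 2 • columnBasis h.1 j := by
  rw [toEuclideanLin_columnBasis]
  ext i
  have := congrFun (congrFun (h.mul_mul_eq hM) i) j
  rw [Matrix.mul_diagonal, mul_comm, ← columnBasis_apply h.1] at this
  exact this

theorem IsSVD.norm_apply_le (h : IsSVD M U V) (hM : M.IsHermitian) (hd : d ≤ n)
    {y : EuclideanSpace ℝ (Fin n)}
    (hy : ∀ i : Fin d, inner ℝ (columnBasis h.1 (Fin.castLE hd i)) y = 0) :
    ‖Matrix.toEuclideanLin M y‖ ≤ singularValue M (d + 1) * ‖y‖ := by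
  refine norm_apply_le_of_apply_apply_eq (Matrix.isSymmetric_toEuclideanLin_iff.2 hM)
    (columnBasis h.1) (h.apply_apply_columnBasis hM) (fun i => LinearMap.singularValues_nonneg _ _)
    (LinearMap.singularValues_nonneg _ _) fun i => ?_
  rcases lt_or_ge (i : ℕ) d with hi | hi
  · exact Or.inl (hy ⟨i, hi⟩)
  · exact Or.inr (LinearMap.singularValues_antitone _ (by simpa using hi))

theorem topEmbedding_apply (h : d ≤ n) (M U : Matrix (Fin n) (Fin n) ℝ) (i : Fin n) (j : Fin d) :
    topEmbedding h M U i j = U i (Fin.castLE h j) * √(singularValue M (j + 1)) := by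
  rw [topEmbedding, Matrix.mul_diagonal]
  rfl

theorem col_topEmbedding_mul_sub (hd : d ≤ n) {P Q UP UQ : Matrix (Fin n) (Fin n) ℝ}
    (hUP : UP ∈ Matrix.orthogonalGroup (Fin n) ℝ) (hUQ : UQ ∈ Matrix.orthogonalGroup (Fin n) ℝ)
    (W : Matrix (Fin d) (Fin d) ℝ) (j : Fin d) :
    WithLp.toLp 2 ((topEmbedding hd P UP * W - topEmbedding hd Q UQ).col j) =
      ∑ i : Fin d, (√(singularValue P (i + 1)) * W i j) • columnBasis hUP (Fin.castLE hd i) -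
        √(singularValue Q (j + 1)) • columnBasis hUQ (Fin.castLE hd j) := by
  ext k
  simp only [Matrix.col_apply, Matrix.sub_apply, Matrix.mul_apply, topEmbedding_apply,
    PiLp.sub_apply, PiLp.smul_apply, smul_eq_mul, WithLp.ofLp_sum, Finset.sum_apply,
    WithLp.ofLp_smul, Pi.smul_apply, columnBasis_apply]
  rw [mul_comm (UQ _ _)]
  exact congrArg (· - _) (Finset.sum_congr rfl fun i _ => by ring)

theorem frobeniusNorm_sq {m n : ℕ} (M : Matrix (Fin m) (Fin n) ℝ) :
    frobeniusNorm M ^ 2 = ∑ j, ‖WithLp.toLp 2 (M.col j)‖ ^ 2 := by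
  have hdef : frobeniusNorm M = (∑ i, ∑ j, ‖M i j‖ ^ (2 : ℝ)) ^ (1 / 2 : ℝ) :=
    Matrix.frobenius_norm_def M
  rw [hdef, ← Real.sqrt_eq_rpow, Real.sq_sqrt (by positivity), Finset.sum_comm]
  simp [EuclideanSpace.norm_sq_eq]

theorem exists_alignment_topEmbedding (hd : d ≤ n) {P Q UP VP UQ VQ : Matrix (Fin n) (Fin n) ℝ}
    (hP : P.IsHermitian) (hQ : Q.IsHermitian) (hUP : IsSVD P UP VP) (hUQ : IsSVD Q UQ VQ)
    {g r η b : ℝ} (hg : 0 < g)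
    (hPQ : ∀ v, ‖(Matrix.toEuclideanLin P - Matrix.toEuclideanLin Q) v‖ ≤ g * r * ‖v‖)
    (hPη : ∀ v, -η * ‖v‖ ^ 2 ≤ inner ℝ (Matrix.toEuclideanLin P v) v)
    (hQη : ∀ v, -η * ‖v‖ ^ 2 ≤ inner ℝ (Matrix.toEuclideanLin Q v) v)
    (hPs : ∀ j : Fin d, η < singularValue P (j + 1))
    (hQs : ∀ j : Fin d, η < singularValue Q (j + 1))
    (hgap : ∀ j : Fin d, singularValue P (d + 1) + g ≤ singularValue Q (j + 1))
    (hPb : ∀ j : Fin d, singularValue P (j + 1) ≤ b)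
    (hQb : ∀ j : Fin d, singularValue Q (j + 1) ≤ b) (hsmall : d * r ^ 2 < 1) :
    ∃ W ∈ Matrix.orthogonalGroup (Fin d) ℝ,
      frobeniusNorm (topEmbedding hd P UP * W - topEmbedding hd Q UQ) ≤
        √(10 * b * (d * r ^ 2)) := by
  have hoff : ∀ y, (∀ i : Fin d, inner ℝ (columnBasis hUP.1 (Fin.castLE hd i)) y = 0) →
      inner ℝ (Matrix.toEuclideanLin P y) y ≤ singularValue P (d + 1) * ‖y‖ ^ 2 := fun y hy => by
    rw [sq, ← mul_assoc]
    exact (real_inner_le_norm _ _).trans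
      (mul_le_mul_of_nonneg_right (hUP.norm_apply_le hP hd hy) (norm_nonneg y))
  obtain ⟨W, hW, hsum⟩ := exists_orthogonal_alignment
    ((columnBasis hUP.1).orthonormal.comp _ (Fin.castLE_injective hd))
    ((columnBasis hUQ.1).orthonormal.comp _ (Fin.castLE_injective hd))
    (Matrix.isSymmetric_toEuclideanLin_iff.2 hP)
    (fun j => apply_eq_smul_of_apply_apply_eq hPη (hPs j) (hUP.apply_apply_columnBasis hP _))
    (fun j => apply_eq_smul_of_apply_apply_eq hQη (hQs j) (hUQ.apply_apply_columnBasis hQ _))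
    hg hPQ hoff (LinearMap.singularValues_nonneg _ _) hgap
    (fun j => LinearMap.singularValues_nonneg _ _) hPb hQb (by simpa using hsmall)
  refine ⟨W, hW, Real.le_sqrt_of_sq_le ?_⟩
  rw [frobeniusNorm_sq]
  simpa only [col_topEmbedding_mul_sub hd hUP.1 hUQ.1, Fintype.card_fin,
    Function.comp_apply] using hsum

end SingularValueDecomposition

section GoodEvent

theorem neg_add_mul_le_inner_of_norm_sub_le {E : Type*} [NormedAddCommGroup E]
    [InnerProductSpace ℝ E] {T S : E →ₗ[ℝ] E} {η ε : ℝ} (h : ∀ v, ‖(T - S) v‖ ≤ ε * ‖v‖)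
    (hS : ∀ v, -η * ‖v‖ ^ 2 ≤ inner ℝ (S v) v) (v : E) :
    -(η + ε) * ‖v‖ ^ 2 ≤ inner ℝ (T v) v := by
  have hsplit : inner ℝ (T v) v = inner ℝ (S v) v + inner ℝ ((T - S) v) v := by
    rw [← inner_add_left, LinearMap.sub_apply, add_sub_cancel]
  have herr : |inner ℝ ((T - S) v) v| ≤ ε * ‖v‖ * ‖v‖ :=
    (abs_real_inner_le_norm _ _).trans (mul_le_mul_of_nonneg_right (h v) (norm_nonneg v))
  linarith [hS v, neg_le_of_abs_le herr]

section Threshold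

variable {n : ℕ} {A P : Matrix (Fin n) (Fin n) ℝ} {lam : ℕ → ℝ} {η : ℝ}

theorem exists_isThresholdIndex {t ρ : ℝ} {k : ℕ} (hk1 : 1 ≤ k) (hkn : k ≤ n)
    (h : 10 * (t / ρ) ^ (2 / 29 : ℝ) ≤
      singularValue (ρ⁻¹ • A) k - singularValue (ρ⁻¹ • A) (k + 1)) :
    ∃ d, IsThresholdIndex A t ρ d := by
  have hbdd : BddAbove {k : ℕ | 1 ≤ k ∧ k ≤ n ∧ 10 * (t / ρ) ^ (2 / 29 : ℝ) ≤
      singularValue (ρ⁻¹ • A) k - singularValue (ρ⁻¹ • A) (k + 1)} := ⟨n, fun k hk => hk.2.1⟩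
  exact ⟨_, Nat.sSup_mem ⟨k, hk1, hkn, h⟩ hbdd, fun k hk => le_csSup hbdd hk⟩

theorem abs_singularValue_sub_sub_eigengap_le
    (h : ∀ k, |(Matrix.toEuclideanLin P).singularValues k - lam k| ≤ η) (k : ℕ) :
    |singularValue P k - singularValue P (k + 1) - eigengap lam k| ≤ 2 * η := by
  rw [eigengap, sub_sub_sub_comm, two_mul]
  exact (abs_sub _ _).trans (add_le_add (h (k - 1)) (h k))

end Threshold

section Embedding

variable {n d : ℕ}

theorem sqrt_smul_topEmbedding (hd : d ≤ n) {a b : ℝ} (ha : 0 < a) (hb : 0 < b)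
    (M U : Matrix (Fin n) (Fin n) ℝ) :
    √b • topEmbedding hd ((a / b) • M) U = √a • topEmbedding hd M U := by
  rw [topEmbedding_smul (div_pos ha hb), smul_smul, ← Real.sqrt_mul hb.le, mul_div_cancel₀ _ hb.ne']

theorem frobeniusNorm_topEmbedding_sub_eq (hd : d ≤ n) {C : ℝ} (hC : 0 < C) (hn : n ≠ 0)
    (A K UA UK : Matrix (Fin n) (Fin n) ℝ) (W : Matrix (Fin d) (Fin d) ℝ) :
    frobeniusNorm (√C • topEmbedding hd A UA * W - topEmbedding hd K UK) =
      √n * frobeniusNorm (topEmbedding hd ((n / C : ℝ)⁻¹ • A) UA * W -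
        topEmbedding hd ((n : ℝ)⁻¹ • K) UK) := by
  have hn0 : (0 : ℝ) < n := by positivity
  have hK := sqrt_smul_topEmbedding hd one_pos hn0 K UK
  rw [Real.sqrt_one, one_smul, one_div] at hK
  rw [← frobeniusNorm_smul (Real.sqrt_nonneg _), smul_sub, ← Matrix.smul_mul, hK, inv_div,
    sqrt_smul_topEmbedding hd hC hn0]

variable {P Q UP VP UQ VQ : Matrix (Fin n) (Fin n) ℝ} {lam : ℕ → ℝ}

theorem exists_alignment_topEmbedding_of_eigengap (hd : d ≤ n) (hanti : Antitone lam)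
    (hnonneg : ∀ k, 0 ≤ lam k) (hP : P.IsHermitian) (hQ : Q.IsHermitian) (hUP : IsSVD P UP VP)
    (hUQ : IsSVD Q UQ VQ) {ε h : ℝ} (hδ : 0 < eigengap lam d) (hhδ : 6 * h ≤ eigengap lam d)
    (hPQ : ∀ v, ‖(Matrix.toEuclideanLin P - Matrix.toEuclideanLin Q) v‖ ≤ ε * ‖v‖)
    (hPform : ∀ v, -(2 * h) * ‖v‖ ^ 2 ≤ inner ℝ (Matrix.toEuclideanLin P v) v)
    (hQform : ∀ v, -(2 * h) * ‖v‖ ^ 2 ≤ inner ℝ (Matrix.toEuclideanLin Q v) v)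
    (hPsv : ∀ k, |(Matrix.toEuclideanLin P).singularValues k - lam k| ≤ 2 * h)
    (hQsv : ∀ k, |(Matrix.toEuclideanLin Q).singularValues k - lam k| ≤ h)
    (hsmall : d * (ε / (eigengap lam d / 2)) ^ 2 < 1) :
    ∃ W ∈ Matrix.orthogonalGroup (Fin d) ℝ,
      frobeniusNorm (topEmbedding hd P UP * W - topEmbedding hd Q UQ) ≤
        √(10 * (lam 0 + 2 * h) * (d * (ε / (eigengap lam d / 2)) ^ 2)) := by
  have hP' : ∀ k, |singularValue P (k + 1) - lam k| ≤ 2 * h := hPsv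
  have hQ' : ∀ k, |singularValue Q (k + 1) - lam k| ≤ h := hQsv
  have h0 : 0 ≤ h := (abs_nonneg _).trans (hQsv 0)
  have hlam : ∀ j : Fin d, lam d + eigengap lam d ≤ lam j := fun j => by
    rw [eigengap, add_sub_cancel]
    exact hanti (Nat.le_sub_one_of_lt j.2)
  have hlam0 : ∀ k, lam k ≤ lam 0 := fun k => hanti (Nat.zero_le k)
  refine exists_alignment_topEmbedding hd hP hQ hUP hUQ (half_pos hδ) ?_ hPform hQform
    (fun j => ?_) (fun j => ?_) (fun j => ?_) (fun j => ?_) (fun j => ?_) hsmall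
  · rwa [mul_div_cancel₀ _ (half_pos hδ).ne']
  · linarith [hnonneg d, hlam j, neg_le_of_abs_le (hP' j)]
  · linarith [hnonneg d, hlam j, neg_le_of_abs_le (hQ' j)]
  · linarith [hlam j, le_of_abs_le (hP' d), neg_le_of_abs_le (hQ' j)]
  · linarith [hlam0 j, le_of_abs_le (hP' j)]
  · linarith [hlam0 j, le_of_abs_le (hQ' j)]

end Embedding

/-- The constant `M₀` of the error bound. The perturbation argument for a gap `δ` yields an error
proportional to `1 / δ`, and `δ ≤ lam 0` trades this for `lam 0 / δ ^ 2`. -/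
def alignmentConstant (lam : ℕ → ℝ) : ℝ := 2 * √(10 * (lam 0 + 2)) * lam 0

theorem alignmentConstant_pos {lam : ℕ → ℝ} (h : 0 < lam 0) : 0 < alignmentConstant lam := by
  unfold alignmentConstant
  positivity

theorem mul_sqrt_le_alignmentConstant_mul {lam : ℕ → ℝ} (n d : ℕ) {ε δ h : ℝ} (h0 : 0 < lam 0)
    (hε : 0 ≤ ε) (hδ : 0 < δ) (hδ0 : δ ≤ lam 0) (h1 : h ≤ 1) :
    √n * √(10 * (lam 0 + 2 * h) * (d * (ε / (δ / 2)) ^ 2)) ≤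
      alignmentConstant lam * (ε * √(d * n) / δ ^ 2) := by
  have hsqrt : √(10 * (lam 0 + 2) * (d * (ε / (δ / 2)) ^ 2)) =
      √(10 * (lam 0 + 2)) * (√d * (ε / (δ / 2))) := by
    rw [Real.sqrt_mul (by positivity), Real.sqrt_mul (Nat.cast_nonneg d),
      Real.sqrt_sq (by positivity)]
  calc √n * √(10 * (lam 0 + 2 * h) * (d * (ε / (δ / 2)) ^ 2))
      ≤ √n * √(10 * (lam 0 + 2) * (d * (ε / (δ / 2)) ^ 2)) := by gcongr; linarith
    _ = 2 * √(10 * (lam 0 + 2)) * δ * (ε * √(d * n) / δ ^ 2) := by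
        rw [hsqrt, Real.sqrt_mul (Nat.cast_nonneg d)]
        field_simp
    _ ≤ 2 * √(10 * (lam 0 + 2)) * lam 0 * (ε * √(d * n) / δ ^ 2) := by gcongr

variable {κ : SmallWorldKernel} {D : Measure I} [IsProbabilityMeasure D] {lam : ℕ → ℝ}

theorem eigengap_le_eigenvalue_zero (hlam : IsEigenvalueSequence (κ.integralOperator D) lam)
    (d : ℕ) : eigengap lam d ≤ lam 0 :=
  (sub_le_self _ (hlam.nonneg d)).trans (hlam.antitone (Nat.zero_le _))

theorem mul_eigengap_sq_le_one (hlam : IsEigenvalueSequence (κ.integralOperator D) lam) (d : ℕ) :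
    d * eigengap lam d ^ 2 ≤ 1 := by
  rcases Nat.eq_zero_or_pos d with rfl | hd
  · simp
  have hle := add_one_mul_eigenvalue_sq_le_one hlam (d - 1)
  rw [Nat.cast_pred hd, sub_add_cancel] at hle
  refine le_trans ?_ hle
  gcongr
  · exact sub_nonneg.2 (hlam.antitone (Nat.sub_le d 1))
  · exact sub_le_self _ (hlam.nonneg d)

theorem mul_div_half_eigengap_sq_lt_one
    (hlam : IsEigenvalueSequence (κ.integralOperator D) lam) {d : ℕ} {ε : ℝ} (hε : 0 ≤ ε)
    (hδ : 0 < eigengap lam d) (hεδ : 4 * ε ≤ eigengap lam d ^ 2) :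
    d * (ε / (eigengap lam d / 2)) ^ 2 < 1 := by
  have hdiv : ε / (eigengap lam d / 2) ≤ eigengap lam d / 2 := by
    rw [div_le_iff₀ (half_pos hδ)]
    linarith
  calc d * (ε / (eigengap lam d / 2)) ^ 2 ≤ d * (eigengap lam d / 2) ^ 2 := by gcongr
    _ = d * eigengap lam d ^ 2 / 4 := by ring
    _ < 1 := by linarith [mul_eigengap_sq_le_one hlam d]

theorem norm_toEuclideanLin_rescaled_sub_le {n : ℕ} {C t : ℝ} (hC : 0 < C) (hn : n ≠ 0)
    {A K : Matrix (Fin n) (Fin n) ℝ}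
    (h : ∀ v, ‖Matrix.toEuclideanLin (A - C⁻¹ • K) v‖ ≤ t * ‖v‖) (v : EuclideanSpace ℝ (Fin n)) :
    ‖(Matrix.toEuclideanLin ((n / C : ℝ)⁻¹ • A) - Matrix.toEuclideanLin ((n : ℝ)⁻¹ • K)) v‖ ≤
      t / (n / C) * ‖v‖ := by
  have hscale : (n / C : ℝ)⁻¹ • A - (n : ℝ)⁻¹ • K = (n / C : ℝ)⁻¹ • (A - C⁻¹ • K) := by
    rw [smul_sub, smul_smul]
    congr 2
    field_simp
  rw [← map_sub, hscale, map_smul, LinearMap.smul_apply, norm_smul,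
    Real.norm_of_nonneg (by positivity), div_eq_inv_mul t, mul_assoc]
  exact mul_le_mul_of_nonneg_left (h v) (by positivity)

/-- The singular values of `A / ρ` are within `2 * h` of `lam`, so that a gap `14 * h` in `lam`
forces a gap `10 * h` in them, which in turn can only come from a gap `6 * h` in `lam`. -/
theorem exists_thresholdIndex_alignment (hlam : IsEigenvalueSequence (κ.integralOperator D) lam)
    {n : ℕ} (hn : n ≠ 0) {C ρ t h : ℝ} (hC : 0 < C) (hρ : ρ = n / C) (ht : 0 < t)
    (hh : (t / ρ) ^ (2 / 29 : ℝ) = h) (x : Fin n → I) (e : Sym2 (Fin n) → Bool)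
    (hnoise : ∀ v, ‖Matrix.toEuclideanLin (adjacency e - C⁻¹ • gramMatrix κ x) v‖ ≤ t * ‖v‖)
    (hform : ∀ v, -h * ‖v‖ ^ 2 ≤
      inner ℝ (Matrix.toEuclideanLin ((n : ℝ)⁻¹ • gramMatrix κ x) v) v)
    (hsv : ∀ k,
      |(Matrix.toEuclideanLin ((n : ℝ)⁻¹ • gramMatrix κ x)).singularValues k - lam k| ≤ h)
    (hε : t / ρ ≤ h ^ 2) (h1 : h ≤ 1) {k₀ : ℕ} (hk1 : 1 ≤ k₀) (hkn : k₀ ≤ n)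
    (hk₀ : 14 * h ≤ eigengap lam k₀) :
    ∃ (d : ℕ) (hd : d ≤ n), IsThresholdIndex (adjacency e) t ρ d ∧ 0 < eigengap lam d ∧
      ∀ UA VA UK VK : Matrix (Fin n) (Fin n) ℝ,
        IsSVD (adjacency e) UA VA → IsSVD (gramMatrix κ x) UK VK →
        ∃ W ∈ Matrix.orthogonalGroup (Fin d) ℝ,
          frobeniusNorm (√C • topEmbedding hd (adjacency e) UA * W -
              topEmbedding hd (gramMatrix κ x) UK) ≤
            alignmentConstant lam * (t * √(d * n) / (eigengap lam d ^ 2 * ρ)) := by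
  have hn0 : (0 : ℝ) < n := by positivity
  have hρ0 : 0 < ρ := hρ ▸ div_pos hn0 hC
  have hh0 : 0 < h := hh ▸ by positivity
  have hεh : t / ρ ≤ h := hε.trans (pow_le_of_le_one hh0.le h1 two_ne_zero)
  have hPQ : ∀ v, ‖(Matrix.toEuclideanLin (ρ⁻¹ • adjacency e) -
      Matrix.toEuclideanLin ((n : ℝ)⁻¹ • gramMatrix κ x)) v‖ ≤ t / ρ * ‖v‖ :=
    hρ ▸ norm_toEuclideanLin_rescaled_sub_le hC hn hnoise
  have hPsv : ∀ k, |(Matrix.toEuclideanLin (ρ⁻¹ • adjacency e)).singularValues k - lam k| ≤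
      2 * h := fun k => by
    have hweyl := abs_singularValues_sub_le hPQ (div_pos ht hρ0).le k
    linarith [abs_sub_le _ _ _ |>.trans (add_le_add hweyl (hsv k))]
  obtain ⟨d, hd⟩ := exists_isThresholdIndex (A := adjacency e) (t := t) (ρ := ρ) hk1 hkn <| by
    linarith [neg_le_of_abs_le (abs_singularValue_sub_sub_eigengap_le hPsv k₀)]
  have hδ : 6 * h ≤ eigengap lam d := by
    linarith [hd.1.2.2, le_of_abs_le (abs_singularValue_sub_sub_eigengap_le hPsv d)]
  have hδ0 : 0 < eigengap lam d := by linarith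
  refine ⟨d, hd.1.2.1, hd, hδ0, fun UA VA UK VK hA hK => ?_⟩
  obtain ⟨W, hW, hbound⟩ := exists_alignment_topEmbedding_of_eigengap hd.1.2.1 hlam.antitone
    hlam.nonneg ((isHermitian_adjacency e).smul (IsSelfAdjoint.all _))
    ((isHermitian_gramMatrix κ x).smul (IsSelfAdjoint.all _)) (hA.smul (inv_pos.2 hρ0))
    (hK.smul (inv_pos.2 hn0)) hδ0 hδ hPQ
    (fun v => (neg_add_mul_le_inner_of_norm_sub_le hPQ hform v).trans' (by gcongr; linarith))
    (fun v => (hform v).trans' (by gcongr; linarith)) hPsv hsv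
    (mul_div_half_eigengap_sq_lt_one hlam (div_pos ht hρ0).le hδ0 (by nlinarith))
  refine ⟨W, hW, ?_⟩
  rw [frobeniusNorm_topEmbedding_sub_eq _ hC hn, ← hρ, mul_comm (_ ^ 2), ← div_div,
    mul_div_right_comm t]
  exact (mul_le_mul_of_nonneg_left hbound (Real.sqrt_nonneg _)).trans
    (mul_sqrt_le_alignmentConstant_mul n d (eigenvalue_zero_pos hlam) (div_pos ht hρ0).le hδ0
      (eigengap_le_eigenvalue_zero hlam d) h1)

end GoodEvent

section Asymptotics

theorem eventually_const_mul_log_le {f : ℕ → ℝ} (hf : ∀ᶠ n in atTop, 0 ≤ f n)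
    (h : (fun n : ℕ => Real.log n) =o[atTop] f) {K : ℝ} (hK : 0 < K) :
    ∀ᶠ n : ℕ in atTop, K * Real.log n ≤ f n := by
  filter_upwards [h.bound (inv_pos.2 hK), hf] with n hn h0
  rw [Real.norm_of_nonneg h0, ← div_eq_inv_mul, le_div_iff₀' hK] at hn
  exact (mul_le_mul_of_nonneg_left (Real.le_norm_self _) hK.le).trans hn

theorem tendsto_natCast_rpow_atTop {a : ℝ} (ha : 0 < a) :
    Tendsto (fun n : ℕ => (n : ℝ) ^ a) atTop atTop :=
  (tendsto_rpow_atTop ha).comp tendsto_natCast_atTop_atTop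

theorem eventually_one_le_log : ∀ᶠ n : ℕ in atTop, 1 ≤ Real.log n :=
  (Real.tendsto_log_atTop.comp tendsto_natCast_atTop_atTop).eventually_ge_atTop 1

/-- The parameter of the partition of `[0, 1]` into cells that is used for `n` sample points. -/
def cellCount (n : ℕ) : ℕ := ⌈(n : ℝ) ^ (1 / 10 : ℝ)⌉₊

theorem cellCount_ne_zero {n : ℕ} (hn : n ≠ 0) : cellCount n ≠ 0 :=
  (Nat.ceil_pos.2 (by positivity)).ne'

theorem cellCount_add_one_le {n : ℕ} (hn : n ≠ 0) :
    ((cellCount n + 1 : ℕ) : ℝ) ≤ 3 * (n : ℝ) ^ (1 / 10 : ℝ) := by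
  have hone : 1 ≤ (n : ℝ) ^ (1 / 10 : ℝ) :=
    Real.one_le_rpow (by exact_mod_cast Nat.one_le_iff_ne_zero.2 hn) (by norm_num)
  have hceil := Nat.ceil_lt_add_one (show 0 ≤ (n : ℝ) ^ (1 / 10 : ℝ) by positivity)
  rw [Nat.cast_add_one, cellCount]
  linarith

theorem two_div_cellCount_le {n : ℕ} (hn : n ≠ 0) :
    2 / (cellCount n : ℝ) ≤ 2 * (n : ℝ) ^ (-(1 / 10) : ℝ) := by
  rw [Real.rpow_neg (Nat.cast_nonneg n), ← div_eq_mul_inv]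
  exact div_le_div_of_nonneg_left zero_le_two (by positivity) (Nat.le_ceil _)

/-- The accepted deviation of the empirical mass of a cell. Its square root, which enters the
discretization error, is of lower order than the inverse of the number of cells. -/
def cellTolerance (n : ℕ) : ℝ := (n : ℝ) ^ (-(2 / 5) : ℝ)

theorem cellTolerance_nonneg (n : ℕ) : 0 ≤ cellTolerance n := by
  unfold cellTolerance
  positivity

theorem eventually_discretizationError_le (κ : SmallWorldKernel) :
    ∀ᶠ n : ℕ in atTop,
      discretizationError κ (cellCount n) (cellTolerance n) ≤ (n : ℝ) ^ (-(1 / 29) : ℝ) := by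
  filter_upwards [eventually_ne_atTop 0, (tendsto_natCast_rpow_atTop
    (show (0 : ℝ) < 1 / 10 - 1 / 29 by norm_num)).eventually_ge_atTop (4 * κ.lip + 6)]
    with n hn hlarge
  have hn0 : (0 : ℝ) < n := by positivity
  have hl := κ.lip_pos
  have hsqrt : √(cellTolerance n) = (n : ℝ) ^ (-(1 / 10) : ℝ) * (n : ℝ) ^ (-(1 / 10) : ℝ) := by
    rw [cellTolerance, Real.sqrt_eq_rpow, ← Real.rpow_mul hn0.le, ← Real.rpow_add hn0]
    norm_num
  have hcancel : (n : ℝ) ^ (1 / 10 : ℝ) * (n : ℝ) ^ (-(1 / 10) : ℝ) = 1 := by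
    rw [← Real.rpow_add hn0, add_neg_cancel, Real.rpow_zero]
  have hdecay : (n : ℝ) ^ (1 / 10 - 1 / 29 : ℝ) * (n : ℝ) ^ (-(1 / 10) : ℝ) =
      (n : ℝ) ^ (-(1 / 29) : ℝ) := by
    rw [← Real.rpow_add hn0]
    norm_num
  rw [discretizationError, hsqrt, ← hdecay]
  set y := (n : ℝ) ^ (-(1 / 10) : ℝ)
  have : 0 < y := by positivity
  calc κ.lip * (2 / (cellCount n : ℝ)) + (cellCount n + 1 : ℕ) * (2 * (y * y)) +
        κ.lip * (2 / (cellCount n : ℝ))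
      ≤ κ.lip * (2 * y) + 3 * (n : ℝ) ^ (1 / 10 : ℝ) * (2 * (y * y)) + κ.lip * (2 * y) := by
        have hcells := two_div_cellCount_le hn
        gcongr
        exact cellCount_add_one_le hn
    _ = 4 * κ.lip * y + 6 * ((n : ℝ) ^ (1 / 10 : ℝ) * y) * y := by ring
    _ = (4 * κ.lip + 6) * y := by rw [hcancel]; ring
    _ ≤ (n : ℝ) ^ (1 / 10 - 1 / 29 : ℝ) * y := by gcongr

theorem eventually_cellDeviation_tail_le (c : ℝ) :
    ∀ᶠ n : ℕ in atTop, (cellCount n + 1 : ℕ) * (2 * Real.exp (-(2 * n * cellTolerance n ^ 2))) ≤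
      1 / 4 * (1 / (n : ℝ) ^ c) := by
  have hlim := (tendsto_rpow_mul_exp_neg_mul_atTop_nhds_zero (1 / 2 + 5 * c) 2 two_pos).comp
    (tendsto_natCast_rpow_atTop (show (0 : ℝ) < 1 / 5 by norm_num))
  filter_upwards [eventually_ne_atTop 0,
    hlim.eventually_le_const (show (0 : ℝ) < 1 / 24 by norm_num)] with n hn h
  have hn0 : (0 : ℝ) < n := by positivity
  have hexponent : 2 * n * cellTolerance n ^ 2 = 2 * (n : ℝ) ^ (1 / 5 : ℝ) := by
    rw [cellTolerance, ← Real.rpow_mul_natCast hn0.le, mul_assoc, ← Real.rpow_one_add' hn0.le]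
    all_goals norm_num
  have hsplit : ((n : ℝ) ^ (1 / 5 : ℝ)) ^ (1 / 2 + 5 * c) =
      (n : ℝ) ^ (1 / 10 : ℝ) * (n : ℝ) ^ c := by
    rw [← Real.rpow_mul hn0.le, ← Real.rpow_add hn0]
    congr 1
    ring
  simp only [Function.comp_apply, hsplit, neg_mul] at h
  have hc0 : 0 < (n : ℝ) ^ c := by positivity
  rw [hexponent, ← mul_div_assoc, mul_one, le_div_iff₀ hc0, mul_assoc]
  refine (mul_le_mul_of_nonneg_right (cellCount_add_one_le hn) (by positivity)).trans ?_
  linarith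

/-- Half of the power of the centred adjacency matrix whose trace is estimated, so that the trace
moment bound decays like `n ^ (-c)`. -/
def traceExponent (c : ℝ) (n : ℕ) : ℕ := ⌈(|c| + 3) * Real.log n⌉₊

theorem traceExponent_ne_zero (c : ℝ) {n : ℕ} (hlog : 0 < Real.log n) : traceExponent c n ≠ 0 :=
  (Nat.ceil_pos.2 (by positivity)).ne'

theorem traceExponent_le (c : ℝ) {n : ℕ} (hlog : 1 ≤ Real.log n) :
    (traceExponent c n : ℝ) ≤ (|c| + 4) * Real.log n := by
  have := Nat.ceil_lt_add_one (show 0 ≤ (|c| + 3) * Real.log n by positivity)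
  rw [traceExponent]
  linarith

theorem natCast_mul_exp_neg_traceExponent_le (c : ℝ) {n : ℕ} (hn : 2 ≤ n) :
    n * Real.exp (-traceExponent c n) ≤ 1 / 4 * (1 / (n : ℝ) ^ c) := by
  have hn2 : (2 : ℝ) ≤ n := by exact_mod_cast hn
  have hn0 : (0 : ℝ) < n := by linarith
  have hceil : (|c| + 3) * Real.log n ≤ traceExponent c n := Nat.le_ceil _
  have hlog : 0 ≤ Real.log n := Real.log_natCast_nonneg n
  calc n * Real.exp (-traceExponent c n) ≤ n * Real.exp (Real.log n * -(3 + c)) := by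
        gcongr
        nlinarith [le_abs_self c]
    _ = (n : ℝ) ^ (1 + -(3 + c)) := by
        rw [← Real.rpow_def_of_pos hn0, Real.rpow_add hn0, Real.rpow_one]
    _ = ((n : ℝ) ^ 2)⁻¹ * (1 / (n : ℝ) ^ c) := by
        rw [show 1 + -(3 + c) = -2 + -c by ring, Real.rpow_add hn0, Real.rpow_neg hn0.le,
          Real.rpow_two, Real.rpow_neg hn0.le, one_div]
    _ ≤ 1 / 4 * (1 / (n : ℝ) ^ c) := by
        rw [one_div 4]
        gcongr
        nlinarith

variable {ρ t : ℕ → ℝ}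

theorem eventually_trace_tail_le (hρ : ∀ᶠ n in atTop, 0 < ρ n) (ht : ∀ᶠ n in atTop, 0 < t n)
    (hlogt : (fun n : ℕ => Real.log n) =o[atTop] (fun n => t n ^ 2 / ρ n)) (c : ℝ) :
    ∀ᶠ n : ℕ in atTop, n * (traceExponent c n * ρ n * Real.exp 2 / t n ^ 2) ^ traceExponent c n ≤
      1 / 4 * (1 / (n : ℝ) ^ c) := by
  have hK : 0 < Real.exp 3 * (|c| + 4) := by positivity
  have hpos : ∀ᶠ n in atTop, 0 ≤ t n ^ 2 / ρ n := hρ.mono fun n hn => by positivity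
  filter_upwards [hρ, ht, eventually_one_le_log, eventually_const_mul_log_le hpos hlogt hK,
    eventually_ge_atTop 2] with n hρ ht hlog hK hn
  have hbase : traceExponent c n * ρ n * Real.exp 2 / t n ^ 2 ≤ Real.exp (-1) := by
    have hle : Real.exp 3 * traceExponent c n ≤ t n ^ 2 / ρ n := by
      refine le_trans ?_ hK
      rw [mul_assoc]
      exact mul_le_mul_of_nonneg_left (traceExponent_le c hlog) (Real.exp_nonneg 3)
    rw [le_div_iff₀ hρ] at hle
    rw [div_le_iff₀ (by positivity)]
    calc traceExponent c n * ρ n * Real.exp 2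
        = Real.exp (-1) * (Real.exp 3 * traceExponent c n * ρ n) := by
          rw [show (2 : ℝ) = -1 + 3 by norm_num, Real.exp_add]
          ring
      _ ≤ Real.exp (-1) * t n ^ 2 := by gcongr
  calc n * (traceExponent c n * ρ n * Real.exp 2 / t n ^ 2) ^ traceExponent c n
      ≤ n * Real.exp (-1) ^ traceExponent c n := by gcongr
    _ = n * Real.exp (-traceExponent c n) := by rw [← Real.exp_nat_mul, mul_neg_one]
    _ ≤ 1 / 4 * (1 / (n : ℝ) ^ c) := natCast_mul_exp_neg_traceExponent_le c hn

theorem eventually_rpow_le_threshold (hρ : ∀ᶠ n : ℕ in atTop, 0 < ρ n ∧ ρ n ≤ n)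
    (ht : ∀ᶠ n in atTop, 0 < t n)
    (hlogt : (fun n : ℕ => Real.log n) =o[atTop] (fun n => t n ^ 2 / ρ n)) :
    ∀ᶠ n : ℕ in atTop, (n : ℝ) ^ (-(1 / 29) : ℝ) ≤ (t n / ρ n) ^ (2 / 29 : ℝ) := by
  have hpos : ∀ᶠ n in atTop, 0 ≤ t n ^ 2 / ρ n :=
    hρ.mono fun n hn => div_nonneg (sq_nonneg _) hn.1.le
  filter_upwards [hρ, ht, eventually_one_le_log, eventually_const_mul_log_le hpos hlogt one_pos]
    with n hρ ht hlog hK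
  obtain ⟨hρ0, hρn⟩ := hρ
  have hinv : (n : ℝ)⁻¹ ≤ (t n / ρ n) ^ (2 : ℝ) := by
    have hle : 1 ≤ t n ^ 2 / ρ n := by linarith
    calc (n : ℝ)⁻¹ ≤ (ρ n)⁻¹ := inv_anti₀ hρ0 hρn
      _ ≤ t n ^ 2 / ρ n * (ρ n)⁻¹ := le_mul_of_one_le_left (inv_nonneg.2 hρ0.le) hle
      _ = (t n / ρ n) ^ (2 : ℝ) := by
          rw [Real.rpow_two]
          field_simp
  calc (n : ℝ) ^ (-(1 / 29) : ℝ) = ((n : ℝ)⁻¹) ^ (1 / 29 : ℝ) := by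
        rw [Real.rpow_neg (Nat.cast_nonneg n), Real.inv_rpow (Nat.cast_nonneg n)]
    _ ≤ ((t n / ρ n) ^ (2 : ℝ)) ^ (1 / 29 : ℝ) := by gcongr
    _ = (t n / ρ n) ^ (2 / 29 : ℝ) := by
        rw [← Real.rpow_mul (by positivity)]
        norm_num

theorem le_rpow_sq {ε : ℝ} (h0 : 0 < ε) (h1 : ε ≤ 1) : ε ≤ (ε ^ (2 / 29 : ℝ)) ^ 2 := by
  rw [← Real.rpow_mul_natCast h0.le]
  exact Real.self_le_rpow_of_le_one h0.le h1 (by norm_num)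

end Asymptotics

section ModelLaw

/-- The samples and graphs for which the centred adjacency matrix has a `2 * s`-th power of too
large trace, or the empirical mass of some cell is far from its mass. -/
def atypicalEvent (κ : SmallWorldKernel) (D : Measure I) (C t : ℝ) (n s : ℕ) :
    Set ((Fin n → I) × (Sym2 (Fin n) → Bool)) :=
  {ω | t ^ (2 * s) < ((adjacency ω.2 - C⁻¹ • gramMatrix κ ω.1) ^ (2 * s)).trace} ∪
    {ω | ω.1 ∈ cellDeviation D n (cellIndex (cellCount n)) (cellTolerance n)}

variable {κ : SmallWorldKernel} {D : Measure I} [IsProbabilityMeasure D] {C ρ t : ℕ → ℝ}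

theorem eventually_pos_and_le (hC : ∀ᶠ n in atTop, 1 ≤ C n) (hρ : ∀ n : ℕ, ρ n = n / C n) :
    ∀ᶠ n : ℕ in atTop, 0 < ρ n ∧ ρ n ≤ n := by
  filter_upwards [hC, eventually_gt_atTop 0] with n hC hn
  rw [hρ n]
  exact ⟨by positivity, div_le_self (Nat.cast_nonneg n) hC⟩

theorem eventually_modelLaw_atypicalEvent_lt (hC : ∀ᶠ n in atTop, 1 ≤ C n)
    (hρ : ∀ n : ℕ, ρ n = n / C n) (ht : ∀ᶠ n in atTop, 0 < t n)
    (hlogρ : (fun n : ℕ => Real.log n) =o[atTop] ρ)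
    (hlogt : (fun n : ℕ => Real.log n) =o[atTop] (fun n => t n ^ 2 / ρ n)) (c : ℝ) :
    ∀ᶠ n : ℕ in atTop, modelLaw κ D (C n) n (atypicalEvent κ D (C n) (t n) n (traceExponent c n)) <
      ENNReal.ofReal (1 / (n : ℝ) ^ c) := by
  have hρ0 : ∀ᶠ n in atTop, 0 < ρ n := (eventually_pos_and_le hC hρ).mono fun n h => h.1
  filter_upwards [hC, ht, eventually_ne_atTop 0, eventually_one_le_log,
    eventually_const_mul_log_le (hρ0.mono fun n h => h.le) hlogρ (show 0 < |c| + 4 by positivity),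
    eventually_trace_tail_le hρ0 ht hlogt c, eventually_cellDeviation_tail_le c]
    with n hC ht hn hlog hlogρ htrace hcells
  have : NeZero n := ⟨hn⟩
  have hpos : 0 < 1 / (n : ℝ) ^ c := by positivity
  rw [hρ n] at hlogρ htrace
  have hcell := pi_cellDeviation_le (D := D) (n := n) (measurable_cellIndex (cellCount n))
    (cellTolerance_nonneg n)
  rw [← modelLaw_fst_preimage κ D (C n)
    (measurableSet_cellDeviation D n (measurable_cellIndex _) _)] at hcell
  calc modelLaw κ D (C n) n (atypicalEvent κ D (C n) (t n) n (traceExponent c n))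
      ≤ ENNReal.ofReal (1 / 4 * (1 / (n : ℝ) ^ c)) + ENNReal.ofReal (1 / 4 * (1 / (n : ℝ) ^ c)) :=
        (measure_union_le _ _).trans (add_le_add
          ((modelLaw_trace_pow_gt_le κ D hC hn ht (traceExponent_ne_zero c (one_pos.trans_le hlog))
            ((traceExponent_le c hlog).trans hlogρ)).trans (ENNReal.ofReal_le_ofReal htrace))
          (hcell.trans (ENNReal.ofReal_le_ofReal hcells)))
    _ = ENNReal.ofReal (1 / 4 * (1 / (n : ℝ) ^ c) + 1 / 4 * (1 / (n : ℝ) ^ c)) :=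
        (ENNReal.ofReal_add (by positivity) (by positivity)).symm
    _ < ENNReal.ofReal (1 / (n : ℝ) ^ c) := by
        rw [ENNReal.ofReal_lt_ofReal_iff hpos]
        linarith

theorem eventually_exists_thresholdIndex_alignment {lam : ℕ → ℝ}
    (hlam : IsEigenvalueSequence (κ.integralOperator D) lam) (hC : ∀ᶠ n in atTop, 1 ≤ C n)
    (hρ : ∀ n : ℕ, ρ n = n / C n) (ht : ∀ᶠ n in atTop, 0 < t n) (htρ : t =o[atTop] ρ)
    (hlogt : (fun n : ℕ => Real.log n) =o[atTop] (fun n => t n ^ 2 / ρ n)) (c : ℝ) :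
    ∀ᶠ n : ℕ in atTop, ∀ ω ∉ atypicalEvent κ D (C n) (t n) n (traceExponent c n),
      ∃ (d : ℕ) (hd : d ≤ n), IsThresholdIndex (adjacency ω.2) (t n) (ρ n) d ∧
        0 < eigengap lam d ∧ ∀ UA VA UK VK : Matrix (Fin n) (Fin n) ℝ,
          IsSVD (adjacency ω.2) UA VA → IsSVD (gramMatrix κ ω.1) UK VK →
          ∃ W ∈ Matrix.orthogonalGroup (Fin d) ℝ,
            frobeniusNorm (√(C n) • topEmbedding hd (adjacency ω.2) UA * W -
                topEmbedding hd (gramMatrix κ ω.1) UK) ≤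
              alignmentConstant lam * (t n * √(d * n) / (eigengap lam d ^ 2 * ρ n)) := by
  obtain ⟨k₀, hk1, hk₀⟩ := exists_eigengap_pos hlam
  have hρ' := eventually_pos_and_le hC hρ
  have hε : Tendsto (fun n => t n / ρ n) atTop (nhds 0) := htρ.tendsto_div_nhds_zero
  have hh : Tendsto (fun n => (t n / ρ n) ^ (2 / 29 : ℝ)) atTop (nhds 0) := by
    simpa using hε.rpow_const (p := (2 / 29 : ℝ)) (Or.inr (by norm_num))
  filter_upwards [hC, ht, hρ', eventually_one_le_log, eventually_ne_atTop 0,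
    eventually_ge_atTop k₀, hε.eventually_le_const one_pos, hh.eventually_le_const one_pos,
    hh.eventually_le_const (show 0 < eigengap lam k₀ / 14 by positivity),
    eventually_discretizationError_le κ, eventually_rpow_le_threshold hρ' ht hlogt]
    with n hC ht hρ0 hlog hn hkn hε1 hh1 hhk hη hthr ω hω
  have : NeZero n := ⟨hn⟩
  have hηh := hη.trans hthr
  obtain ⟨htrace, hcell⟩ := not_or.1 hω
  simp only [cellDeviation, Set.mem_ofPred_eq, not_exists, not_lt] at htrace hcell
  exact exists_thresholdIndex_alignment hlam hn (one_pos.trans_le hC) (hρ n) ht rfl ω.1 ω.2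
    (norm_toEuclideanLin_le_of_trace_pow_le (isHermitian_adjacency_sub_gramMatrix κ _ _ _) ht.le
      (traceExponent_ne_zero c (one_pos.trans_le hlog)) htrace)
    (fun v => (neg_discretizationError_mul_le_inner_gramMatrix hlam (cellCount_ne_zero hn)
      hcell v).trans' (by gcongr))
    (fun k => (abs_singularValues_gramMatrix_sub_le hlam (cellCount_ne_zero hn) hcell k).trans hηh)
    (le_rpow_sq (div_pos ht hρ0.1) hε1) hh1 hk1 hkn (by linarith)

end ModelLaw

end

end LatentGraph

open LatentGraph in
theorem mainTheorem8 (κ : SmallWorldKernel) (D : Measure I) [IsProbabilityMeasure D]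
    (lam : ℕ → ℝ) (hlam : IsEigenvalueSequence (κ.integralOperator D) lam) :
    ∃ M : ℝ, 0 < M ∧
      ∀ C ρ t : ℕ → ℝ, (∀ᶠ n in atTop, 1 ≤ C n) → (∀ n : ℕ, ρ n = n / C n) →
        (∀ᶠ n in atTop, 0 < t n) →
        (fun n : ℕ => Real.log n) =o[atTop] ρ →
        t =o[atTop] ρ →
        (fun n : ℕ => Real.log n) =o[atTop] (fun n => t n ^ 2 / ρ n) →
        ∀ c : ℝ, ∀ᶠ n : ℕ in atTop,
          modelLaw κ D (C n) n
            {ω | ¬ ∃ (d : ℕ) (hd : d ≤ n), IsThresholdIndex (adjacency ω.2) (t n) (ρ n) d ∧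
              0 < eigengap lam d ∧
              ∀ UA VA UK VK : Matrix (Fin n) (Fin n) ℝ,
                IsSVD (adjacency ω.2) UA VA → IsSVD (gramMatrix κ ω.1) UK VK →
                ∃ W ∈ Matrix.orthogonalGroup (Fin d) ℝ,
                  frobeniusNorm (√(C n) • topEmbedding hd (adjacency ω.2) UA * W -
                      topEmbedding hd (gramMatrix κ ω.1) UK) ≤
                    M * (t n * √(d * n) / (eigengap lam d ^ 2 * ρ n))}
            < ENNReal.ofReal (1 / (n : ℝ) ^ c) := by
  refine ⟨alignmentConstant lam, alignmentConstant_pos (eigenvalue_zero_pos hlam),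
    fun C ρ t hC hρ ht hlogρ htρ hlogt c => ?_⟩
  filter_upwards [eventually_modelLaw_atypicalEvent_lt (κ := κ) (D := D) hC hρ ht hlogρ hlogt c,
    eventually_exists_thresholdIndex_alignment hlam hC hρ ht htρ hlogt c] with n hprob halign
  exact (measure_mono fun ω => not_imp_comm.1 (halign ω)).trans_lt hprob
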